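/- **Determinant on the unit hemisphere.** For $r_0>0$, equip the closed unit disk $\{0\le r\le 1\}$ with the metric $e^{2\sigma_+}(dr^2+r^2d\theta^2)$, $e^{\sigma_+}=\frac{2r_0}{1+r_0^2r^2}$, of Gaussian curvature $1$ (for $r_0=1$ it is the unit hemisphere). Let $\Delta_+=-e^{-2\sigma_+}\bigl(\tfrac1r\partial_r(r\partial_r)+\tfrac1{r^2}\partial_\theta^2\bigr)$ be its positive Laplacian with Dirichlet boundary conditions, with eigenvalues $\lambda_0\le\lambda_1\le\cdots$ repeated according to multiplicity. For $M^2\in\mathbb R$, choose $p_0$ with $\lambda_p+M^2>0$ for all $p\ge p_0$, let $\zeta^{p_0}(s)$ be the meromorphic continuation to $\mathbb C$ of $\sum_{p\ge p_0}(\lambda_p+M^2)^{-s}$ ($\operatorname{Re}s>1$), and define the zeta-regularized determinant $$D^+(M^2,r_0)=\prod_{p<p_0}(\lambda_p+M^2)\; e^{-(\zeta^{p_0})'(0)},$$ which does not depend on $p_0$. In particular $D^+(M^2,r_0)=e^{-\zeta'(0)}$ with $\zeta=\zeta^{0}$ when all $\lambda_p+M^2$ are positive. Let $\zeta_{\mathrm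 R}$ be the Riemann zeta function and $\mathsf G$ the Barnes $G$-function, $$\mathsf G(1+z)=(2\pi)^{z/2}e^{-\frac12(z+(1+\gamma)z^2)}\prod_{k\ge1}\Bigl(1+\frac zk\Bigr)^{k}e^{\frac{z^2}{2k}-z},$$ where $\gamma$ is Euler's constant. Let $r_0=1$ and let $M^2$ be real. Then the Dirichlet spectrum and the continued zeta function exist, the latter is regular at $s=0$, and, $\sqrt{1-4M^2}$ being either complex square root, the following hold. 1. If $M^2>-2$ (that is, if all $\lambda_p+M^2$ are positive), then $D^+(M^2,1)>0$; and if moreover $M^2\neq0$, then $$\ln D^+(M^2,1)=-\tfrac12\ln(2\pi)+\tfrac14-2\zeta_{\mathrm R}'(-1)-M^2-\ln\Bigl[\tfrac1\pi\cos\bigl(\tfrac\pi2\sqrt{1-4M^2}\bigr)\Bigr]+\ln\Bigl[\mathsf G\bigl(\tfrac12(1+\sqrt{1-4M^2})\bigr)\,\mathsf G\bigl(\tfrac12(1-\sqrt{1-4M^2})\bigr)\Bigr],$$ with principal logarithms (for $-2<M^2<0$ both arguments are negative, and the imaginary parts cancel). 2. At $M^2=0$, where the cosine and a factor $\mathsf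 G$ both vanish, $\ln D^+(0,1)=-\tfrac12\ln(2\pi)+\tfrac14-2\zeta_{\mathrm R}'(-1)$. 3. For every real $M^2$ not of the form $-k(k+1)$, $k=0,1,2,\dots$, $$D^+(M^2,1)=e^{-\frac12\ln(2\pi)+\frac14-2\zeta_{\mathrm R}'(-1)-M^2}\;\frac{\mathsf G\bigl(\tfrac12(1+\sqrt{1-4M^2})\bigr)\,\mathsf G\bigl(\tfrac12(1-\sqrt{1-4M^2})\bigr)}{\tfrac1\pi\cos\bigl(\tfrac\pi2\sqrt{1-4M^2}\bigr)}.$$ 4. If $M^2=-k(k+1)$ with an integer $k\ge1$, then $D^+(M^2,1)=0$. -/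

import Mathlib

noncomputable section

/-- The conformal factor `e^{σ₊}` (with `L = 1`) of the round metric of Gaussian curvature `1` on the
closed unit disk, as a function of the radial coordinate `r`: the metric is
`e^{2σ₊} (dr² + r² dθ²)`. -/
def confFactor (r₀ r : ℝ) : ℝ := 2 * r₀ / (1 + r₀ ^ 2 * r ^ 2)

/-- The positive Laplacian of the curved disk, `Δ₊ f = - e^{-2σ₊} (∂ₓ² + ∂ᵧ²) f`. The disk is the
unit disk of `ℂ = ℝ²`, and `∂ₓ² + ∂ᵧ² = r⁻¹ ∂ᵣ (r ∂ᵣ) + r⁻² ∂_θ²` is the flat Laplacian. -/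
def diskLaplacian (r₀ : ℝ) (f : ℂ → ℂ) (z : ℂ) : ℂ :=
  -(((confFactor r₀ ‖z‖ ^ 2)⁻¹ : ℝ) : ℂ) * Laplacian.laplacian f z

/-- The eigenspace of the Dirichlet Laplacian of the disk for `μ`: functions on the closed unit disk
(extended by `0` to the plane) that are continuous, vanish on the boundary circle, are twice
continuously differentiable inside and satisfy `Δ₊ f = μ f` there. -/
def dirichletEigenspace (r₀ μ : ℝ) : Submodule ℂ (ℂ → ℂ) where
  carrier := {f | Continuous f ∧ (∀ z : ℂ, 1 ≤ ‖z‖ → f z = 0) ∧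
    ContDiffOn ℝ 2 f (Metric.ball 0 1) ∧
    ∀ z ∈ Metric.ball (0 : ℂ) 1, diskLaplacian r₀ f z = (μ : ℂ) * f z}
  zero_mem' := by
    refine ⟨continuous_const, fun _ _ => rfl, contDiffOn_const, fun z _ => ?_⟩
    have h : (0 : ℂ → ℂ) = fun _ => 0 := rfl
    rw [h]
    simp [diskLaplacian]
  add_mem' := by
    rintro f g ⟨hf1, hf2, hf3, hf4⟩ ⟨hg1, hg2, hg3, hg4⟩
    refine ⟨hf1.add hg1, fun z hz => by simp [hf2 z hz, hg2 z hz], hf3.add hg3, fun z hz => ?_⟩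
    have hn := Metric.isOpen_ball.mem_nhds hz
    have e1 := hf4 z hz
    have e2 := hg4 z hz
    unfold diskLaplacian at e1 e2 ⊢
    rw [(hf3.contDiffAt hn).laplacian_add (hg3.contDiffAt hn), Pi.add_apply, mul_add, mul_add,
      e1, e2]
  smul_mem' := by
    rintro c f ⟨hf1, hf2, hf3, hf4⟩
    refine ⟨hf1.const_smul c, fun z hz => by simp [hf2 z hz], contDiffOn_const.smul hf3,
      fun z hz => ?_⟩
    have hn := Metric.isOpen_ball.mem_nhds hz
    have e1 := hf4 z hz
    unfold diskLaplacian at e1 ⊢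
    rw [InnerProductSpace.laplacian_smul c (hf3.contDiffAt hn), Pi.smul_apply, smul_eq_mul,
      smul_eq_mul, mul_left_comm, e1, mul_left_comm]

/-- `lam 0 ≤ lam 1 ≤ ⋯` lists the eigenvalues of the Dirichlet Laplacian of the disk with
parameter `r₀`, each repeated according to its multiplicity. -/
def IsDirichletSpectrum (r₀ : ℝ) (lam : ℕ → ℝ) : Prop :=
  Monotone lam ∧
    ∀ μ : ℝ, {p | lam p = μ}.encard = Cardinal.toENat (Module.rank ℂ (dirichletEigenspace r₀ μ))

/-- `Z` is the meromorphic continuation, regular at `s = 0`, of the zeta function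
`∑_{p ≥ p₀} (lam p + M²)^{-s}`, `Re s > 1`, where all `lam p + M²` with `p ≥ p₀` are positive.
`M2` stands for `M²`. -/
def IsZetaFunction (lam : ℕ → ℝ) (M2 : ℝ) (p₀ : ℕ) (Z : ℂ → ℂ) : Prop :=
  (∀ p, p₀ ≤ p → 0 < lam p + M2) ∧
    (∀ s : ℂ, 1 < s.re → HasSum (fun k : ℕ => ((lam (p₀ + k) + M2 : ℝ) : ℂ) ^ (-s)) (Z s)) ∧
    Meromorphic Z ∧ AnalyticAt ℂ Z 0

/-- `D` is the zeta-regularized determinant `det (Δ₊ + M²)` of the Dirichlet Laplacian of the disk: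
`D = (∏_{p < p₀} (λ_p + M²)) exp (- Z'(0))`, with `Z` the zeta function of the eigenvalues
`λ_p + M²`, `p ≥ p₀`, all of which are positive. When all `λ_p + M²` are positive, `p₀ = 0` gives
`D = exp (- ζ'(0))`. The value does not depend on the choice of `p₀`. -/
def IsZetaDeterminant (M2 r₀ D : ℝ) : Prop :=
  ∃ lam : ℕ → ℝ, IsDirichletSpectrum r₀ lam ∧ ∃ (p₀ : ℕ) (Z : ℂ → ℂ), IsZetaFunction lam M2 p₀ Z ∧
    (D : ℂ) = ((∏ p ∈ Finset.range p₀, (lam p + M2) : ℝ) : ℂ) * Complex.exp (-deriv Z 0)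

/-- The determinant `D⁺(M², r₀)`. -/
def detPlus (M2 r₀ : ℝ) : ℝ := Classical.epsilon (IsZetaDeterminant M2 r₀)

/-- The Barnes `G`-function, by its Weierstrass product
`G(1 + w) = (2π)^{w/2} e^{-(w + (1 + γ) w²)/2} ∏_{k ≥ 1} (1 + w/k)^k e^{w²/(2k) - w}`
at `w = z - 1`. -/
def barnesG (z : ℂ) : ℂ :=
  (2 * Real.pi : ℂ) ^ ((z - 1) / 2) *
    Complex.exp (-((z - 1) + (1 + Real.eulerMascheroniConstant) * (z - 1) ^ 2) / 2) *
    ∏' k : ℕ, (1 + (z - 1) / (k + 1)) ^ (k + 1) *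
      Complex.exp ((z - 1) ^ 2 / (2 * (k + 1)) - (z - 1))

end

/-!
The unit disk with `r₀ = 1` is the hemisphere `x₃ ≥ 0` of the unit sphere in stereographic
coordinates. The proof has three parts.

**Spectrum.** The functions `hemiFun a b`, which are the polynomials `x₃ (x₁ + i x₂)ᵃ (x₁ - i x₂)ᵇ`
up to constants, vanish on the equator, and the Laplacian acts on them triangularly
(`diskLaplacian_hemiFun`): `hemiFun a b` goes to `l (l + 1) hemiFun a b`, with `l = a + b + 1`, plus a
multiple of `hemiFun (a - 1) (b - 1)`. By Green's identity, applied through a radial cutoff because an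
eigenfunction is only assumed continuous up to the boundary, the `L²`-pairings of an eigenfunction
with the `hemiFun a b` satisfy the dual recursion (`hemiPairing_recursion`). By Stone–Weierstrass
these pairings determine the function (`eq_zero_of_hemiPairing_eq_zero`), so the only possible
eigenvalues are `l (l + 1)`, `l ≥ 1`, with multiplicity at most `l`. Solving the triangular system
gives `l` eigenfunctions, which rotations separate, so the multiplicity is exactly `l`
(`toENat_rank_dirichletEigenspace`).

**Zeta function.** The eigenvalues of degree at most some `n ≥ |M²|` are split off. For the others,
`l (l + 1) + M² = l² (1 + x_l)` with `x_l = (l + M²) / l²`, and the binomial expansion of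
`(1 + x_l)^{-s}` writes the zeta function as finitely many tails of the Riemann zeta function at
shifted arguments plus a remainder that is analytic on a half-plane as far to the left as desired.
Three terms of the expansion reach `s = 0`, where the derivative is read off as
`-2 ζ'(-1)`, elementary constants and a convergent series of logarithms (`exists_isZetaFunction`).
The identity theorem shows that the determinant does not depend on the choices made
(`IsZetaDeterminant.unique`).

**Closed form.** Let `z, z' = (1 ± w) / 2` with `w² = 1 - 4 M²`, so that `z + z' = 1` and `z z' = M²`.
Then `(1 + z / l) (1 + z' / l) = 1 + x_l`, and the product of the Weierstrass products of `G (1 + z)`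
and `G (1 + z')` is the regularized product of the eigenvalues. This gives the determinant as an
exponential times `G (1 + z) G (1 + z')` for every `M²` (`exists_isZetaDeterminant`). The functional
equation `G (1 + z) = Γ(z) G(z)` (`barnesG_add_one`) and the reflection formula
`Γ(z) Γ(1 - z) = π / sin (π z)`, with `sin (π z) = cos (π w / 2)`, lead to the stated form; at `M² = 0` the
version before the functional equation is evaluated directly, and at the other excluded values one of
the eigenvalues split off is `-M²`, so the determinant vanishes.
-/

open Complex Filter Topology MeasureTheory Set
open scoped ComplexConjugate

/-! ### The flat Laplacian in Wirtinger form -/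

/-- The real-linear map `v ↦ A v + B v̄`: the differential of a function with Wirtinger derivatives
`A = ∂f` and `B = ∂̄f`. -/
noncomputable def wirtingerMap (A B : ℂ) : ℂ →L[ℝ] ℂ :=
  A • (1 : ℂ →L[ℝ] ℂ) + B • (conjCLE : ℂ →L[ℝ] ℂ)

@[simp] lemma wirtingerMap_apply (A B v : ℂ) : wirtingerMap A B v = A * v + B * conj v := by
  simp [wirtingerMap]

/-- The Laplacian in Wirtinger form: `Δ f = 2 (∂̄∂ f + ∂∂̄ f)`. -/
lemma laplacian_eq_of_wirtinger {f A B : ℂ → ℂ} {z A₁ A₂ B₁ B₂ : ℂ}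
    (hf : ∀ᶠ u in 𝓝 z, HasFDerivAt f (wirtingerMap (A u) (B u)) u)
    (hA : HasFDerivAt A (wirtingerMap A₁ A₂) z) (hB : HasFDerivAt B (wirtingerMap B₁ B₂) z) :
    Laplacian.laplacian f z = 2 * (A₂ + B₁) := by
  have h1 : fderiv ℝ f =ᶠ[𝓝 z] fun u => wirtingerMap (A u) (B u) :=
    hf.mono fun u hu => hu.fderiv
  have h2 : HasFDerivAt (fun u => wirtingerMap (A u) (B u))
      ((wirtingerMap A₁ A₂).smulRight (1 : ℂ →L[ℝ] ℂ) +
        (wirtingerMap B₁ B₂).smulRight (conjCLE : ℂ →L[ℝ] ℂ)) z :=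
    (hA.smul_const (1 : ℂ →L[ℝ] ℂ)).add (hB.smul_const (conjCLE : ℂ →L[ℝ] ℂ))
  have h3 := (h2.congr_of_eventuallyEq h1).fderiv
  rw [InnerProductSpace.laplacian_eq_iteratedFDeriv_complexPlane]
  simp only [iteratedFDeriv_two_apply, h3]
  simp [-I_mul_I]
  linear_combination (A₁ - A₂ - B₁ + B₂) * I_mul_I

/-- The function `z ↦ zᵃ z̄ᵇ k(|z|²)`. -/
noncomputable def radialMonomial (a b : ℕ) (k : ℝ → ℝ) (z : ℂ) : ℂ :=
  z ^ a * conj z ^ b * (k (normSq z) : ℂ)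

lemma hasFDerivAt_normSq (z : ℂ) :
    HasFDerivAt (fun z => ((normSq z : ℝ) : ℂ)) (wirtingerMap (conj z) z) z := by
  have h1 : HasFDerivAt (fun z : ℂ => z) (1 : ℂ →L[ℝ] ℂ) z := hasFDerivAt_id z
  have h2 : HasFDerivAt (fun z : ℂ => conj z) (conjCLE : ℂ →L[ℝ] ℂ) z := conjCLE.hasFDerivAt
  have := h1.mul h2
  refine (this.congr_of_eventuallyEq (.of_forall fun w => ?_)).congr_fderiv ?_
  · simp [mul_conj]
  · ext v; simp; ring

lemma HasDerivAt.hasFDerivAt_comp_normSq {k : ℝ → ℝ} {k' : ℝ} {z : ℂ}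
    (hk : HasDerivAt k k' (normSq z)) :
    HasFDerivAt (fun z => ((k (normSq z) : ℝ) : ℂ)) (wirtingerMap (k' * conj z) (k' * z)) z := by
  have h0 : HasFDerivAt (fun z : ℂ => normSq z)
      (reCLM.comp (wirtingerMap (conj z) z)) z := by
    simpa [Function.comp_def] using (reCLM.hasFDerivAt (x := ((normSq z : ℝ) : ℂ))).comp z
      (hasFDerivAt_normSq z)
  have h1 := ofRealCLM.hasFDerivAt.comp z (hk.comp_hasFDerivAt z h0)
  refine h1.congr_fderiv ?_
  ext v
  apply Complex.ext <;> simp <;> ring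

lemma hasFDerivAt_radialMonomial {a b : ℕ} {k k' : ℝ → ℝ} {z : ℂ}
    (hk : HasDerivAt k (k' (normSq z)) (normSq z)) :
    HasFDerivAt (radialMonomial a b k)
      (wirtingerMap (a * radialMonomial (a - 1) b k z + radialMonomial a (b + 1) k' z)
        (b * radialMonomial a (b - 1) k z + radialMonomial (a + 1) b k' z)) z := by
  have h1 : HasFDerivAt (fun z : ℂ => z ^ a) (wirtingerMap (a * z ^ (a - 1)) 0) z := by
    refine ((hasDerivAt_pow a z).hasFDerivAt.restrictScalars ℝ).congr_fderiv ?_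
    ext v; simp; ring
  have h2 : HasFDerivAt (fun z : ℂ => conj z ^ b) (wirtingerMap 0 (b * conj z ^ (b - 1))) z := by
    refine (((hasDerivAt_pow b (conj z)).hasFDerivAt.restrictScalars ℝ).comp z
      (conjCLE : ℂ →L[ℝ] ℂ).hasFDerivAt).congr_fderiv ?_
    ext v; simp; ring
  refine ((h1.mul h2).mul hk.hasFDerivAt_comp_normSq).congr_fderiv ?_
  ext v
  simp [radialMonomial]
  ring

/-- In the case `a b = 0` the truncated exponent `a - 1` or `b - 1` is harmless, since the last term
has coefficient zero. -/
lemma laplacian_radialMonomial {a b : ℕ} {k k' k'' : ℝ → ℝ}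
    (hk : ∀ t, 0 ≤ t → HasDerivAt k (k' t) t) (hk' : ∀ t, 0 ≤ t → HasDerivAt k' (k'' t) t) (z : ℂ) :
    Laplacian.laplacian (radialMonomial a b k) z =
      radialMonomial a b (fun t => 4 * t * k'' t + 4 * (a + b + 1) * k' t) z
        + 4 * a * b * radialMonomial (a - 1) (b - 1) k z := by
  have h1 := fun a b u => hasFDerivAt_radialMonomial (a := a) (b := b) (hk _ (normSq_nonneg u))
  have h2 := fun a b => hasFDerivAt_radialMonomial (a := a) (b := b) (hk' _ (normSq_nonneg z))
  have hA := ((h1 (a - 1) b z).const_mul (a : ℂ)).add (h2 a (b + 1))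
  have hB := ((h1 a (b - 1) z).const_mul (b : ℂ)).add (h2 (a + 1) b)
  have e : ∀ A₁ A₂ A₃ A₄ c : ℂ, c • wirtingerMap A₁ A₂ + wirtingerMap A₃ A₄ =
      wirtingerMap (c * A₁ + A₃) (c * A₂ + A₄) := by
    intros; ext v; simp; ring
  rw [e] at hA hB
  rw [laplacian_eq_of_wirtinger (Eventually.of_forall (h1 a b)) hA hB]
  have hz : ((normSq z : ℝ) : ℂ) = z * conj z := (mul_conj z).symm
  simp only [radialMonomial]
  push_cast
  rw [hz]
  rcases a with _ | a <;> rcases b with _ | b <;> simp <;> ring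

/-! ### The basic functions and the triangular action of the Laplacian -/

/-- The radial profile of the basic functions `zᵃ z̄ᵇ (1 - t) / (1 + t)^{d + 1}`, `d = a + b`,
`t = |z|²`. -/
noncomputable def profile (d : ℕ) (t : ℝ) : ℝ := (1 - t) * ((1 + t)⁻¹) ^ (d + 1)

/-- The derivative of `profile d` on `t ≥ 0`. -/
noncomputable def profileDeriv (d : ℕ) (t : ℝ) : ℝ :=
  -((1 + t)⁻¹) ^ (d + 1) - (d + 1) * (1 - t) * ((1 + t)⁻¹) ^ (d + 2)

/-- The second derivative of `profile d` on `t ≥ 0`. -/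
noncomputable def profileDeriv₂ (d : ℕ) (t : ℝ) : ℝ :=
  2 * (d + 1) * ((1 + t)⁻¹) ^ (d + 2) + (d + 1) * (d + 2) * (1 - t) * ((1 + t)⁻¹) ^ (d + 3)

lemma hasDerivAt_inv_one_add_pow (n : ℕ) {t : ℝ} (ht : 0 ≤ t) :
    HasDerivAt (fun t : ℝ => ((1 + t)⁻¹) ^ n) (-n * ((1 + t)⁻¹) ^ (n + 1)) t := by
  have h : (1 + t) ≠ 0 := by positivity
  refine (((hasDerivAt_id' t).const_add 1).fun_inv h |>.fun_pow n).congr_deriv ?_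
  rcases n with _ | n
  · simp
  · simp only [Nat.add_sub_cancel, ← inv_pow, div_eq_mul_inv]; ring

lemma hasDerivAt_profile (d : ℕ) {t : ℝ} (ht : 0 ≤ t) :
    HasDerivAt (profile d) (profileDeriv d t) t := by
  refine (((hasDerivAt_id' t).const_sub 1).mul
    (hasDerivAt_inv_one_add_pow (d + 1) ht)).congr_deriv ?_
  simp only [profileDeriv]; push_cast; ring

lemma hasDerivAt_profileDeriv (d : ℕ) {t : ℝ} (ht : 0 ≤ t) :
    HasDerivAt (profileDeriv d) (profileDeriv₂ d t) t := by
  refine ((hasDerivAt_inv_one_add_pow (d + 1) ht).neg.sub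
    ((((hasDerivAt_id' t).const_sub 1).const_mul ((d : ℝ) + 1)).mul
    (hasDerivAt_inv_one_add_pow (d + 2) ht))).congr_deriv ?_
  simp only [profileDeriv₂]; push_cast; ring

/-- The basic functions `zᵃ z̄ᵇ (1 - |z|²) / (1 + |z|²)^{a + b + 1}`: up to the factor `2^{a+b}`, the
polynomials `x₃ (x₁ + i x₂)ᵃ (x₁ - i x₂)ᵇ` on the unit sphere in stereographic coordinates. -/
noncomputable def hemiFun (a b : ℕ) : ℂ → ℂ := radialMonomial a b (profile (a + b))

lemma diskLaplacian_one_eq (f : ℂ → ℂ) (z : ℂ) :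
    diskLaplacian 1 f z = -(((1 + normSq z) ^ 2 / 4 : ℝ) : ℂ) * Laplacian.laplacian f z := by
  have h : (1 + normSq z) ≠ 0 := by have := normSq_nonneg z; positivity
  simp only [diskLaplacian, confFactor, ← normSq_eq_norm_sq]
  congr 3
  field_simp
  norm_num

/-- The Laplacian acts on the basic functions triangularly. -/
lemma diskLaplacian_hemiFun (a b : ℕ) (z : ℂ) :
    diskLaplacian 1 (hemiFun a b) z =
      (a + b + 1) * (a + b + 2) * hemiFun a b z - a * b * hemiFun (a - 1) (b - 1) z := by
  have ht := normSq_nonneg z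
  have h : (1 + normSq z) ≠ 0 := by positivity
  have hc : (1 + (normSq z : ℂ)) ≠ 0 := by exact_mod_cast h
  rw [diskLaplacian_one_eq, hemiFun, laplacian_radialMonomial
    (fun t => hasDerivAt_profile _) (fun t => hasDerivAt_profileDeriv _)]
  have e1 : (1 + normSq z) ^ 2 / 4 * (4 * normSq z * profileDeriv₂ (a + b) (normSq z) +
      4 * (a + b + 1) * profileDeriv (a + b) (normSq z)) =
      - ((a + b + 1) * (a + b + 2) * profile (a + b) (normSq z)) := by
    simp only [profile, profileDeriv, profileDeriv₂, pow_succ]; push_cast; field_simp; ring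
  have e1' := congrArg (fun x : ℝ => (x : ℂ)) e1
  have e2 : (a * b : ℂ) * radialMonomial (a - 1) (b - 1) (profile (a + b)) z * (1 + normSq z) ^ 2 =
      a * b * hemiFun (a - 1) (b - 1) z := by
    rcases a with _ | a
    · simp
    rcases b with _ | b
    · simp
    have : a + 1 + (b + 1) = (a + b) + 2 := by ring
    simp only [hemiFun, radialMonomial, Nat.add_sub_cancel, profile, this]
    have e3 : ((1 + (normSq z : ℂ))⁻¹) ^ (a + b + 2 + 1) * (1 + normSq z) ^ 2 =
        ((1 + (normSq z : ℂ))⁻¹) ^ (a + b + 1) := by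
      rw [show a + b + 2 + 1 = (a + b + 1) + 2 by ring, pow_add, mul_assoc, ← mul_pow,
        inv_mul_cancel₀ hc, one_pow, mul_one]
    push_cast
    rw [← e3]
    ring
  push_cast at e1' ⊢
  simp only [radialMonomial] at e2 ⊢
  push_cast
  linear_combination (-(z ^ a * conj z ^ b)) * e1' - e2

/-! ### Green's identity and radial cutoffs -/

lemma laplacian_eq_fderiv_fderiv {f : ℂ → ℂ} {z : ℂ} (hf : ContDiffAt ℝ 2 f z) :
    Laplacian.laplacian f z = fderiv ℝ (fun u => fderiv ℝ f u 1) z 1 +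
      fderiv ℝ (fun u => fderiv ℝ f u I) z I := by
  have h : DifferentiableAt ℝ (fderiv ℝ f) z :=
    (hf.fderiv_right (m := 1) (by norm_num)).differentiableAt (by norm_num)
  have e : ∀ v : ℂ, fderiv ℝ (fun u => fderiv ℝ f u v) z v = fderiv ℝ (fderiv ℝ f) z v v := by
    intro v
    rw [fderiv_clm_apply h (differentiableAt_const v)]
    simp
  rw [InnerProductSpace.laplacian_eq_iteratedFDeriv_complexPlane, e, e]
  simp [iteratedFDeriv_two_apply]

/-- Integration by parts twice in the direction `v`. Only the product with the compactly supported
`G` has to be integrable, so nothing is assumed about `f` near the boundary of `U`. -/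
lemma integral_mul_fderiv_fderiv {f G : ℂ → ℂ} {U : Set ℂ} (hU : IsOpen U)
    (hf : ContDiffOn ℝ 2 f U) (hG : ContDiff ℝ 2 G) (hc : HasCompactSupport G)
    (hs : tsupport G ⊆ U) (v : ℂ) :
    ∫ z, f z * fderiv ℝ (fun u => fderiv ℝ G u v) z v =
      ∫ z, fderiv ℝ (fun u => fderiv ℝ f u v) z v * G z := by
  have hfat : ∀ z ∈ U, ContDiffAt ℝ 2 f z := fun z hz => hf.contDiffAt (hU.mem_nhds hz)
  have hf1 : ∀ z ∈ U, ContDiffAt ℝ 1 (fun u => fderiv ℝ f u v) z := fun z hz =>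
    ((hfat z hz).fderiv_right (m := 1) (by norm_num)).clm_apply contDiffAt_const
  have hf2 : ∀ z ∈ U, ContinuousAt (fun u => fderiv ℝ (fun u => fderiv ℝ f u v) u v) z :=
    fun z hz => (((hf1 z hz).fderiv_right (m := 0) (by norm_num)).clm_apply
      contDiffAt_const).continuousAt
  have hG1 : ContDiff ℝ 1 (fun u => fderiv ℝ G u v) :=
    (hG.fderiv_right (m := 1) (by norm_num)).clm_apply contDiff_const
  have hG2 : Continuous (fun u => fderiv ℝ (fun u => fderiv ℝ G u v) u v) :=
    ((hG1.fderiv_right (m := 0) (by norm_num)).clm_apply contDiff_const).continuous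
  have c1 : HasCompactSupport (fun u => fderiv ℝ G u v) := hc.fderiv_apply ℝ v
  have c2 : HasCompactSupport (fun u => fderiv ℝ (fun u => fderiv ℝ G u v) u v) :=
    c1.fderiv_apply ℝ v
  have s1 : tsupport (fun u => fderiv ℝ G u v) ⊆ tsupport G := tsupport_fderiv_apply_subset ℝ v
  have s2 : tsupport (fun u => fderiv ℝ (fun u => fderiv ℝ G u v) u v) ⊆ tsupport G :=
    (tsupport_fderiv_apply_subset ℝ v).trans s1
  have key : ∀ a b : ℂ → ℂ, (∀ z ∈ U, ContinuousAt a z) → Continuous b → HasCompactSupport b →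
      tsupport b ⊆ tsupport G → Integrable (fun z => a z * b z) := by
    intro a b ha hb hbc hbs
    refine Continuous.integrable_of_hasCompactSupport ?_ hbc.mul_left
    refine continuous_of_tsupport fun z hz => ?_
    exact (ha z (hs (hbs (tsupport_mul_subset_right hz)))).mul hb.continuousAt
  rw [integral_mul_fderiv_eq_neg_fderiv_mul_of_integrable
      (key _ _ (fun z hz => (hf1 z hz).continuousAt) hG1.continuous c1 s1)
      (key _ _ (fun z hz => (hfat z hz).continuousAt) hG2 c2 s2)
      (key _ _ (fun z hz => (hfat z hz).continuousAt) hG1.continuous c1 s1)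
      (fun z hz => (hfat z (hs (s1 hz))).differentiableAt (by norm_num))
      (fun z _ => hG1.differentiable (by norm_num) z),
    integral_mul_fderiv_eq_neg_fderiv_mul_of_integrable
      (key _ _ hf2 hG.continuous hc le_rfl)
      (key _ _ (fun z hz => (hf1 z hz).continuousAt) hG1.continuous c1 s1)
      (key _ _ (fun z hz => (hf1 z hz).continuousAt) hG.continuous hc le_rfl)
      (fun z hz => (hf1 z (hs hz)).differentiableAt (by norm_num))
      (fun z _ => hG.differentiable (by norm_num) z), neg_neg]

/-- Green's second identity for a compactly supported test function. -/
lemma integral_mul_laplacian {f G : ℂ → ℂ} {U : Set ℂ} (hU : IsOpen U)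
    (hf : ContDiffOn ℝ 2 f U) (hG : ContDiff ℝ 2 G) (hc : HasCompactSupport G)
    (hs : tsupport G ⊆ U) :
    ∫ z, f z * Laplacian.laplacian G z = ∫ z, Laplacian.laplacian f z * G z := by
  have hfat : ∀ z ∈ U, ContDiffAt ℝ 2 f z := fun z hz => hf.contDiffAt (hU.mem_nhds hz)
  have hf2 : ∀ v, ∀ z ∈ U, ContinuousAt (fun u => fderiv ℝ (fun u => fderiv ℝ f u v) u v) z :=
    fun v z hz => (((((hfat z hz).fderiv_right (m := 1) (by norm_num)).clm_apply
      contDiffAt_const).fderiv_right (m := 0) (by norm_num)).clm_apply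
      contDiffAt_const).continuousAt
  have hG2 : ∀ v, Continuous (fun u => fderiv ℝ (fun u => fderiv ℝ G u v) u v) := fun v =>
    ((((hG.fderiv_right (m := 1) (by norm_num)).clm_apply contDiff_const).fderiv_right
      (m := 0) (by norm_num)).clm_apply contDiff_const).continuous
  have c2 : ∀ v, HasCompactSupport (fun u => fderiv ℝ (fun u => fderiv ℝ G u v) u v) := fun v =>
    (hc.fderiv_apply ℝ v).fderiv_apply ℝ v
  have s2 : ∀ v, tsupport (fun u => fderiv ℝ (fun u => fderiv ℝ G u v) u v) ⊆ tsupport G :=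
    fun v => (tsupport_fderiv_apply_subset ℝ v).trans (tsupport_fderiv_apply_subset ℝ v)
  have key : ∀ a b : ℂ → ℂ, (∀ z ∈ U, ContinuousAt a z) → Continuous b → HasCompactSupport b →
      tsupport b ⊆ tsupport G → Integrable (fun z => a z * b z) := by
    intro a b ha hb hbc hbs
    refine Continuous.integrable_of_hasCompactSupport ?_ hbc.mul_left
    refine continuous_of_tsupport fun z hz => ?_
    exact (ha z (hs (hbs (tsupport_mul_subset_right hz)))).mul hb.continuousAt
  have e1 : ∀ z, f z * Laplacian.laplacian G z =
      f z * fderiv ℝ (fun u => fderiv ℝ G u 1) z 1 + f z * fderiv ℝ (fun u => fderiv ℝ G u I) z I :=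
    fun z => by rw [laplacian_eq_fderiv_fderiv hG.contDiffAt, mul_add]
  have e2 : ∀ z, Laplacian.laplacian f z * G z =
      fderiv ℝ (fun u => fderiv ℝ f u 1) z 1 * G z +
        fderiv ℝ (fun u => fderiv ℝ f u I) z I * G z := by
    intro z
    by_cases hz : z ∈ U
    · rw [laplacian_eq_fderiv_fderiv (hfat z hz), add_mul]
    · have : G z = 0 := image_eq_zero_of_notMem_tsupport fun h => hz (hs h)
      simp [this]
  simp_rw [e1, e2]
  rw [integral_add, integral_add, integral_mul_fderiv_fderiv hU hf hG hc hs,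
    integral_mul_fderiv_fderiv hU hf hG hc hs]
  · exact key _ _ (hf2 1) hG.continuous hc le_rfl
  · exact key _ _ (hf2 I) hG.continuous hc le_rfl
  · exact key _ _ (fun z hz => (hfat z hz).continuousAt) (hG2 1) (c2 1) (s2 1)
  · exact key _ _ (fun z hz => (hfat z hz).continuousAt) (hG2 I) (c2 I) (s2 I)

/-- A smooth radial cutoff, as a function of `t = |z|²`: it vanishes for `t ≥ 1 - ε` and is `1` for
`t ≤ 1 - 2 ε`. -/
noncomputable def radialCutoff (ε t : ℝ) : ℝ := Real.smoothTransition ((1 - t) / ε - 1)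

lemma deriv_smoothTransition_eq_zero {s : ℝ} (hs : s ∉ Icc (0 : ℝ) 1) :
    deriv Real.smoothTransition =ᶠ[𝓝 s] fun _ => 0 := by
  have hs' : s < 0 ∨ 1 < s := by
    by_contra h; push Not at h; exact hs ⟨h.1, h.2⟩
  rcases hs' with h | h
  · filter_upwards [Iio_mem_nhds h] with x hx
    have : Real.smoothTransition =ᶠ[𝓝 x] fun _ => 0 := by
      filter_upwards [Iio_mem_nhds hx] with y hy
      exact Real.smoothTransition.zero_of_nonpos (le_of_lt hy)
    rw [this.deriv_eq]; simp
  · filter_upwards [Ioi_mem_nhds h] with x hx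
    have : Real.smoothTransition =ᶠ[𝓝 x] fun _ => 1 := by
      filter_upwards [Ioi_mem_nhds hx] with y hy
      exact Real.smoothTransition.one_of_one_le (le_of_lt hy)
    rw [this.deriv_eq]; simp

lemma deriv_deriv_smoothTransition_eq_zero {s : ℝ} (hs : s ∉ Icc (0 : ℝ) 1) :
    deriv (deriv Real.smoothTransition) s = 0 := by
  rw [(deriv_smoothTransition_eq_zero hs).deriv_eq]; simp

lemma contDiff_deriv_smoothTransition : ContDiff ℝ 2 (deriv Real.smoothTransition) := by
  exact (contDiff_succ_iff_deriv (n := 2).1 Real.smoothTransition.contDiff).2.2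

lemma exists_bound_deriv_smoothTransition :
    ∃ C : ℝ, 0 ≤ C ∧ ∀ s, |deriv Real.smoothTransition s| ≤ C ∧
      |deriv (deriv Real.smoothTransition) s| ≤ C := by
  have hc1 : HasCompactSupport (deriv Real.smoothTransition) :=
    HasCompactSupport.intro isCompact_Icc fun s hs => (deriv_smoothTransition_eq_zero hs).eq_of_nhds
  have hc2 : HasCompactSupport (deriv (deriv Real.smoothTransition)) :=
    HasCompactSupport.intro isCompact_Icc fun s hs => deriv_deriv_smoothTransition_eq_zero hs
  have h2 : Continuous (deriv (deriv Real.smoothTransition)) :=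
    contDiff_deriv_smoothTransition.continuous_deriv (by norm_num)
  obtain ⟨C₁, h₁⟩ := contDiff_deriv_smoothTransition.continuous.bounded_above_of_compact_support hc1
  obtain ⟨C₂, h₂⟩ := h2.bounded_above_of_compact_support hc2
  refine ⟨max C₁ C₂, (norm_nonneg _).trans ((h₁ 0).trans (le_max_left _ _)), fun s => ?_⟩
  exact ⟨(h₁ s).trans (le_max_left _ _), (h₂ s).trans (le_max_right _ _)⟩

lemma hasDerivAt_radialCutoff (ε t : ℝ) :
    HasDerivAt (radialCutoff ε) (-(deriv Real.smoothTransition ((1 - t) / ε - 1)) / ε) t := by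
  have h : HasDerivAt Real.smoothTransition (deriv Real.smoothTransition ((1 - t) / ε - 1))
      ((1 - t) / ε - 1) :=
    ((Real.smoothTransition.contDiff (n := 1)).differentiable (by norm_num) _).hasDerivAt
  have h2 : HasDerivAt (fun t : ℝ => (1 - t) / ε - 1) (-1 / ε) t :=
    (((hasDerivAt_id' t).const_sub 1).div_const ε).sub_const 1
  exact (h.comp t h2).congr_deriv (by ring)

lemma hasDerivAt_deriv_radialCutoff (ε t : ℝ) :
    HasDerivAt (fun t => -(deriv Real.smoothTransition ((1 - t) / ε - 1)) / ε)
      (deriv (deriv Real.smoothTransition) ((1 - t) / ε - 1) / ε ^ 2) t := by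
  have h : HasDerivAt (deriv Real.smoothTransition)
      (deriv (deriv Real.smoothTransition) ((1 - t) / ε - 1)) ((1 - t) / ε - 1) :=
    (contDiff_deriv_smoothTransition.differentiable (by norm_num) _).hasDerivAt
  have h2 : HasDerivAt (fun t : ℝ => (1 - t) / ε - 1) (-1 / ε) t :=
    (((hasDerivAt_id' t).const_sub 1).div_const ε).sub_const 1
  have h3 := (h.comp t h2).neg.div_const ε
  exact h3.congr_deriv (by ring)

/-- The commutator of the flat Laplacian with the cutoff, on a basic function. -/
noncomputable def cutoffError (a b : ℕ) (ε : ℝ) : ℂ → ℂ :=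
  radialMonomial a b fun t =>
    8 * t * profileDeriv (a + b) t * (-(deriv Real.smoothTransition ((1 - t) / ε - 1)) / ε) +
    4 * t * profile (a + b) t * (deriv (deriv Real.smoothTransition) ((1 - t) / ε - 1) / ε ^ 2) +
    4 * (a + b + 1) * profile (a + b) t * (-(deriv Real.smoothTransition ((1 - t) / ε - 1)) / ε)

/-- A basic function multiplied by the radial cutoff. -/
noncomputable def cutoffHemiFun (a b : ℕ) (ε : ℝ) : ℂ → ℂ :=
  radialMonomial a b fun t => profile (a + b) t * radialCutoff ε t

lemma laplacian_cutoffHemiFun (a b : ℕ) (ε : ℝ) (z : ℂ) :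
    Laplacian.laplacian (cutoffHemiFun a b ε) z =
      radialCutoff ε (normSq z) * Laplacian.laplacian (hemiFun a b) z + cutoffError a b ε z := by
  have h1 := fun t (ht : 0 ≤ t) =>
    (hasDerivAt_profile (a + b) ht).fun_mul (hasDerivAt_radialCutoff ε t)
  have h2 := fun t (ht : 0 ≤ t) =>
    ((hasDerivAt_profileDeriv (a + b) ht).fun_mul (hasDerivAt_radialCutoff ε t)).fun_add
    ((hasDerivAt_profile (a + b) ht).fun_mul (hasDerivAt_deriv_radialCutoff ε t))
  rw [cutoffHemiFun, hemiFun, laplacian_radialMonomial h1 h2, laplacian_radialMonomial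
    (fun t => hasDerivAt_profile _) (fun t => hasDerivAt_profileDeriv _)]
  simp only [radialMonomial, cutoffError]
  push_cast
  ring

lemma contDiff_normSq : ContDiff ℝ 2 normSq := by
  have : (fun z : ℂ => normSq z) = fun z => z.re * z.re + z.im * z.im := by
    ext z; exact normSq_apply z
  change ContDiff ℝ 2 (fun z : ℂ => normSq z)
  rw [this]
  exact (reCLM.contDiff.mul reCLM.contDiff).add (imCLM.contDiff.mul imCLM.contDiff)

lemma contDiff_radialMonomial (a b : ℕ) {k : ℝ → ℝ} (hk : ContDiff ℝ 2 fun z : ℂ => k (normSq z)) :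
    ContDiff ℝ 2 (radialMonomial a b k) :=
  ((contDiff_id.pow a).mul (conjCLE.contDiff.pow b)).mul (ofRealCLM.contDiff.comp hk)

lemma contDiff_profile (d : ℕ) : ContDiff ℝ 2 fun z : ℂ => profile d (normSq z) := by
  have h : ∀ z : ℂ, 1 + normSq z ≠ 0 := fun z => by have := normSq_nonneg z; positivity
  exact (contDiff_const.sub contDiff_normSq).mul
    (((contDiff_const.add contDiff_normSq).inv h).pow (d + 1))

lemma contDiff_hemiFun (a b : ℕ) : ContDiff ℝ 2 (hemiFun a b) :=
  contDiff_radialMonomial a b (contDiff_profile _)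

lemma contDiff_cutoffHemiFun (a b : ℕ) (ε : ℝ) : ContDiff ℝ 2 (cutoffHemiFun a b ε) := by
  refine contDiff_radialMonomial a b ((contDiff_profile _).mul ?_)
  exact Real.smoothTransition.contDiff.comp
    (((contDiff_const.sub contDiff_normSq).div_const ε).sub contDiff_const)

lemma radialCutoff_eq_zero {ε t : ℝ} (hε : 0 < ε) (h : 1 - ε ≤ t) : radialCutoff ε t = 0 := by
  refine Real.smoothTransition.zero_of_nonpos ?_
  rw [sub_nonpos, div_le_one hε]; linarith

lemma radialCutoff_eq_one {ε t : ℝ} (hε : 0 < ε) (h : t ≤ 1 - 2 * ε) : radialCutoff ε t = 1 := by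
  refine Real.smoothTransition.one_of_one_le ?_
  rw [le_sub_iff_add_le, le_div_iff₀ hε]; linarith

lemma cutoffHemiFun_eq (a b : ℕ) (ε : ℝ) (z : ℂ) :
    cutoffHemiFun a b ε z = radialCutoff ε (normSq z) * hemiFun a b z := by
  simp only [cutoffHemiFun, hemiFun, radialMonomial]; push_cast; ring

lemma tsupport_cutoffHemiFun_subset (a b : ℕ) {ε : ℝ} (hε : 0 < ε) :
    tsupport (cutoffHemiFun a b ε) ⊆ {z | normSq z ≤ 1 - ε} := by
  refine closure_minimal (fun z hz => ?_) (isClosed_le continuous_normSq continuous_const)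
  by_contra h
  simp only [mem_ofPred_eq, not_le] at h
  exact hz (by rw [cutoffHemiFun_eq, radialCutoff_eq_zero hε h.le]; simp)

lemma mem_ball_iff_normSq {z : ℂ} : z ∈ Metric.ball (0 : ℂ) 1 ↔ normSq z < 1 := by
  rw [mem_ball_zero_iff, normSq_eq_norm_sq]
  constructor <;> intro h <;> nlinarith [norm_nonneg z]

lemma hasCompactSupport_cutoffHemiFun (a b : ℕ) {ε : ℝ} (hε : 0 < ε) :
    HasCompactSupport (cutoffHemiFun a b ε) := by
  refine (isCompact_closedBall (0 : ℂ) 1).of_isClosed_subset (isClosed_tsupport _) ?_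
  refine (tsupport_cutoffHemiFun_subset a b hε).trans fun z hz => ?_
  exact Metric.ball_subset_closedBall (mem_ball_iff_normSq.2 (lt_of_le_of_lt hz (by linarith)))

/-- The commutator term is of size `O(1/ε)` and supported in the shell
`1 - 2ε ≤ |z|² ≤ 1 - ε`. -/
lemma exists_bound_cutoffError (a b : ℕ) : ∃ K : ℝ, 0 ≤ K ∧ ∀ ε, 0 < ε → ε ≤ 1 / 2 → ∀ z : ℂ,
    ‖cutoffError a b ε z‖ ≤
      {z : ℂ | 1 - 2 * ε ≤ normSq z ∧ normSq z ≤ 1 - ε}.indicator (fun _ => K / ε) z := by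
  obtain ⟨C, hC, hb⟩ := exists_bound_deriv_smoothTransition
  set d := a + b with hd
  refine ⟨8 * (d + 2) * C + 8 * C + 8 * (d + 1) * C, by positivity, fun ε hε hε2 z => ?_⟩
  set t := normSq z with ht
  by_cases hz : 1 - 2 * ε ≤ t ∧ t ≤ 1 - ε
  · rw [indicator_of_mem (by exact hz)]
    have ht0 : 0 ≤ t := normSq_nonneg z
    have ht1 : t ≤ 1 := by linarith [hz.2]
    have hq0 : 0 ≤ (1 + t)⁻¹ := by positivity
    have hq1 : (1 + t)⁻¹ ≤ 1 := inv_le_one_of_one_le₀ (by linarith)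
    have hzn : ‖z‖ ≤ 1 := by
      rw [ht, normSq_eq_norm_sq] at ht1; nlinarith [norm_nonneg z]
    obtain ⟨b1, b2⟩ := hb ((1 - t) / ε - 1)
    have hp : |profile d t| ≤ 2 * ε := by
      rw [profile, abs_mul, abs_of_nonneg (by linarith : 0 ≤ 1 - t),
        abs_of_nonneg (by positivity : 0 ≤ ((1 + t)⁻¹) ^ (d + 1))]
      calc (1 - t) * ((1 + t)⁻¹) ^ (d + 1) ≤ (2 * ε) * 1 := by
            gcongr
            · linarith [hz.1]
            · exact pow_le_one₀ hq0 hq1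
        _ = 2 * ε := by ring
    have hp' : |profileDeriv d t| ≤ d + 2 := by
      have x1 := pow_le_one₀ (n := d + 1) hq0 hq1
      have x2 := pow_le_one₀ (n := d + 2) hq0 hq1
      have y1 : 0 ≤ ((1 + t)⁻¹) ^ (d + 1) := by positivity
      have y2 : 0 ≤ ((1 + t)⁻¹) ^ (d + 2) := by positivity
      have y3 : (d + 1) * (1 - t) * ((1 + t)⁻¹) ^ (d + 2) ≤ (d + 1) * 1 * 1 := by
        gcongr; linarith
      have y4 : 0 ≤ (d + 1) * (1 - t) * ((1 + t)⁻¹) ^ (d + 2) := by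
        have : 0 ≤ 1 - t := by linarith
        positivity
      rw [profileDeriv, abs_le]
      constructor <;> linarith
    have hm : ‖cutoffError a b ε z‖ ≤ ‖((8 * t * profileDeriv d t *
        (-(deriv Real.smoothTransition ((1 - t) / ε - 1)) / ε) +
        4 * t * profile d t * (deriv (deriv Real.smoothTransition) ((1 - t) / ε - 1) / ε ^ 2) +
        4 * (a + b + 1) * profile d t *
          (-(deriv Real.smoothTransition ((1 - t) / ε - 1)) / ε) : ℝ) : ℂ)‖ := by
      rw [cutoffError, radialMonomial, norm_mul]
      refine mul_le_of_le_one_left (norm_nonneg _) ?_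
      rw [norm_mul, norm_pow, norm_pow, norm_conj]
      exact mul_le_one₀ (pow_le_one₀ (norm_nonneg _) hzn) (by positivity)
        (pow_le_one₀ (norm_nonneg _) hzn)
    refine hm.trans ?_
    rw [norm_real, Real.norm_eq_abs]
    have hab : (a + b : ℝ) = d := by rw [hd]; push_cast; ring
    rw [hab]
    refine (abs_add_three _ _ _).trans ?_
    have e1 : |8 * t * profileDeriv d t * (-(deriv Real.smoothTransition ((1 - t) / ε - 1)) / ε)| ≤
        8 * 1 * (d + 2) * (C / ε) := by
      rw [abs_mul, abs_mul, abs_div, abs_neg, abs_of_pos hε, abs_of_nonneg (by positivity : 0 ≤ 8 * t)]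
      gcongr
    have e2 : |4 * t * profile d t *
        (deriv (deriv Real.smoothTransition) ((1 - t) / ε - 1) / ε ^ 2)| ≤
        4 * 1 * (2 * ε) * (C / ε ^ 2) := by
      rw [abs_mul, abs_mul, abs_div, abs_of_pos (by positivity : 0 < ε ^ 2),
        abs_of_nonneg (by positivity : 0 ≤ 4 * t)]
      gcongr
    have e3 : |4 * (d + 1) * profile d t *
        (-(deriv Real.smoothTransition ((1 - t) / ε - 1)) / ε)| ≤
        4 * (d + 1) * 1 * (2 * (C / 1)) := by
      rw [abs_mul, abs_mul, abs_div, abs_neg, abs_of_pos hε,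
        abs_of_nonneg (by positivity : (0:ℝ) ≤ 4 * (d + 1))]
      calc 4 * (d + 1) * |profile d t| * (|deriv Real.smoothTransition ((1 - t) / ε - 1)| / ε)
          ≤ 4 * (d + 1) * (2 * ε) * (C / ε) := by gcongr
        _ = _ := by field_simp
    have e4 : 4 * 1 * (2 * ε) * (C / ε ^ 2) = 8 * C / ε := by field_simp; ring
    have e5 : 4 * (d + 1) * 1 * (2 * (C / 1)) ≤ 8 * (d + 1) * C / ε := by
      rw [le_div_iff₀ hε]
      have : 0 ≤ 8 * (d + 1) * C := by positivity
      nlinarith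
    calc _ ≤ 8 * 1 * (d + 2) * (C / ε) + 4 * 1 * (2 * ε) * (C / ε ^ 2) +
          4 * (d + 1) * 1 * (2 * (C / 1)) := by gcongr
      _ ≤ 8 * 1 * (d + 2) * (C / ε) + 8 * C / ε + 8 * (d + 1) * C / ε := by rw [e4]; gcongr
      _ = _ := by ring
  · rw [indicator_of_notMem (by exact hz)]
    have hs : (1 - t) / ε - 1 ∉ Icc (0 : ℝ) 1 := by
      rintro ⟨h1, h2⟩
      refine hz ⟨?_, ?_⟩
      · rw [sub_le_iff_le_add, div_le_iff₀ hε] at h2; linarith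
      · rw [sub_nonneg, le_div_iff₀ hε] at h1; linarith
    rw [cutoffError, radialMonomial, ← ht, (deriv_smoothTransition_eq_zero hs).eq_of_nhds,
      deriv_deriv_smoothTransition_eq_zero hs]
    simp

/-! ### Pairing of an eigenfunction with the basic functions -/

/-- The density `4 / (1 + |z|²)²` of the round area with respect to Lebesgue measure. -/
noncomputable def roundDensity (z : ℂ) : ℂ := ((4 / (1 + normSq z) ^ 2 : ℝ) : ℂ)

/-- The `L²`-pairing, for the round area, of a function with a basic function. -/
noncomputable def hemiPairing (f : ℂ → ℂ) (a b : ℕ) : ℂ :=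
  ∫ z, f z * roundDensity z * hemiFun a b z

lemma continuous_roundDensity : Continuous roundDensity := by
  have h : ∀ z : ℂ, (1 + normSq z) ^ 2 ≠ 0 := fun z => by have := normSq_nonneg z; positivity
  exact continuous_ofReal.comp (continuous_const.div
    ((continuous_const.add continuous_normSq).pow 2) h)

lemma laplacian_eq_diskLaplacian (f : ℂ → ℂ) (z : ℂ) :
    Laplacian.laplacian f z = -(roundDensity z) * diskLaplacian 1 f z := by
  have h : (1 + normSq z) ≠ 0 := by have := normSq_nonneg z; positivity
  rw [diskLaplacian_one_eq, roundDensity, neg_mul, neg_mul, mul_neg, neg_neg, ← mul_assoc,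
    ← ofReal_mul]
  have : 4 / (1 + normSq z) ^ 2 * ((1 + normSq z) ^ 2 / 4) = 1 := by field_simp
  rw [this]; simp

lemma hasCompactSupport_of_eq_zero {f : ℂ → ℂ} (h : ∀ z : ℂ, 1 ≤ ‖z‖ → f z = 0) :
    HasCompactSupport f := by
  refine HasCompactSupport.intro (isCompact_closedBall (0 : ℂ) 1) fun z hz => h z ?_
  simp only [mem_closedBall_zero_iff, not_le] at hz
  exact hz.le

lemma integrable_hemiPairing {f : ℂ → ℂ} (hf : Continuous f) (h0 : ∀ z : ℂ, 1 ≤ ‖z‖ → f z = 0)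
    (a b : ℕ) : Integrable fun z => f z * roundDensity z * hemiFun a b z :=
  ((hf.mul continuous_roundDensity).mul
    (contDiff_hemiFun a b).continuous).integrable_of_hasCompactSupport
    ((hasCompactSupport_of_eq_zero h0).mul_right.mul_right)

/-- The area of the shell on which the derivatives of the cutoff live: it is `O(ε)`, which balances
the `O(1/ε)` size of the commutator. -/
lemma measureReal_shell {ε : ℝ} (hε : 0 < ε) (hε2 : ε ≤ 1 / 2) :
    volume.real {z : ℂ | 1 - 2 * ε ≤ normSq z ∧ normSq z ≤ 1 - ε} = Real.pi * ε := by
  have h1 : {z : ℂ | 1 - 2 * ε ≤ normSq z ∧ normSq z ≤ 1 - ε} =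
      Metric.closedBall 0 (√(1 - ε)) \ Metric.ball 0 (√(1 - 2 * ε)) := by
    ext z
    simp only [mem_ofPred_eq, Set.mem_sdiff, mem_closedBall_zero_iff, mem_ball_zero_iff, not_lt,
      normSq_eq_norm_sq]
    rw [Real.le_sqrt (norm_nonneg _) (by linarith), Real.sqrt_le_left (norm_nonneg _)]
    exact and_comm
  have hsub : Metric.ball (0 : ℂ) (√(1 - 2 * ε)) ⊆ Metric.closedBall 0 (√(1 - ε)) :=
    Metric.ball_subset_closedBall.trans
      (Metric.closedBall_subset_closedBall (Real.sqrt_le_sqrt (by linarith)))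
  rw [h1, measureReal_sdiff hsub measurableSet_ball
    (isCompact_closedBall (0 : ℂ) _).measure_lt_top.ne]
  simp only [measureReal_def, Complex.volume_ball, Complex.volume_closedBall]
  simp only [ENNReal.toReal_mul, ENNReal.toReal_pow, ENNReal.toReal_ofReal (Real.sqrt_nonneg _),
    Real.sq_sqrt (by linarith : 0 ≤ 1 - ε), Real.sq_sqrt (by linarith : 0 ≤ 1 - 2 * ε)]
  simp
  ring

/-- As the cutoff approaches the boundary circle, where `f` vanishes, its commutator does not
contribute. -/
lemma tendsto_integral_cutoffError {f : ℂ → ℂ} (hf : Continuous f)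
    (h0 : ∀ z : ℂ, 1 ≤ ‖z‖ → f z = 0) (a b : ℕ) {ε : ℕ → ℝ} (hε : ∀ n, 0 < ε n)
    (hε2 : ∀ n, ε n ≤ 1 / 2) (hl : Tendsto ε atTop (𝓝 0)) :
    Tendsto (fun n => ∫ z, f z * cutoffError a b (ε n) z) atTop (𝓝 0) := by
  obtain ⟨K, hK, hb⟩ := exists_bound_cutoffError a b
  have huc := hf.uniformContinuous_of_tendsto_cocompact (x := 0)
    ((hasCompactSupport_of_eq_zero h0).is_zero_at_infty)
  rw [Metric.tendsto_atTop]
  intro η hη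
  have hη' : 0 < η / (K * Real.pi + 1) := by positivity
  obtain ⟨δ, hδ, huc⟩ := Metric.uniformContinuous_iff.1 huc _ hη'
  obtain ⟨N, hN⟩ := Metric.tendsto_atTop.1 hl (δ / 2) (by positivity)
  refine ⟨N, fun n hn => ?_⟩
  have hn' : ε n < δ / 2 := by
    have := hN n hn; rwa [Real.dist_eq, sub_zero, abs_of_pos (hε n)] at this
  rw [dist_zero_right]
  set S := {z : ℂ | 1 - 2 * ε n ≤ normSq z ∧ normSq z ≤ 1 - ε n} with hS
  have hSm : MeasurableSet S :=
    ((isClosed_le continuous_const continuous_normSq).inter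
      (isClosed_le continuous_normSq continuous_const)).measurableSet
  have hSfin : volume S < ⊤ := by
    refine (measure_mono (fun z hz => ?_)).trans_lt (isCompact_closedBall (0 : ℂ) 1).measure_lt_top
    exact Metric.ball_subset_closedBall
      (mem_ball_iff_normSq.2 (lt_of_le_of_lt hz.2 (by linarith [hε n])))
  have hbd : ∀ z, ‖f z * cutoffError a b (ε n) z‖ ≤
      S.indicator (fun _ => η / (K * Real.pi + 1) * (K / ε n)) z := by
    intro z
    rw [norm_mul]
    by_cases hz : z ∈ S
    · have h1 := hb (ε n) (hε n) (hε2 n) z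
      rw [indicator_of_mem hz] at h1 ⊢
      refine mul_le_mul ?_ h1 (norm_nonneg _) hη'.le
      -- `f` is small at `z`, being uniformly continuous and zero at the nearest boundary point.
      by_cases hz0 : z = 0
      · subst hz0
        have h2 := huc (a := (0 : ℂ)) (b := ((1 : ℝ) : ℂ)) ?_
        · rw [h0 ((1 : ℝ) : ℂ) (by simp), dist_zero_right] at h2; exact h2.le
        · have := hz.1; simp at this; simp; linarith
      · have hzn : 0 < ‖z‖ := norm_pos_iff.2 hz0
        have hz1 : ‖z‖ ≤ 1 := by
          have := hz.2; rw [normSq_eq_norm_sq] at this; nlinarith [hε n]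
        have h2 := huc (a := z) (b := ((‖z‖⁻¹ : ℝ) : ℂ) * z) ?_
        · rw [h0 (((‖z‖⁻¹ : ℝ) : ℂ) * z) (by simp [hz0]), dist_zero_right] at h2; exact h2.le
        · have : z - ((‖z‖⁻¹ : ℝ) : ℂ) * z = ((1 - ‖z‖⁻¹ : ℝ) : ℂ) * z := by push_cast; ring
          rw [dist_eq_norm, this, norm_mul, norm_real, Real.norm_eq_abs, abs_sub_comm,
            abs_of_nonneg (by rw [sub_nonneg]; exact one_le_inv_iff₀.2 ⟨hzn, hz1⟩), sub_mul,
            inv_mul_cancel₀ hzn.ne']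
          have := hz.1; rw [normSq_eq_norm_sq] at this; nlinarith
    · have h1 := hb (ε n) (hε n) (hε2 n) z
      rw [indicator_of_notMem hz] at h1 ⊢
      exact mul_nonpos_of_nonneg_of_nonpos (norm_nonneg _) h1
  refine (norm_integral_le_of_norm_le
    ((integrable_indicator_iff hSm).2 (integrableOn_const hSfin.ne)) (.of_forall hbd)).trans_lt ?_
  rw [integral_indicator hSm, setIntegral_const, measureReal_shell (hε n) (hε2 n), smul_eq_mul]
  have := (hε n).ne'
  calc Real.pi * ε n * (η / (K * Real.pi + 1) * (K / ε n))
      = η * ((K * Real.pi) / (K * Real.pi + 1)) := by field_simp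
    _ < η * 1 := by
        gcongr
        rw [div_lt_one (by positivity)]; linarith
    _ = η := mul_one η

/-- Symmetry of the Dirichlet Laplacian, tested on the basic functions: the pairings of an
eigenfunction satisfy the recursion dual to the triangular action of the Laplacian. -/
lemma hemiPairing_recursion {μ : ℝ} {f : ℂ → ℂ} (hf : f ∈ dirichletEigenspace 1 μ) (a b : ℕ) :
    ((a + b + 1) * (a + b + 2) - μ : ℂ) * hemiPairing f a b =
      a * b * hemiPairing f (a - 1) (b - 1) := by
  obtain ⟨hc, h0, hC2, heig⟩ := hf
  set ε : ℕ → ℝ := fun n => 1 / ((n : ℝ) + 1) / 2 with hεdef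
  have hε : ∀ n, 0 < ε n := fun n => by positivity
  have hε2 : ∀ n, ε n ≤ 1 / 2 := fun n => by
    have : 1 / ((n : ℝ) + 1) ≤ 1 := by rw [div_le_one (by positivity)]; simp
    simp only [hεdef]; linarith
  have hl : Tendsto ε atTop (𝓝 0) := by
    simpa [hεdef] using (tendsto_one_div_add_atTop_nhds_zero_nat (𝕜 := ℝ)).div_const (2 : ℝ)
  have hcs := hasCompactSupport_of_eq_zero h0
  set S : ℂ → ℂ := fun z => ((a + b + 1) * (a + b + 2) - μ : ℂ) * hemiFun a b z -
    a * b * hemiFun (a - 1) (b - 1) z with hS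
  have hcont : Continuous fun z => f z * roundDensity z * S z :=
    (hc.mul continuous_roundDensity).mul ((continuous_const.mul (contDiff_hemiFun _ _).continuous).sub
      (continuous_const.mul (contDiff_hemiFun _ _).continuous))
  have hint : Integrable fun z => f z * roundDensity z * S z :=
    hcont.integrable_of_hasCompactSupport (hcs.mul_right.mul_right)
  have hcut : ∀ n, Continuous fun z : ℂ => ((radialCutoff (ε n) (normSq z) : ℝ) : ℂ) := fun n =>
    continuous_ofReal.comp (Real.smoothTransition.continuous.comp
      (((continuous_const.sub continuous_normSq).div_const _).sub continuous_const))
  have hstep : ∀ n, ∫ z, radialCutoff (ε n) (normSq z) * (f z * roundDensity z * S z) =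
      ∫ z, f z * cutoffError a b (ε n) z := by
    intro n
    have hG := integral_mul_laplacian Metric.isOpen_ball hC2 (contDiff_cutoffHemiFun a b (ε n))
      (hasCompactSupport_cutoffHemiFun a b (hε n))
      ((tsupport_cutoffHemiFun_subset a b (hε n)).trans fun z hz =>
        mem_ball_iff_normSq.2 (lt_of_le_of_lt hz (by linarith [hε n])))
    have hlap : ∀ g : ℂ → ℂ, ContDiff ℝ 2 g → Continuous (Laplacian.laplacian g) := by
      intro g hg
      have : Laplacian.laplacian g = fun z => fderiv ℝ (fun u => fderiv ℝ g u 1) z 1 +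
          fderiv ℝ (fun u => fderiv ℝ g u I) z I := by
        ext z; exact laplacian_eq_fderiv_fderiv hg.contDiffAt
      rw [this]
      have h2 : ∀ v, Continuous (fun u => fderiv ℝ (fun u => fderiv ℝ g u v) u v) := fun v =>
        ((((hg.fderiv_right (m := 1) (by norm_num)).clm_apply contDiff_const).fderiv_right
          (m := 0) (by norm_num)).clm_apply contDiff_const).continuous
      exact (h2 1).add (h2 I)
    have hE : Continuous (cutoffError a b (ε n)) := by
      have : cutoffError a b (ε n) = fun z => Laplacian.laplacian (cutoffHemiFun a b (ε n)) z -
          radialCutoff (ε n) (normSq z) * Laplacian.laplacian (hemiFun a b) z := by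
        ext z; rw [laplacian_cutoffHemiFun]; ring
      rw [this]
      exact (hlap _ (contDiff_cutoffHemiFun _ _ _)).sub
        ((hcut n).mul (hlap _ (contDiff_hemiFun _ _)))
    have i1 : Integrable fun z => radialCutoff (ε n) (normSq z) * (f z * roundDensity z * S z) :=
      ((hcut n).mul hcont).integrable_of_hasCompactSupport (hcs.mul_right.mul_right.mul_left)
    have i2 : Integrable fun z => f z * cutoffError a b (ε n) z :=
      (hc.mul hE).integrable_of_hasCompactSupport hcs.mul_right
    have i3 : Integrable fun z => f z * Laplacian.laplacian (cutoffHemiFun a b (ε n)) z :=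
      (hc.mul (hlap _ (contDiff_cutoffHemiFun _ _ _))).integrable_of_hasCompactSupport hcs.mul_right
    have e : ∀ z, Laplacian.laplacian f z * cutoffHemiFun a b (ε n) z =
        radialCutoff (ε n) (normSq z) * (f z * roundDensity z * S z) -
          f z * cutoffError a b (ε n) z +
          f z * Laplacian.laplacian (cutoffHemiFun a b (ε n)) z := by
      intro z
      rw [laplacian_cutoffHemiFun, laplacian_eq_diskLaplacian (hemiFun a b),
        diskLaplacian_hemiFun, cutoffHemiFun_eq, hS]
      by_cases hz : z ∈ Metric.ball (0 : ℂ) 1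
      · rw [laplacian_eq_diskLaplacian f, heig z hz]; ring
      · rw [radialCutoff_eq_zero (hε n)
          (by have := mt mem_ball_iff_normSq.2 hz; linarith [hε n])]
        simp
    simp_rw [e] at hG
    have i12 : Integrable fun z => radialCutoff (ε n) (normSq z) * (f z * roundDensity z * S z) -
        f z * cutoffError a b (ε n) z := i1.sub i2
    rw [integral_add i12 i3, integral_sub i1 i2] at hG
    linear_combination -hG
  have hlim : Tendsto (fun n => ∫ z, radialCutoff (ε n) (normSq z) * (f z * roundDensity z * S z))
      atTop (𝓝 (∫ z, f z * roundDensity z * S z)) := by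
    refine tendsto_integral_of_dominated_convergence (fun z => ‖f z * roundDensity z * S z‖)
      (fun n => ((hcut n).mul hcont).aestronglyMeasurable) hint.norm
      (fun n => .of_forall fun z => ?_) (.of_forall fun z => ?_)
    · rw [norm_mul]
      refine mul_le_of_le_one_left (norm_nonneg _) ?_
      rw [norm_real, Real.norm_eq_abs, radialCutoff, abs_of_nonneg (Real.smoothTransition.nonneg _)]
      exact Real.smoothTransition.le_one _
    · by_cases hz : z ∈ Metric.ball (0 : ℂ) 1
      · have hz' := mem_ball_iff_normSq.1 hz
        obtain ⟨N, hN⟩ := Metric.tendsto_atTop.1 hl ((1 - normSq z) / 2) (by linarith)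
        refine tendsto_const_nhds.congr' ?_
        filter_upwards [eventually_ge_atTop N] with n hn
        have := hN n hn
        rw [Real.dist_eq, sub_zero, abs_of_pos (hε n)] at this
        rw [radialCutoff_eq_one (hε n) (by linarith)]
        simp
      · rw [h0 z (by simpa using hz)]; simp
  have hzero : ∫ z, f z * roundDensity z * S z = 0 :=
    tendsto_nhds_unique hlim
      ((tendsto_integral_cutoffError hc h0 a b hε hε2 hl).congr fun n => (hstep n).symm)
  have hp := fun a b => integrable_hemiPairing hc h0 a b
  have e4 : ∀ z, f z * roundDensity z * S z =
      ((a + b + 1) * (a + b + 2) - μ : ℂ) * (f z * roundDensity z * hemiFun a b z) -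
      (a * b) * (f z * roundDensity z * hemiFun (a - 1) (b - 1) z) := fun z => by
    simp only [hS]; ring
  simp_rw [e4] at hzero
  rw [integral_sub ((hp a b).const_mul _) ((hp (a - 1) (b - 1)).const_mul _),
    integral_const_mul, integral_const_mul] at hzero
  simp only [hemiPairing]
  linear_combination hzero

/-! ### Completeness of the basic functions and the upper bound for the multiplicities -/

/-- Half of the stereographic coordinate `x₁ + i x₂ = 2z / (1 + |z|²)`. -/
noncomputable def halfStereo (z : ℂ) : ℂ := z * (((1 + normSq z)⁻¹ : ℝ) : ℂ)

lemma continuous_halfStereo : Continuous halfStereo := by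
  have h : ∀ z : ℂ, (1 + normSq z) ≠ 0 := fun z => by have := normSq_nonneg z; positivity
  exact continuous_id.mul (continuous_ofReal.comp
    ((continuous_const.add continuous_normSq).inv₀ h))

lemma hemiFun_eq (a b : ℕ) (z : ℂ) :
    hemiFun a b z = (((1 - normSq z) * (1 + normSq z)⁻¹ : ℝ) : ℂ) *
      (halfStereo z ^ a * conj (halfStereo z) ^ b) := by
  simp only [hemiFun, radialMonomial, profile, halfStereo, map_mul, conj_ofReal]
  push_cast
  ring

lemma injOn_halfStereo : InjOn halfStereo (Metric.closedBall 0 1) := by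
  intro z hz u hu h
  rw [mem_closedBall_zero_iff] at hz hu
  have hz0 := norm_nonneg z
  have hu0 := norm_nonneg u
  have h1 : (1 + normSq z) ≠ 0 := by have := normSq_nonneg z; positivity
  have h2 : (1 + normSq u) ≠ 0 := by have := normSq_nonneg u; positivity
  have hn : ‖z‖ * (1 + ‖u‖ ^ 2) = ‖u‖ * (1 + ‖z‖ ^ 2) := by
    have := congrArg norm h
    simp only [halfStereo, norm_mul, norm_real, Real.norm_eq_abs, normSq_eq_norm_sq, abs_inv] at this
    rw [abs_of_pos (by positivity), abs_of_pos (by positivity)] at this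
    field_simp at this
    linarith
  have hn2 : (‖z‖ - ‖u‖) * (1 - ‖z‖ * ‖u‖) = 0 := by linear_combination hn
  have hn3 : ‖z‖ = ‖u‖ := by
    rcases mul_eq_zero.1 hn2 with h | h
    · linarith
    · nlinarith
  simp only [halfStereo, normSq_eq_norm_sq, hn3] at h
  refine mul_right_cancel₀ ?_ h
  rw [ofReal_ne_zero]
  positivity

/-- The basic functions are complete: a continuous function on the closed disk that vanishes on the
circle and pairs to zero with all of them is zero. -/
lemma eq_zero_of_hemiPairing_eq_zero {f : ℂ → ℂ} (hf : Continuous f)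
    (h0 : ∀ z : ℂ, 1 ≤ ‖z‖ → f z = 0) (hp : ∀ a b, hemiPairing f a b = 0) : f = 0 := by
  have hcs := hasCompactSupport_of_eq_zero h0
  have hpos : ∀ z : ℂ, 0 < 1 + normSq z := fun z => by have := normSq_nonneg z; positivity
  set W : ℂ → ℝ := fun z => 4 / (1 + normSq z) ^ 2 * ((1 - normSq z) * (1 + normSq z)⁻¹) with hW
  have hWc : Continuous W :=
    (continuous_const.div ((continuous_const.add continuous_normSq).pow 2)
      (fun z => pow_ne_zero 2 (hpos z).ne')).mul ((continuous_const.sub continuous_normSq).mul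
      ((continuous_const.add continuous_normSq).inv₀ (fun z => (hpos z).ne')))
  set F : ℂ → ℂ := fun z => f z * W z with hF
  have hFc : Continuous F := hf.mul (continuous_ofReal.comp hWc)
  have hFcs : HasCompactSupport F := hcs.mul_right
  have hFi : Integrable F := hFc.integrable_of_hasCompactSupport hFcs
  have hFP : ∀ P : ℂ → ℂ, Continuous P → Integrable fun z => F z * P z := fun P hP =>
    (hFc.mul hP).integrable_of_hasCompactSupport hFcs.mul_right
  let K := Metric.closedBall (0 : ℂ) 1
  have : CompactSpace K := isCompact_iff_compactSpace.1 (isCompact_closedBall 0 1)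
  let ψ : C(K, ℂ) := ⟨fun z => halfStereo z, continuous_halfStereo.comp continuous_subtype_val⟩
  let A : StarSubalgebra ℂ C(K, ℂ) := StarAlgebra.adjoin ℂ {ψ}
  have hA : A.topologicalClosure = ⊤ := by
    refine ContinuousMap.starSubalgebra_topologicalClosure_eq_top_of_separatesPoints A ?_
    intro x y hxy
    refine ⟨ψ, ⟨ψ, StarAlgebra.self_mem_adjoin_singleton ℂ ψ, rfl⟩, fun h => hxy ?_⟩
    exact Subtype.ext (injOn_halfStereo x.2 y.2 h)
  -- The monomials spanning `A` are basic functions without their weight, which is moved into `F`.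
  have hAz : ∀ p ∈ A, ∃ P : ℂ → ℂ, Continuous P ∧ (∀ z : K, p z = P z) ∧ ∫ z, F z * P z = 0 := by
    intro p hpA
    have hpA' : p ∈ Subalgebra.toSubmodule (Algebra.adjoin ℂ ({ψ} ∪ star {ψ})) := by
      rw [← StarAlgebra.adjoin_toSubalgebra]; exact hpA
    rw [Algebra.adjoin_eq_span] at hpA'
    refine Submodule.span_induction ?_ ?_ ?_ ?_ hpA'
    · intro q hq
      rw [Set.star_singleton, Set.singleton_union, SetLike.mem_coe, Submonoid.mem_closure_pair] at hq
      obtain ⟨a, b, rfl⟩ := hq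
      refine ⟨fun z => halfStereo z ^ a * conj (halfStereo z) ^ b,
        (continuous_halfStereo.pow a).mul ((continuous_conj.comp continuous_halfStereo).pow b),
        fun z => by simp [ψ], ?_⟩
      rw [← hp a b, hemiPairing]
      congr 1
      ext z
      rw [hemiFun_eq, hF, hW, roundDensity]
      push_cast
      ring
    · exact ⟨fun _ => 0, continuous_const, fun _ => rfl, by simp⟩
    · rintro x y _ _ ⟨P, hP1, hP2, hP3⟩ ⟨Q, hQ1, hQ2, hQ3⟩
      refine ⟨fun z => P z + Q z, hP1.add hQ1, fun z => by simp [hP2, hQ2], ?_⟩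
      simp_rw [mul_add]
      rw [integral_add (hFP P hP1) (hFP Q hQ1), hP3, hQ3, add_zero]
    · rintro c x _ ⟨P, hP1, hP2, hP3⟩
      refine ⟨fun z => c * P z, continuous_const.mul hP1, fun z => by simp [hP2], ?_⟩
      simp_rw [mul_left_comm _ c]
      rw [integral_const_mul, hP3, mul_zero]
  -- Approximating `conj f` by such `P` shows that `∫ |f|² W = 0`.
  have hzero : ∫ z, F z * conj (f z) = 0 := by
    rw [← norm_le_zero_iff]
    refine le_of_forall_pos_le_add fun η hη => ?_
    let φ : C(K, ℂ) := ⟨fun z => conj (f z),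
      (continuous_conj.comp hf).comp continuous_subtype_val⟩
    have hφ : φ ∈ closure (A : Set C(K, ℂ)) := by
      rw [← StarSubalgebra.topologicalClosure_coe, hA]; trivial
    obtain ⟨p, hpA, hpd⟩ := Metric.mem_closure_iff.1 hφ (η / ((∫ z, ‖F z‖) + 1)) (by positivity)
    obtain ⟨P, hP1, hP2, hP3⟩ := hAz p hpA
    have e1 : ∫ z, F z * conj (f z) = ∫ z, F z * (conj (f z) - P z) := by
      simp_rw [mul_sub]
      rw [integral_sub (hFP (fun z => conj (f z)) (continuous_conj.comp hf)) (hFP P hP1), hP3, sub_zero]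
    rw [e1, zero_add]
    calc ‖∫ z, F z * (conj (f z) - P z)‖ ≤ ∫ z, ‖F z‖ * (η / ((∫ z, ‖F z‖) + 1)) := by
          refine norm_integral_le_of_norm_le (hFi.norm.mul_const _) (.of_forall fun z => ?_)
          rw [norm_mul]
          by_cases hz : z ∈ K
          · gcongr
            have := (ContinuousMap.dist_apply_le_dist (f := φ) (g := p) ⟨z, hz⟩).trans hpd.le
            rw [hP2, dist_eq_norm] at this
            exact this
          · have : F z = 0 := by
              simp only [K, mem_closedBall_zero_iff, not_le] at hz
              simp [hF, h0 z hz.le]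
            simp [this]
      _ = η * ((∫ z, ‖F z‖) / ((∫ z, ‖F z‖) + 1)) := by rw [integral_mul_const]; ring
      _ ≤ η * 1 := by
          gcongr
          have : 0 ≤ ∫ z, ‖F z‖ := integral_nonneg fun _ => norm_nonneg _
          rw [div_le_one (by positivity)]; linarith
      _ = η := mul_one η
  have e2 : ∀ z, F z * conj (f z) = ((normSq (f z) * W z : ℝ) : ℂ) := fun z => by
    rw [hF, ofReal_mul, ← mul_conj]; ring
  simp_rw [e2] at hzero
  rw [integral_complex_ofReal, ofReal_eq_zero] at hzero
  have hnn : ∀ z, 0 ≤ normSq (f z) * W z := by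
    intro z
    by_cases hz : z ∈ Metric.ball (0 : ℂ) 1
    · have := mem_ball_iff_normSq.1 hz
      have h1 : 0 ≤ 1 - normSq z := by linarith
      have h2 := hpos z
      exact mul_nonneg (normSq_nonneg _) (by positivity)
    · rw [h0 z (by simpa using hz)]; simp
  have hcW : Continuous fun z => normSq (f z) * W z := (continuous_normSq.comp hf).mul hWc
  have hiW : Integrable fun z => normSq (f z) * W z := by
    refine hcW.integrable_of_hasCompactSupport (HasCompactSupport.mul_right ?_)
    exact hcs.comp_left (g := normSq) (by simp)
  have hae := (integral_eq_zero_iff_of_nonneg hnn hiW).1 hzero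
  have hall := (hcW.ae_eq_iff_eq volume (continuous_const (y := (0 : ℝ)))).1 hae
  ext z
  by_cases hz : z ∈ Metric.ball (0 : ℂ) 1
  · have h1 : 0 < 1 - normSq z := by have := mem_ball_iff_normSq.1 hz; linarith
    have h2 := hpos z
    have h3 := congrFun hall z
    have h4 : W z ≠ 0 := by simp only [hW]; positivity
    simpa [h4] using h3
  · exact h0 z (by simpa using hz)

/-- For an eigenfunction, the pairings of resonant degree, those with
`(a + b + 1) (a + b + 2) = μ`, determine all the others through the recursion. -/
lemma hemiPairing_eq_zero {μ : ℝ} {f : ℂ → ℂ} (hf : f ∈ dirichletEigenspace 1 μ)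
    (h : ∀ a b : ℕ, ((a : ℝ) + b + 1) * (a + b + 2) = μ → hemiPairing f a b = 0) :
    ∀ a b, hemiPairing f a b = 0 := by
  intro a
  induction a with
  | zero =>
    intro b
    by_cases hb : (((0 : ℕ) : ℝ) + b + 1) * ((0 : ℕ) + b + 2) = μ
    · exact h _ _ hb
    · have := hemiPairing_recursion hf 0 b
      have hne : ((((0 : ℕ) : ℂ) + b + 1) * ((0 : ℕ) + b + 2) - μ : ℂ) ≠ 0 := by
        rw [sub_ne_zero]; exact_mod_cast hb
      exact (mul_eq_zero.1 (this.trans (by simp))).resolve_left hne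
  | succ a ih =>
    intro b
    by_cases hb : (((a + 1 : ℕ) : ℝ) + b + 1) * ((a + 1 : ℕ) + b + 2) = μ
    · exact h _ _ hb
    · have := hemiPairing_recursion hf (a + 1) b
      have hne : ((((a + 1 : ℕ) : ℂ)) + b + 1) * ((a + 1 : ℕ) + b + 2) - μ ≠ 0 := by
        rw [sub_ne_zero]; exact_mod_cast hb
      rw [Nat.add_sub_cancel, ih, mul_zero] at this
      exact (mul_eq_zero.1 this).resolve_left hne

/-- Numbers that are not of the form `l (l + 1)`, `l ≥ 1`, are not eigenvalues. -/
lemma dirichletEigenspace_eq_bot {μ : ℝ} (h : ∀ l : ℕ, 1 ≤ l → (l : ℝ) * (l + 1) ≠ μ) :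
    dirichletEigenspace 1 μ = ⊥ := by
  rw [Submodule.eq_bot_iff]
  intro f hf
  refine eq_zero_of_hemiPairing_eq_zero hf.1 hf.2.1 (hemiPairing_eq_zero hf fun a b hab => ?_)
  refine absurd ?_ (h (a + b + 1) (by lia))
  push_cast
  linarith

/-- The pairings with the basic functions of degree `l - 1`, as a linear map on the eigenspace. -/
noncomputable def hemiPairingMap (μ : ℝ) (l : ℕ) : dirichletEigenspace 1 μ →ₗ[ℂ] (Fin l → ℂ) where
  toFun f i := hemiPairing f i (l - 1 - i)
  map_add' f g := by
    ext i
    simp only [hemiPairing, Submodule.coe_add, Pi.add_apply, add_mul]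
    exact integral_add (integrable_hemiPairing f.2.1 f.2.2.1 _ _)
      (integrable_hemiPairing g.2.1 g.2.2.1 _ _)
  map_smul' c f := by
    ext i
    simp only [hemiPairing, Submodule.coe_smul, Pi.smul_apply, smul_eq_mul, RingHom.id_apply,
      mul_assoc]
    exact integral_const_mul _ _

/-- An eigenfunction is determined by its `l` pairings of degree `l - 1`. -/
lemma rank_dirichletEigenspace_le {l : ℕ} :
    Module.rank ℂ (dirichletEigenspace 1 ((l : ℝ) * (l + 1))) ≤ l := by
  have hinj : Function.Injective (hemiPairingMap ((l : ℝ) * (l + 1)) l) := by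
    rw [← LinearMap.ker_eq_bot, LinearMap.ker_eq_bot']
    intro f hf
    refine Subtype.ext (eq_zero_of_hemiPairing_eq_zero f.2.1 f.2.2.1
      (hemiPairing_eq_zero f.2 fun a b hab => ?_))
    have hl : a + b + 1 = l := by
      have h1 : (a + b + 1) * (a + b + 2) = l * (l + 1) := by exact_mod_cast hab
      nlinarith
    have := congrFun hf ⟨a, by lia⟩
    have hb : l - 1 - a = b := by lia
    simpa [hemiPairingMap, hb] using this
  have := LinearMap.rank_le_of_injective _ hinj
  simpa using this

/-! ### Explicit eigenfunctions and the lower bound for the multiplicities -/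

/-- The basic function `hemiFun a b` on the open disk, extended by zero. -/
noncomputable def hemiFunExt (a b : ℕ) (z : ℂ) : ℂ :=
  ((max (1 - normSq z) 0 * (1 + normSq z)⁻¹ : ℝ) : ℂ) *
    (halfStereo z ^ a * conj (halfStereo z) ^ b)

lemma continuous_hemiFunExt (a b : ℕ) : Continuous (hemiFunExt a b) := by
  have h : ∀ z : ℂ, (1 + normSq z) ≠ 0 := fun z => by have := normSq_nonneg z; positivity
  exact (continuous_ofReal.comp (((continuous_const.sub continuous_normSq).max
    continuous_const).mul ((continuous_const.add continuous_normSq).inv₀ h))).mul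
    ((continuous_halfStereo.pow a).mul ((continuous_conj.comp continuous_halfStereo).pow b))

lemma hemiFunExt_of_mem {a b : ℕ} {z : ℂ} (hz : z ∈ Metric.ball (0 : ℂ) 1) :
    hemiFunExt a b z = hemiFun a b z := by
  have := mem_ball_iff_normSq.1 hz
  rw [hemiFunExt, hemiFun_eq, max_eq_left (by linarith)]

lemma hemiFunExt_of_one_le {a b : ℕ} {z : ℂ} (hz : 1 ≤ ‖z‖) : hemiFunExt a b z = 0 := by
  have : 1 ≤ normSq z := by rw [normSq_eq_norm_sq]; nlinarith
  rw [hemiFunExt, max_eq_right (by linarith)]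
  simp

lemma laplacian_finset_sum {ι : Type*} (s : Finset ι) (c : ι → ℂ) (h : ι → ℂ → ℂ)
    (hh : ∀ i, ContDiff ℝ 2 (h i)) (z : ℂ) :
    Laplacian.laplacian (fun z => ∑ i ∈ s, c i * h i z) z =
      ∑ i ∈ s, c i * Laplacian.laplacian (h i) z := by
  classical
  induction s using Finset.induction_on with
  | empty => simp
  | insert i s hi ih =>
    have e : (fun z => ∑ j ∈ insert i s, c j * h j z) =
        c i • h i + fun z => ∑ j ∈ s, c j * h j z := by
      ext z; simp [Finset.sum_insert hi]
    have hs : ContDiff ℝ 2 fun z => ∑ j ∈ s, c j * h j z :=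
      ContDiff.sum fun j _ => contDiff_const.mul (hh j)
    have hi' : ContDiff ℝ 2 (c i • h i) := contDiff_const.smul (hh i)
    rw [e, hi'.contDiffAt.laplacian_add hs.contDiffAt,
      InnerProductSpace.laplacian_smul (c i) (hh i).contDiffAt, ih, Finset.sum_insert hi]
    rfl

/-- The coefficients of the eigenfunction with leading term `hemiFun a b`, solving the triangular
system for the eigenvalue `(a + b + 1) (a + b + 2)`. -/
noncomputable def eigenCoeff (a b : ℕ) : ℕ → ℂ
  | 0 => 1
  | j + 1 => eigenCoeff a b j * ((a - j) * (b - j)) /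
      ((a + b - 2 * j - 1) * (a + b - 2 * j) - (a + b + 1) * (a + b + 2))

/-- The Dirichlet eigenfunction with leading term `hemiFun a b`. -/
noncomputable def hemiEigenfun (a b : ℕ) (z : ℂ) : ℂ :=
  ∑ j ∈ Finset.range (min a b + 1), eigenCoeff a b j * hemiFunExt (a - j) (b - j) z

lemma eigenCoeff_succ {a b j : ℕ} (hj : j < min a b) :
    ((((a - (j + 1) : ℕ) : ℂ) + (b - (j + 1) : ℕ) + 1) *
      (((a - (j + 1) : ℕ) : ℂ) + (b - (j + 1) : ℕ) + 2) - (a + b + 1) * (a + b + 2)) *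
        eigenCoeff a b (j + 1) =
      eigenCoeff a b j * ((a - j : ℕ) * (b - j : ℕ)) := by
  obtain ⟨ha, hb⟩ := lt_min_iff.1 hj
  obtain ⟨a, rfl⟩ := Nat.exists_eq_add_of_le ha
  obtain ⟨b, rfl⟩ := Nat.exists_eq_add_of_le hb
  have e1 : j.succ + a - (j + 1) = a := by lia
  have e2 : j.succ + b - (j + 1) = b := by lia
  have e3 : j.succ + a - j = a + 1 := by lia
  have e4 : j.succ + b - j = b + 1 := by lia
  have hne : ((a : ℂ) + b + 1) * (a + b + 2) -
      ((j + 1 + a) + (j + 1 + b) + 1) * ((j + 1 + a) + (j + 1 + b) + 2) ≠ 0 := by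
    rw [sub_ne_zero]
    norm_cast
    nlinarith
  rw [eigenCoeff, e1, e2, e3, e4]
  push_cast
  have e5 : ((j : ℂ) + 1 + a + (j + 1 + b) - 2 * j - 1) * (j + 1 + a + (j + 1 + b) - 2 * j) -
      ((j + 1 + a) + (j + 1 + b) + 1) * ((j + 1 + a) + (j + 1 + b) + 2) = ((a : ℂ) + b + 1) * (a + b + 2) -
      ((j + 1 + a) + (j + 1 + b) + 1) * ((j + 1 + a) + (j + 1 + b) + 2) := by ring
  rw [e5, mul_div_cancel₀ _ hne]
  ring

lemma hemiEigenfun_mem (a b : ℕ) :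
    hemiEigenfun a b ∈ dirichletEigenspace 1 (((a : ℝ) + b + 1) * (a + b + 2)) := by
  set F : ℂ → ℂ := fun z =>
    ∑ j ∈ Finset.range (min a b + 1), eigenCoeff a b j * hemiFun (a - j) (b - j) z with hF
  have hEq : EqOn (hemiEigenfun a b) F (Metric.ball 0 1) := fun z hz => by
    simp only [hemiEigenfun, hF, hemiFunExt_of_mem hz]
  have hFC : ContDiff ℝ 2 F :=
    ContDiff.sum fun j _ => contDiff_const.mul (contDiff_hemiFun _ _)
  refine ⟨?_, fun z hz => ?_, hFC.contDiffOn.congr hEq, fun z hz => ?_⟩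
  · exact continuous_finsetSum _ fun j _ => continuous_const.mul (continuous_hemiFunExt _ _)
  · simp [hemiEigenfun, hemiFunExt_of_one_le hz]
  · have hev : hemiEigenfun a b =ᶠ[𝓝 z] F :=
      Filter.eventuallyEq_of_mem (Metric.isOpen_ball.mem_nhds hz) hEq
    have h1 : diskLaplacian 1 (hemiEigenfun a b) z = diskLaplacian 1 F z := by
      rw [diskLaplacian, diskLaplacian, (InnerProductSpace.laplacian_congr_nhds hev).eq_of_nhds]
    have h2 : diskLaplacian 1 F z = ∑ j ∈ Finset.range (min a b + 1),
        eigenCoeff a b j * diskLaplacian 1 (hemiFun (a - j) (b - j)) z := by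
      rw [diskLaplacian, hF, laplacian_finset_sum _ _ _ (fun j => contDiff_hemiFun _ _),
        Finset.mul_sum]
      refine Finset.sum_congr rfl fun j _ => ?_
      rw [diskLaplacian]; ring
    rw [h1, h2, hEq hz, hF, ← sub_eq_zero, Finset.mul_sum, ← Finset.sum_sub_distrib]
    set m := min a b with hm
    set β : ℕ → ℂ := fun j => ((((a - j : ℕ) : ℂ) + (b - j : ℕ) + 1) *
      (((a - j : ℕ) : ℂ) + (b - j : ℕ) + 2) - (a + b + 1) * (a + b + 2)) *
        eigenCoeff a b j * hemiFun (a - j) (b - j) z with hβ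
    set γ : ℕ → ℂ := fun j => eigenCoeff a b j * ((a - j : ℕ) * (b - j : ℕ)) *
      hemiFun (a - (j + 1)) (b - (j + 1)) z with hγ
    have h3 : ∀ j ∈ Finset.range (m + 1),
        eigenCoeff a b j * diskLaplacian 1 (hemiFun (a - j) (b - j)) z -
        (((((a : ℝ) + b + 1) * (a + b + 2) : ℝ)) : ℂ) *
          (eigenCoeff a b j * hemiFun (a - j) (b - j) z) = β j - γ j := by
      intro j _
      rw [diskLaplacian_hemiFun, hβ, hγ]
      simp only [Nat.sub_sub]
      push_cast
      ring
    have h4 : ∀ j ∈ Finset.range m, β (j + 1) = γ j := by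
      intro j hj
      simp only [hβ, hγ]
      rw [eigenCoeff_succ (Finset.mem_range.1 hj)]
    have h5 : β 0 = 0 := by simp [hβ]
    have h6 : γ m = 0 := by
      simp only [hγ]
      rcases min_choice a b with h | h <;> rw [hm, h] <;> simp
    rw [Finset.sum_congr rfl h3, Finset.sum_sub_distrib, Finset.sum_range_succ' β,
      Finset.sum_range_succ γ, h5, h6, Finset.sum_congr rfl h4]
    ring

lemma hemiFunExt_rotate {u : ℂ} (hu : ‖u‖ = 1) (a b : ℕ) (z : ℂ) :
    hemiFunExt a b (u * z) = u ^ a * conj u ^ b * hemiFunExt a b z := by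
  have h : normSq (u * z) = normSq z := by simp [normSq_eq_norm_sq, hu]
  simp only [hemiFunExt, halfStereo, h, map_mul]
  ring

lemma hemiEigenfun_rotate {u : ℂ} (hu : ‖u‖ = 1) (a b : ℕ) (z : ℂ) :
    hemiEigenfun a b (u * z) = u ^ a * conj u ^ b * hemiEigenfun a b z := by
  rw [hemiEigenfun, hemiEigenfun, Finset.mul_sum]
  refine Finset.sum_congr rfl fun j hj => ?_
  have hj' : j ≤ min a b := by simpa [Nat.lt_succ_iff] using hj
  have huu : u * conj u = 1 := by simp [mul_conj, normSq_eq_norm_sq, hu]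
  have e : u ^ a * conj u ^ b = u ^ (a - j) * conj u ^ (b - j) := by
    calc u ^ a * conj u ^ b = u ^ (a - j + j) * conj u ^ (b - j + j) := by
          rw [Nat.sub_add_cancel (by lia), Nat.sub_add_cancel (by lia)]
      _ = u ^ (a - j) * conj u ^ (b - j) * (u * conj u) ^ j := by rw [mul_pow]; ring
      _ = _ := by rw [huu, one_pow, mul_one]
  rw [hemiFunExt_rotate hu, e]
  ring

/-- On the radius `(0, 1)` the eigenfunction is a positive factor times a polynomial of degree
`a + b` in `halfStereo`, which has only finitely many zeros. -/
lemma hemiEigenfun_ne_zero (a b : ℕ) : hemiEigenfun a b ≠ 0 := by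
  intro h
  set q : Polynomial ℂ := ∑ j ∈ Finset.range (min a b + 1),
    Polynomial.C (eigenCoeff a b j) * Polynomial.X ^ (a + b - 2 * j) with hq
  have hcoeff : q.coeff (a + b) = 1 := by
    rw [hq, Polynomial.finsetSum_coeff, Finset.sum_eq_single 0]
    · simp [eigenCoeff]
    · intro j hj hj0
      have hj' : j ≤ min a b := by simpa [Nat.lt_succ_iff] using hj
      rw [Polynomial.coeff_C_mul, Polynomial.coeff_X_pow, if_neg (by lia), mul_zero]
    · simp
  have hq0 : q ≠ 0 := fun h => by simp [h] at hcoeff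
  have hroot : ∀ r ∈ Ioo (0 : ℝ) 1, q.IsRoot (halfStereo r) := by
    intro r hr
    have h1 : hemiEigenfun a b r = 0 := by rw [h]; rfl
    have hconj : conj (halfStereo r) = halfStereo r := by simp [halfStereo]
    have h2 : hemiEigenfun a b r =
        (((max (1 - normSq (r : ℂ)) 0 * (1 + normSq (r : ℂ))⁻¹ : ℝ)) : ℂ) *
          q.eval (halfStereo r) := by
      rw [hemiEigenfun, hq, Polynomial.eval_finsetSum, Finset.mul_sum]
      refine Finset.sum_congr rfl fun j hj => ?_
      have hj' : j ≤ min a b := by simpa [Nat.lt_succ_iff] using hj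
      rw [hemiFunExt, hconj, ← pow_add, show a - j + (b - j) = a + b - 2 * j by lia]
      simp only [Polynomial.eval_mul, Polynomial.eval_C, Polynomial.eval_pow, Polynomial.eval_X]
      ring
    rw [h2] at h1
    refine (mul_eq_zero.1 h1).resolve_left ?_
    have hr2 : 0 < 1 - normSq (r : ℂ) := by
      rw [normSq_ofReal]; nlinarith [hr.1, hr.2]
    have hr3 := normSq_nonneg (r : ℂ)
    rw [← ne_eq, ofReal_ne_zero, max_eq_left hr2.le]
    positivity
  have hinf : (halfStereo ∘ ofReal '' Ioo (0 : ℝ) 1).Infinite := by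
    refine (Ioo_infinite (zero_lt_one' ℝ)).image ?_
    refine injOn_halfStereo.comp ofReal_injective.injOn fun r hr => ?_
    rw [mem_closedBall_zero_iff, norm_real, Real.norm_eq_abs, abs_of_pos hr.1]
    exact hr.2.le
  refine hinf (q.rootSet_finite ℂ |>.subset ?_)
  rintro _ ⟨r, hr, rfl⟩
  rw [Polynomial.mem_rootSet_of_ne hq0]
  simpa using hroot r hr

lemma le_rank_dirichletEigenspace {l : ℕ} (hl : 1 ≤ l) :
    (l : Cardinal) ≤ Module.rank ℂ (dirichletEigenspace 1 ((l : ℝ) * (l + 1))) := by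
  have hmem : ∀ i : Fin l, hemiEigenfun i (l - 1 - i) ∈
      dirichletEigenspace 1 ((l : ℝ) * (l + 1)) := by
    intro i
    have h := hemiEigenfun_mem i (l - 1 - i)
    have hsum : ((i : ℕ) : ℝ) + ((l - 1 - i : ℕ) : ℝ) + 1 = l := by
      have : (i : ℕ) + (l - 1 - i) + 1 = l := by lia
      exact_mod_cast this
    have h2 : (((i : ℕ) : ℝ) + ((l - 1 - i : ℕ) : ℝ) + 1) *
        ((i : ℕ) + ((l - 1 - i : ℕ) : ℝ) + 2) = l * (l + 1) := by
      rw [← hsum]; ring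
    rwa [h2] at h
  -- The rotation by `u` separates the eigenfunctions: `u ^ 2` is a primitive `l`-th root of unity.
  set u : ℂ := exp (2 * Real.pi * I / (2 * l)) with hu
  have hl0 : (l : ℂ) ≠ 0 := by exact_mod_cast (by lia : l ≠ 0)
  have hu2 : IsPrimitiveRoot (u ^ 2) l := by
    have : u ^ 2 = exp (2 * Real.pi * I / l) := by
      rw [hu, ← exp_nat_mul]; congr 1; push_cast; field_simp
    rw [this]
    exact isPrimitiveRoot_exp l (by lia)
  have hu1 : ‖u‖ = 1 := by
    have : 2 * Real.pi * I / (2 * l) = ((Real.pi / l : ℝ) : ℂ) * I := by push_cast; field_simp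
    rw [hu, this, norm_exp_ofReal_mul_I]
  have hu0 : u ≠ 0 := by rw [← norm_ne_zero_iff, hu1]; norm_num
  have hind : LinearIndependent ℂ (fun i : Fin l => hemiEigenfun i (l - 1 - i)) := by
    refine Module.End.eigenvectors_linearIndependent' (LinearMap.funLeft ℂ ℂ (fun z : ℂ => u * z))
      (fun i : Fin l => u ^ (i : ℕ) * conj u ^ (l - 1 - i)) (fun i j hij => ?_) _ fun i => ?_
    · have huu : conj u = u⁻¹ := by
        rw [← mul_right_inj' hu0, mul_inv_cancel₀ hu0, mul_conj, normSq_eq_norm_sq, hu1]; simp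
      have key : ∀ i : Fin l, u ^ (i : ℕ) * conj u ^ (l - 1 - i) * u ^ (l - 1) = (u ^ 2) ^ (i : ℕ) := by
        intro i
        obtain ⟨k, hk⟩ : ∃ k, l - 1 = k + i := ⟨l - 1 - i, by lia⟩
        rw [hk, Nat.add_sub_cancel, huu, pow_add, inv_pow, mul_assoc, inv_mul_cancel_left₀
          (pow_ne_zero _ hu0), ← pow_mul, ← pow_add]
        congr 1; lia
      have := congrArg (· * u ^ (l - 1)) hij
      simp only [key] at this
      exact Fin.ext (hu2.pow_inj i.2 j.2 this)
    · rw [Module.End.hasEigenvector_iff, Module.End.mem_eigenspace_iff]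
      refine ⟨?_, hemiEigenfun_ne_zero _ _⟩
      ext z
      exact hemiEigenfun_rotate hu1 _ _ z
  have hind' : LinearIndependent ℂ (fun i : Fin l =>
      (⟨_, hmem i⟩ : dirichletEigenspace 1 ((l : ℝ) * (l + 1)))) :=
    LinearIndependent.of_comp (Submodule.subtype _) hind
  simpa using hind'.cardinal_le_rank

lemma toENat_rank_dirichletEigenspace {l : ℕ} (hl : 1 ≤ l) :
    Cardinal.toENat (Module.rank ℂ (dirichletEigenspace 1 ((l : ℝ) * (l + 1)))) = l := by
  rw [le_antisymm rank_dirichletEigenspace_le (le_rank_dirichletEigenspace hl)]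
  simp

/-! ### The Dirichlet spectrum -/

/-- The degree `l` of the `p`-th eigenvalue `l (l + 1)`: the least `l` with `p < l (l + 1) / 2`. -/
def eigenDegree (p : ℕ) : ℕ :=
  Nat.find (p := fun l => 2 * p < l * (l + 1)) ⟨2 * p + 1, by nlinarith⟩

/-- The triangular number `n (n + 1) / 2`, which counts the eigenvalues of degree at most `n`. -/
def triangular (n : ℕ) : ℕ := n * (n + 1) / 2

lemma two_mul_triangular (n : ℕ) : 2 * triangular n = n * (n + 1) :=
  Nat.mul_div_cancel' (Nat.even_mul_succ_self n).two_dvd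

lemma triangular_succ (n : ℕ) : triangular (n + 1) = triangular n + (n + 1) := by
  have h1 := two_mul_triangular n
  have h2 := two_mul_triangular (n + 1)
  nlinarith

/-- The eigenvalues of degree `m + 1` have the indices from `triangular m` up to
`triangular (m + 1) - 1`. -/
lemma eigenDegree_eq_succ_iff {p m : ℕ} :
    eigenDegree p = m + 1 ↔ triangular m ≤ p ∧ p < triangular (m + 1) := by
  rw [eigenDegree, Nat.find_eq_iff]
  have h1 := two_mul_triangular m
  have h2 := two_mul_triangular (m + 1)
  constructor
  · rintro ⟨h3, h4⟩
    have h5 := h4 m (Nat.lt_succ_self m)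
    constructor <;> nlinarith
  · rintro ⟨h3, h4⟩
    refine ⟨by nlinarith, fun k hk => ?_⟩
    have : k ≤ m := by lia
    have : k * (k + 1) ≤ m * (m + 1) := by gcongr
    lia

lemma one_le_eigenDegree (p : ℕ) : 1 ≤ eigenDegree p := by
  by_contra h
  have h0 : eigenDegree p = 0 := by lia
  rw [eigenDegree, Nat.find_eq_iff] at h0
  simp at h0

lemma eigenDegree_mono : Monotone eigenDegree := by
  intro p q hpq
  refine Nat.find_min' _ ?_
  have := Nat.find_spec (p := fun l => 2 * q < l * (l + 1)) ⟨2 * q + 1, by nlinarith⟩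
  exact lt_of_le_of_lt (by lia) this

/-- The list of the eigenvalues `l (l + 1)`, each repeated `l` times. -/
def hemiEigenvalue (p : ℕ) : ℝ := (eigenDegree p : ℝ) * (eigenDegree p + 1)

lemma setOf_hemiEigenvalue_eq (m : ℕ) :
    {p | hemiEigenvalue p = ((m + 1 : ℕ) : ℝ) * ((m + 1 : ℕ) + 1)} =
      Finset.Ico (triangular m) (triangular (m + 1)) := by
  ext p
  simp only [mem_ofPred_eq, Finset.coe_Ico, mem_Ico, ← eigenDegree_eq_succ_iff, hemiEigenvalue]
  constructor
  · intro h
    have : eigenDegree p * (eigenDegree p + 1) = (m + 1) * ((m + 1) + 1) := by exact_mod_cast h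
    nlinarith
  · intro h; rw [h]

lemma isDirichletSpectrum_hemiEigenvalue : IsDirichletSpectrum 1 hemiEigenvalue := by
  refine ⟨fun p q hpq => ?_, fun μ => ?_⟩
  · have : (eigenDegree p : ℝ) ≤ eigenDegree q := by exact_mod_cast eigenDegree_mono hpq
    simp only [hemiEigenvalue]
    gcongr
  · by_cases h : ∃ l : ℕ, 1 ≤ l ∧ (l : ℝ) * (l + 1) = μ
    · obtain ⟨l, hl, rfl⟩ := h
      obtain ⟨m, rfl⟩ := Nat.exists_eq_add_of_le' hl
      rw [toENat_rank_dirichletEigenspace hl, setOf_hemiEigenvalue_eq, Set.encard_coe_eq_coe_finsetCard,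
        Nat.card_Ico, triangular_succ, Nat.add_sub_cancel_left]
    · push Not at h
      rw [dirichletEigenspace_eq_bot h]
      have : {p | hemiEigenvalue p = μ} = ∅ := by
        ext p
        simpa [hemiEigenvalue] using h _ (one_le_eigenDegree p)
      simp [this]

/-- A monotone sequence is determined by the multiplicities of its values. -/
lemma eq_of_monotone_of_encard_fiber_eq {lam lam' : ℕ → ℝ} (h : Monotone lam) (h' : Monotone lam')
    (hc : ∀ μ, {p | lam p = μ}.encard = {p | lam' p = μ}.encard) : lam = lam' := by
  have key : ∀ {f g : ℕ → ℝ}, Monotone g → (∀ μ, {p | f p = μ}.encard = {p | g p = μ}.encard) →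
      ∀ p, (∀ q < p, f q = g q) → g p ≤ f p := by
    intro f g hg hc p ih
    by_contra! hlt
    have hsub : {q | g q = f p} ⊆ {q | f q = f p} ∩ Set.Iio p := by
      intro q hq
      have hqp : q < p := by
        by_contra! hpq
        have := hg hpq
        rw [mem_ofPred_eq] at hq
        linarith
      exact ⟨(ih q hqp).trans hq, hqp⟩
    have hss : {q | g q = f p} ⊂ {q | f q = f p} :=
      ⟨hsub.trans inter_subset_left, fun h => lt_irrefl p (hsub (h rfl)).2⟩
    have hfin : {q | g q = f p}.Finite := (finite_Iio p).subset fun q hq => (hsub hq).2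
    exact (hfin.encard_lt_encard hss).ne (hc _).symm
  ext p
  induction p using Nat.strong_induction_on with
  | _ p ih =>
    exact le_antisymm (key h (fun μ => (hc μ).symm) p fun q hq => (ih q hq).symm)
      (key h' hc p ih)

lemma IsDirichletSpectrum.unique {r₀ : ℝ} {lam lam' : ℕ → ℝ} (h : IsDirichletSpectrum r₀ lam)
    (h' : IsDirichletSpectrum r₀ lam') : lam = lam' :=
  eq_of_monotone_of_encard_fiber_eq h.1 h'.1 fun μ => (h.2 μ).trans (h'.2 μ).symm

/-! ### Uniqueness of the determinant -/

/-- Identity theorem: meromorphic functions on `ℂ` that agree on the half-plane `Re s > 1` and are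
analytic at `0` agree near `0`. -/
lemma Meromorphic.eventuallyEq_nhds_zero_of_eqOn {Z Z' : ℂ → ℂ} (hZ : Meromorphic Z)
    (hZ' : Meromorphic Z') (h0 : AnalyticAt ℂ Z 0) (h0' : AnalyticAt ℂ Z' 0)
    (h : ∀ s : ℂ, 1 < s.re → Z s = Z' s) : Z =ᶠ[𝓝 0] Z' := by
  -- The order of vanishing of the difference is infinite at `2`, hence everywhere.
  have hm : Meromorphic (Z - Z') := fun x => (hZ x).sub (hZ' x)
  have htop : meromorphicOrderAt (Z - Z') 2 = ⊤ := by
    rw [meromorphicOrderAt_eq_top_iff]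
    refine Filter.Eventually.filter_mono nhdsWithin_le_nhds ?_
    filter_upwards [(isOpen_lt continuous_const continuous_re).mem_nhds
      (show (1 : ℝ) < (2 : ℂ).re by norm_num)] with s hs
    simp [h s hs]
  have h0top : meromorphicOrderAt (Z - Z') 0 = ⊤ := by
    by_contra hne
    exact (hm.exists_meromorphicOrderAt_ne_top_iff_forall.1 ⟨0, hne⟩) 2 htop
  rw [meromorphicOrderAt_eq_top_iff] at h0top
  have hfr := h0top.frequently
  have := (h0.sub h0').frequently_zero_iff_eventually_zero.1 hfr
  filter_upwards [this] with s hs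
  simpa [sub_eq_zero] using hs

/-- The determinant depends neither on the number `p₀` of eigenvalues split off nor on the chosen
continuation: a further positive eigenvalue `λ` split off changes `Z'(0)` by `-log λ`. -/
lemma IsZetaDeterminant.unique {M2 r₀ D D' : ℝ} (h : IsZetaDeterminant M2 r₀ D)
    (h' : IsZetaDeterminant M2 r₀ D') : D = D' := by
  obtain ⟨lam, hlam, p, Z, ⟨hpos, hsum, hmer, han⟩, hD⟩ := h
  obtain ⟨lam', hlam', p', Z', ⟨hpos', hsum', hmer', han'⟩, hD'⟩ := h'
  obtain rfl := hlam.unique hlam'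
  -- By symmetry it suffices to treat `p ≤ p'`.
  have key : ∀ {p q : ℕ} {Z Z' : ℂ → ℂ}, p ≤ q → (∀ i, p ≤ i → 0 < lam i + M2) →
      (∀ s : ℂ, 1 < s.re → HasSum (fun k : ℕ => ((lam (p + k) + M2 : ℝ) : ℂ) ^ (-s)) (Z s)) →
      (∀ s : ℂ, 1 < s.re → HasSum (fun k : ℕ => ((lam (q + k) + M2 : ℝ) : ℂ) ^ (-s)) (Z' s)) →
      Meromorphic Z → Meromorphic Z' → AnalyticAt ℂ Z 0 → AnalyticAt ℂ Z' 0 →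
      ((∏ i ∈ Finset.range p, (lam i + M2) : ℝ) : ℂ) * Complex.exp (-deriv Z 0) =
      ((∏ i ∈ Finset.range q, (lam i + M2) : ℝ) : ℂ) * Complex.exp (-deriv Z' 0) := by
    intro p q Z Z' hpq hpos hs hs' hm hm' ha ha'
    obtain ⟨n, rfl⟩ := Nat.exists_eq_add_of_le hpq
    have hne : ∀ k, ((lam (p + k) + M2 : ℝ) : ℂ) ≠ 0 := fun k =>
      ofReal_ne_zero.2 (hpos _ (by lia)).ne'
    set F : ℂ → ℂ := fun s => ∑ k ∈ Finset.range n, ((lam (p + k) + M2 : ℝ) : ℂ) ^ (-s) with hF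
    have hder : HasDerivAt F (∑ k ∈ Finset.range n, -Complex.log ((lam (p + k) + M2 : ℝ) : ℂ)) 0 := by
      refine HasDerivAt.fun_sum fun k _ => ?_
      have := ((hasDerivAt_id (0 : ℂ)).neg).const_cpow (c := ((lam (p + k) + M2 : ℝ) : ℂ))
        (Or.inl (hne k))
      simpa using this
    have hFd : Differentiable ℂ F := by
      refine Differentiable.fun_sum fun k _ => ?_
      exact differentiable_neg.const_cpow (Or.inl (hne k))
    have hFa : ∀ s, AnalyticAt ℂ F s := fun s => hFd.analyticAt s
    have hEq : Z =ᶠ[𝓝 0] F + Z' := by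
      refine hm.eventuallyEq_nhds_zero_of_eqOn (fun x => (hFa x).meromorphicAt.add (hm' x)) ha
        ((hFa 0).add ha') fun s hs1 => ?_
      have h2 := hs' s hs1
      simp only [add_assoc] at h2
      have h3 := (hasSum_nat_add_iff (f := fun k : ℕ => ((lam (p + k) + M2 : ℝ) : ℂ) ^ (-s)) n).1
        (by simpa only [add_comm n] using h2)
      rw [(hs s hs1).unique h3, Pi.add_apply, add_comm]
    have hd : deriv Z 0 = (∑ k ∈ Finset.range n, -Complex.log ((lam (p + k) + M2 : ℝ) : ℂ)) +
        deriv Z' 0 := by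
      rw [hEq.deriv_eq, (hder.add ha'.differentiableAt.hasDerivAt).deriv]
    rw [hd, Finset.prod_range_add, neg_add, Complex.exp_add, ← Finset.sum_neg_distrib,
      Complex.exp_sum]
    simp only [neg_neg]
    rw [Finset.prod_congr rfl fun k _ => Complex.exp_log (hne k)]
    push_cast
    ring
  have : (D : ℂ) = D' := by
    rw [hD, hD']
    rcases le_total p p' with hpp | hpp
    · exact key hpp hpos hsum hsum' hmer hmer' han han'
    · exact (key hpp hpos' hsum' hsum hmer' hmer han' han).symm
  exact_mod_cast this

/-! ### Sums and products over the spectrum -/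

lemma eigenDegree_triangular_add (n k : ℕ) : n + 1 ≤ eigenDegree (triangular n + k) := by
  have h1 : eigenDegree (triangular n) = n + 1 := by
    rw [eigenDegree_eq_succ_iff, triangular_succ]; lia
  rw [← h1]
  exact eigenDegree_mono (by lia)

/-- Summation over the spectrum, grouped by degree. -/
lemma hasSum_eigenDegree {F : ℕ → ℂ} {S : ℂ} (n : ℕ)
    (h : HasSum (fun m : ℕ => ((n + m + 1 : ℕ) : ℂ) * F (n + m + 1)) S)
    (hs : Summable fun m : ℕ => ((n + m + 1 : ℕ) : ℝ) * ‖F (n + m + 1)‖) :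
    HasSum (fun k => F (eigenDegree (triangular n + k))) S := by
  set g : ℕ → ℕ := fun k => eigenDegree (triangular n + k) - (n + 1) with hg
  have hgk : ∀ k m, g k = m ↔ eigenDegree (triangular n + k) = n + m + 1 := by
    intro k m
    have := eigenDegree_triangular_add n k
    simp only [hg]; lia
  have htm : ∀ m, triangular n ≤ triangular (n + m) := by
    intro m
    induction m with
    | zero => simp
    | succ m ih => rw [← add_assoc, triangular_succ]; lia
  have hfib : ∀ m, {k | g k = m} = Finset.Ico (triangular (n + m) - triangular n)
      (triangular (n + m + 1) - triangular n) := by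
    intro m
    ext k
    simp only [mem_ofPred_eq, hgk, eigenDegree_eq_succ_iff, Finset.coe_Ico, mem_Ico]
    have := htm m
    lia
  have hcard : ∀ m, Nat.card {k // g k = m} = n + m + 1 := by
    intro m
    rw [← Set.coe_ofPred, hfib, Nat.card_coe_set_eq, Set.ncard_coe_finset, Nat.card_Ico,
      triangular_succ]
    have := htm m
    lia
  have hfin : ∀ m, Finite {k // g k = m} := fun m =>
    Nat.finite_of_card_ne_zero (by rw [hcard]; lia)
  have hval : ∀ m (c : {k // g k = m}), F (eigenDegree (triangular n + c)) = F (n + m + 1) :=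
    fun m c => by rw [(hgk c m).1 c.2]
  rw [← (Equiv.sigmaFiberEquiv g).hasSum_iff]
  have hconst : ∀ {α : Type} [AddCommMonoid α] [TopologicalSpace α] (m : ℕ) (x : α),
      HasSum (fun _ : {k // g k = m} => x) ((n + m + 1) • x) := by
    intro α _ _ m x
    have := Fintype.ofFinite {k // g k = m}
    have h1 := hasSum_fintype (fun _ : {k // g k = m} => x)
    rwa [Finset.sum_const, Finset.card_univ, ← Nat.card_eq_fintype_card, hcard] at h1
  have hnorm : ∀ m, HasSum (fun c : {k // g k = m} => ‖F (eigenDegree (triangular n + c))‖)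
      (((n + m + 1 : ℕ) : ℝ) * ‖F (n + m + 1)‖) := by
    intro m
    simp only [hval, ← nsmul_eq_mul]
    exact hconst m _
  refine HasSum.sigma_of_hasSum h (fun m => ?_) ?_
  · change HasSum (fun c : {k // g k = m} => F (eigenDegree (triangular n + c))) _
    simp only [hval, ← nsmul_eq_mul]
    exact hconst m _
  · refine Summable.of_norm ((summable_sigma_of_nonneg fun _ => norm_nonneg _).2
      ⟨fun m => (hnorm m).summable, ?_⟩)
    refine hs.congr fun m => ?_
    exact (hnorm m).tsum_eq.symm

/-- The product over the eigenvalues of degree at most `n`, grouped by degree. -/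
lemma prod_range_triangular {M : Type*} [CommMonoid M] (F : ℕ → M) (n : ℕ) :
    ∏ p ∈ Finset.range (triangular n), F (eigenDegree p) =
      ∏ m ∈ Finset.range n, F (m + 1) ^ (m + 1) := by
  induction n with
  | zero => simp [triangular]
  | succ n ih =>
    rw [triangular_succ, Finset.prod_range_add, ih,
      Finset.prod_range_succ (fun m => F (m + 1) ^ (m + 1))]
    congr 1
    rw [Finset.prod_congr rfl (g := fun _ => F (n + 1)), Finset.prod_const, Finset.card_range]
    intro k hk
    have := Finset.mem_range.1 hk
    rw [eigenDegree_eq_succ_iff (m := n) |>.2 ⟨by lia, by rw [triangular_succ]; lia⟩]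

/-! ### The binomial series with uniform remainder -/

/-- The generalized binomial coefficient `a (a - 1) ⋯ (a - j + 1) / j!`. -/
noncomputable def binomCoeff (a : ℂ) (j : ℕ) : ℂ := (∏ i ∈ Finset.range j, (a - i)) / j.factorial

lemma binomCoeff_succ_mul (a : ℂ) (j : ℕ) :
    (j + 1 : ℂ) * binomCoeff a (j + 1) = a * binomCoeff (a - 1) j := by
  have h : (j.factorial : ℂ) ≠ 0 := by exact_mod_cast j.factorial_ne_zero
  have h2 : (j + 1 : ℂ) ≠ 0 := by exact_mod_cast j.succ_ne_zero
  have e : ∀ i ∈ Finset.range j, a - ((i + 1 : ℕ) : ℂ) = a - 1 - i := fun i _ => by push_cast; ring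
  rw [binomCoeff, binomCoeff, Finset.prod_range_succ', Nat.factorial_succ, Finset.prod_congr rfl e]
  push_cast
  field_simp
  simp [mul_comm]

@[simp] lemma binomCoeff_zero (a : ℂ) : binomCoeff a 0 = 1 := by simp [binomCoeff]

lemma binomCoeff_one (a : ℂ) : binomCoeff a 1 = a := by simp [binomCoeff]

lemma binomCoeff_two (a : ℂ) : binomCoeff a 2 = a * (a - 1) / 2 := by
  simp [binomCoeff, Finset.prod_range_succ]

/-- The remainder of order `N` of the binomial series of `(1 + x) ^ a`. -/
noncomputable def binomRem (N : ℕ) (a : ℂ) (x : ℝ) : ℂ :=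
  ((1 + x : ℝ) : ℂ) ^ a - ∑ j ∈ Finset.range N, binomCoeff a j * (x : ℂ) ^ j

lemma hasDerivAt_binomRem (N : ℕ) (a : ℂ) {x : ℝ} (hx : |x| ≤ 1 / 2) :
    HasDerivAt (binomRem (N + 1) a) (a * binomRem N (a - 1) x) x := by
  have h1 : 0 < 1 + x := by have := (abs_le.1 hx).1; linarith
  have h2 : HasDerivAt (fun x : ℝ => ((1 + x : ℝ) : ℂ) ^ a) (a * ((1 + x : ℝ) : ℂ) ^ (a - 1)) x := by
    have h3 : HasDerivAt (fun x : ℝ => ((1 + x : ℝ) : ℂ)) 1 x := by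
      simpa using ((hasDerivAt_id' x).const_add 1).ofReal_comp
    have h4 : HasDerivAt (fun w : ℂ => w ^ a) (a * ((1 + x : ℝ) : ℂ) ^ (a - 1)) ((1 + x : ℝ) : ℂ) := by
      exact ((hasDerivAt_id _).cpow_const (c := a) (ofReal_mem_slitPlane.2 h1)).congr_deriv
        (by rw [mul_one]; rfl)
    simpa [Function.comp_def] using h4.comp_of_eq x h3 rfl
  have h5 : HasDerivAt (fun x : ℝ => ∑ j ∈ Finset.range (N + 1), binomCoeff a j * (x : ℂ) ^ j)
      (∑ j ∈ Finset.range (N + 1), binomCoeff a j * (j * (x : ℂ) ^ (j - 1))) x := by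
    refine HasDerivAt.fun_sum fun j _ => HasDerivAt.const_mul _ ?_
    exact (hasDerivAt_pow j (x : ℂ)).comp_ofReal
  refine (h2.sub h5).congr_deriv ?_
  rw [binomRem, mul_sub, Finset.sum_range_succ', Finset.mul_sum]
  congr 1
  simp only [Nat.cast_zero, zero_mul, mul_zero, add_zero, Nat.add_sub_cancel]
  refine Finset.sum_congr rfl fun j _ => ?_
  have := binomCoeff_succ_mul a j
  push_cast
  linear_combination (x : ℂ) ^ j * this

/-- Taylor's theorem for `(1 + x) ^ a`, uniformly for bounded complex `a`. By induction on the
order, since the derivative of a remainder is a remainder of lower order. -/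
lemma exists_bound_binomRem (N : ℕ) (A : ℝ) : ∃ C : ℝ, 0 ≤ C ∧ ∀ a : ℂ, ‖a‖ ≤ A → ∀ x : ℝ,
    |x| ≤ 1 / 2 → ‖binomRem N a x‖ ≤ C * |x| ^ N := by
  induction N generalizing A with
  | zero =>
    refine ⟨Real.exp A, by positivity, fun a ha x hx => ?_⟩
    have h1 : 0 < 1 + x := by have := (abs_le.1 hx).1; linarith
    have hA : 0 ≤ A := (norm_nonneg _).trans ha
    simp only [binomRem, Finset.range_zero, Finset.sum_empty, sub_zero, pow_zero, mul_one]
    rw [norm_cpow_eq_rpow_re_of_pos h1, Real.rpow_def_of_pos h1]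
    refine Real.exp_le_exp.2 ((le_abs_self _).trans ?_)
    rw [abs_mul]
    have hlog : |Real.log (1 + x)| ≤ 1 := by
      rw [abs_le] at hx ⊢
      constructor
      · have := Real.one_sub_inv_le_log_of_pos h1
        have h2 : (1 + x)⁻¹ ≤ 2 := by
          rw [inv_le_comm₀ h1 (by norm_num)]; linarith
        linarith
      · have := Real.log_le_sub_one_of_pos h1; linarith
    calc |Real.log (1 + x)| * |a.re| ≤ 1 * A := by
          gcongr; exact (abs_re_le_norm a).trans ha
      _ = A := one_mul A
  | succ N ih =>
    obtain ⟨C, hC, h⟩ := ih (A + 1)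
    refine ⟨|A| * C, by positivity, fun a ha x hx => ?_⟩
    have hA : 0 ≤ A := (norm_nonneg _).trans ha
    have hsub : ∀ y ∈ Icc (-|x|) |x|, |y| ≤ |x| := fun y hy => abs_le.2 hy
    have h0 : binomRem (N + 1) a 0 = 0 := by
      rw [binomRem, Finset.sum_range_succ']
      simp
    have hmv := (convex_Icc (-|x|) |x|).norm_image_sub_le_of_norm_hasDerivWithin_le
      (f := binomRem (N + 1) a) (f' := fun y => a * binomRem N (a - 1) y) (C := A * (C * |x| ^ N))
      (x := 0) (y := x)
      (fun y hy => (hasDerivAt_binomRem N a ((hsub y hy).trans hx)).hasDerivWithinAt)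
      (fun y hy => ?_) (by simp) ⟨neg_abs_le x, le_abs_self x⟩
    · rw [h0, sub_zero, sub_zero, Real.norm_eq_abs] at hmv
      rw [abs_of_nonneg hA]
      calc _ ≤ _ := hmv
        _ = _ := by ring
    · rw [norm_mul]
      have h2 := h (a - 1) ((norm_sub_le _ _).trans (by simpa using ha)) y ((hsub y hy).trans hx)
      gcongr
      exact h2.trans (mul_le_mul_of_nonneg_left
        (pow_le_pow_left₀ (abs_nonneg y) (hsub y hy) N) hC)

/-! ### Meromorphic continuation of the zeta function -/

lemma hasSum_of_eq {f g : ℕ → ℂ} {a : ℂ} (h : HasSum g a) (e : ∀ m, f m = g m) : HasSum f a :=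
  (funext e : f = g) ▸ h

/-- The Riemann zeta function without its first `n` terms. -/
noncomputable def tailZeta (n : ℕ) (s : ℂ) : ℂ :=
  riemannZeta s - ∑ k ∈ Finset.range n, 1 / ((k : ℂ) + 1) ^ s

lemma hasSum_tailZeta (n : ℕ) {s : ℂ} (hs : 1 < s.re) :
    HasSum (fun m : ℕ => 1 / ((n + m + 1 : ℕ) : ℂ) ^ s) (tailZeta n s) := by
  have h1 : Summable fun k : ℕ => 1 / ((k : ℂ) + 1) ^ s := by
    have := (summable_nat_add_iff (f := fun k : ℕ => 1 / (k : ℂ) ^ s) 1).2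
      (Complex.summable_one_div_nat_cpow.2 hs)
    simpa using this
  have h2 : HasSum (fun k : ℕ => 1 / ((k : ℂ) + 1) ^ s) (riemannZeta s) := by
    rw [zeta_eq_tsum_one_div_nat_add_one_cpow hs]; exact h1.hasSum
  have h3 := (hasSum_nat_add_iff' (f := fun k : ℕ => 1 / ((k : ℂ) + 1) ^ s) n).2 h2
  refine hasSum_of_eq h3 fun m => ?_
  push_cast
  rw [add_comm (n : ℂ) m]

lemma differentiableAt_tailZeta (n : ℕ) {s : ℂ} (hs : s ≠ 1) :
    DifferentiableAt ℂ (tailZeta n) s := by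
  refine (differentiableAt_riemannZeta hs).sub (DifferentiableAt.fun_sum fun k _ => ?_)
  have hk : ((k : ℂ) + 1) ≠ 0 := by exact_mod_cast k.succ_ne_zero
  exact (differentiableAt_const _).div (differentiableAt_id.const_cpow (Or.inl hk)) 
    (by simp [cpow_eq_zero_iff, hk])

lemma hasDerivAt_tailZeta (n : ℕ) {s : ℂ} (hs : s ≠ 1) :
    HasDerivAt (tailZeta n) (deriv riemannZeta s +
      ∑ k ∈ Finset.range n, Complex.log ((k : ℂ) + 1) / ((k : ℂ) + 1) ^ s) s := by
  have h1 : HasDerivAt (fun s : ℂ => ∑ k ∈ Finset.range n, 1 / ((k : ℂ) + 1) ^ s)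
      (∑ k ∈ Finset.range n, -(Complex.log ((k : ℂ) + 1) / ((k : ℂ) + 1) ^ s)) s := by
    refine HasDerivAt.fun_sum fun k _ => ?_
    have hk : ((k : ℂ) + 1) ≠ 0 := by exact_mod_cast k.succ_ne_zero
    have := ((hasDerivAt_id s).const_cpow (c := (k : ℂ) + 1) (Or.inl hk)).fun_inv
      (by simp [cpow_eq_zero_iff, hk])
    simp only [one_div]
    refine this.congr_deriv ?_
    have h0 : ((k : ℂ) + 1) ^ s ≠ 0 := by simp [cpow_eq_zero_iff, hk]
    simp only [id]
    field_simp
  refine ((differentiableAt_riemannZeta hs).hasDerivAt.sub h1).congr_deriv ?_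
  rw [Finset.sum_neg_distrib, sub_neg_eq_add]

lemma meromorphicAt_riemannZeta (s : ℂ) : MeromorphicAt riemannZeta s := by
  have h1 : MeromorphicAt (fun s : ℂ => (s - 1)⁻¹ * riemannZeta₁ s) s :=
    (((analyticAt_id.sub analyticAt_const).meromorphicAt).inv).mul
      (differentiable_riemannZeta₁.analyticAt s).meromorphicAt
  refine h1.congr ?_
  by_cases hs : s = 1
  · subst hs
    filter_upwards [self_mem_nhdsWithin] with t ht
    exact (riemannZeta_eq_inv_sub_mul ht).symm
  · refine Filter.Eventually.filter_mono nhdsWithin_le_nhds ?_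
    filter_upwards [compl_singleton_mem_nhds hs] with t ht
    exact (riemannZeta_eq_inv_sub_mul ht).symm

lemma meromorphicAt_tailZeta (n : ℕ) (s : ℂ) : MeromorphicAt (tailZeta n) s := by
  refine (meromorphicAt_riemannZeta s).sub (AnalyticAt.meromorphicAt ?_)
  refine Differentiable.analyticAt (f := fun s : ℂ => ∑ k ∈ Finset.range n, 1 / ((k : ℂ) + 1) ^ s)
    (Differentiable.fun_sum fun k _ => ?_) s
  have hk : ((k : ℂ) + 1) ≠ 0 := by exact_mod_cast k.succ_ne_zero
  exact (differentiable_const _).div (differentiable_id.const_cpow (Or.inl hk))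
    (by simp [cpow_eq_zero_iff, hk])

/-- The relative correction `x_l` in `l (l + 1) + M² = l² (1 + x_l)`. -/
noncomputable def relShift (M2 : ℝ) (l : ℕ) : ℝ := (l + M2) / (l : ℝ) ^ 2

lemma abs_relShift_le {M2 : ℝ} {l : ℕ} (hl : |M2| ≤ l) (hl4 : 4 ≤ l) :
    |relShift M2 l| ≤ 2 / l ∧ |relShift M2 l| ≤ 1 / 2 := by
  have h4 : (4 : ℝ) ≤ l := by exact_mod_cast hl4
  have hl0 : (0 : ℝ) < l := by linarith
  have h1 : |relShift M2 l| ≤ 2 / l := by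
    rw [relShift, abs_div, abs_of_pos (by positivity : (0 : ℝ) < (l : ℝ) ^ 2),
      div_le_div_iff₀ (by positivity) hl0]
    have := abs_add_le (l : ℝ) M2
    rw [abs_of_pos hl0] at this
    nlinarith
  refine ⟨h1, h1.trans ?_⟩
  rw [div_le_div_iff₀ hl0 (by norm_num)]
  linarith

lemma mul_succ_add_eq {M2 : ℝ} {l : ℕ} (hl : 1 ≤ l) :
    (l : ℝ) * (l + 1) + M2 = (l : ℝ) ^ 2 * (1 + relShift M2 l) := by
  have : (l : ℝ) ≠ 0 := by exact_mod_cast (by lia : l ≠ 0)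
  rw [relShift]; field_simp; ring

/-- The `l`-th term of the zeta function minus `N` terms of its expansion for large `l`. -/
noncomputable def zetaRem (M2 : ℝ) (N l : ℕ) (s : ℂ) : ℂ :=
  (l : ℂ) ^ (1 - 2 * s) * binomRem N (-s) (relShift M2 l)

/-- The contribution of the `j`-th term of the binomial expansion to the zeta function. -/
noncomputable def zetaTerm (M2 : ℝ) (n j : ℕ) (s : ℂ) : ℂ :=
  binomCoeff (-s) j * ∑ i ∈ Finset.range (j + 1),
    (j.choose i : ℂ) * (M2 : ℂ) ^ i * tailZeta n (2 * s + j + i - 1)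

lemma hasSum_zetaTerm (M2 : ℝ) (n j : ℕ) {s : ℂ} (hs : 2 - j < 2 * s.re) :
    HasSum (fun m : ℕ => ((n + m + 1 : ℕ) : ℂ) ^ (1 - 2 * s) *
      (binomCoeff (-s) j * (relShift M2 (n + m + 1) : ℂ) ^ j)) (zetaTerm M2 n j s) := by
  have h1 : HasSum (fun m : ℕ => ∑ i ∈ Finset.range (j + 1), (j.choose i : ℂ) * (M2 : ℂ) ^ i *
      (1 / ((n + m + 1 : ℕ) : ℂ) ^ (2 * s + j + i - 1)))
      (∑ i ∈ Finset.range (j + 1),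
        (j.choose i : ℂ) * (M2 : ℂ) ^ i * tailZeta n (2 * s + j + i - 1)) := by
    refine hasSum_sum fun i _ => (hasSum_tailZeta n ?_).mul_left _
    have : (0 : ℝ) ≤ i := Nat.cast_nonneg i
    simp
    linarith
  refine hasSum_of_eq (h1.mul_left (binomCoeff (-s) j)) fun m => ?_
  set l := n + m + 1 with hl
  have hl0 : (l : ℂ) ≠ 0 := by exact_mod_cast (by lia : l ≠ 0)
  rw [mul_left_comm]
  congr 1
  have e1 : (relShift M2 l : ℂ) ^ j = (∑ i ∈ Finset.range (j + 1),
      (M2 : ℂ) ^ i * (l : ℂ) ^ (j - i) * (j.choose i : ℂ)) / (l : ℂ) ^ (2 * j) := by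
    rw [relShift]
    push_cast
    rw [div_pow, ← pow_mul, add_comm, add_pow]
  rw [e1, Finset.sum_div, Finset.mul_sum]
  refine Finset.sum_congr rfl fun i hi => ?_
  have hij : i ≤ j := by simpa [Nat.lt_succ_iff] using hi
  have e2 : (l : ℂ) ^ (1 - 2 * s) * ((l : ℂ) ^ (j - i) / (l : ℂ) ^ (2 * j)) =
      1 / (l : ℂ) ^ (2 * s + j + i - 1) := by
    rw [one_div, ← cpow_neg, ← cpow_natCast, ← cpow_natCast, ← cpow_sub _ _ hl0,
      ← cpow_add _ _ hl0]
    congr 1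
    push_cast [hij]
    ring
  linear_combination ((M2 : ℂ) ^ i * (j.choose i : ℂ)) * e2

/-- Without any subtraction, `zetaRem` is the whole term of degree `l`, multiplicity included. -/
lemma zetaRem_zero {M2 : ℝ} {l : ℕ} (hl : |M2| ≤ l) (hl4 : 4 ≤ l) (s : ℂ) :
    zetaRem M2 0 l s = l * (((l : ℝ) * (l + 1) + M2 : ℝ) : ℂ) ^ (-s) := by
  have hl0 : (l : ℂ) ≠ 0 := by exact_mod_cast (by lia : l ≠ 0)
  have hx : 0 ≤ 1 + relShift M2 l := by
    have := (abs_le.1 (abs_relShift_le hl hl4).2).1; linarith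
  rw [zetaRem, binomRem, mul_succ_add_eq (by lia), ofReal_mul,
    mul_cpow_ofReal_nonneg (by positivity) hx]
  have e : (((l : ℝ) ^ 2 : ℝ) : ℂ) ^ (-s) = (l : ℂ) ^ (-(2 * s)) := by
    have h2 : (((l : ℝ) ^ 2 : ℝ) : ℂ) = (((l ^ 2 : ℕ)) : ℂ) := by push_cast; ring
    rw [h2, pow_two, Nat.cast_mul, natCast_mul_natCast_cpow, ← cpow_add _ _ hl0]
    congr 1; ring
  rw [e, sub_eq_add_neg 1 (2 * s), cpow_add _ _ hl0, cpow_one]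
  simp
  ring

lemma zetaRem_eq_succ_add (M2 : ℝ) (N l : ℕ) (s : ℂ) :
    zetaRem M2 N l s = zetaRem M2 (N + 1) l s +
      (l : ℂ) ^ (1 - 2 * s) * (binomCoeff (-s) N * (relShift M2 l : ℂ) ^ N) := by
  simp only [zetaRem, binomRem, Finset.sum_range_succ]
  ring

/-- The remainders are dominated, locally uniformly on `Re s > 1 - N / 2`, by a summable sequence. -/
lemma exists_summable_bound_zetaRem {M2 : ℝ} {n : ℕ} (hn : |M2| ≤ n) (hn4 : 4 ≤ n) (N : ℕ)
    {σ : ℝ} (hσ : 2 - N < 2 * σ) (A : ℝ) : ∃ u : ℕ → ℝ, Summable u ∧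
      ∀ m (s : ℂ), σ ≤ s.re → ‖s‖ ≤ A → ‖zetaRem M2 N (n + m + 1) s‖ ≤ u m := by
  obtain ⟨C, hC, hb⟩ := exists_bound_binomRem N A
  refine ⟨fun m => C * 2 ^ N * (((n + m + 1 : ℕ) : ℝ) ^ (1 - 2 * σ - N)), ?_, fun m s hs hA => ?_⟩
  · refine Summable.mul_left _ ?_
    have h := (Real.summable_nat_rpow (p := 1 - 2 * σ - N)).2 (by linarith)
    have := (summable_nat_add_iff (n + 1)).2 h
    refine this.congr fun m => ?_
    rw [show m + (n + 1) = n + m + 1 by ring]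
  · set l := n + m + 1 with hl
    have hl1 : (1 : ℝ) ≤ l := by exact_mod_cast (by lia : 1 ≤ l)
    have hlM : |M2| ≤ l := hn.trans (by exact_mod_cast (by lia : n ≤ l))
    obtain ⟨h1, h2⟩ := abs_relShift_le hlM (by lia : 4 ≤ l)
    have h3 := hb (-s) (by simpa using hA) _ h2
    rw [zetaRem, norm_mul, norm_natCast_cpow_of_pos (by lia)]
    have h4 : (l : ℝ) ^ (1 - 2 * s).re ≤ (l : ℝ) ^ (1 - 2 * σ) := by
      refine Real.rpow_le_rpow_of_exponent_le hl1 ?_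
      simp; linarith
    have h5 : (l : ℝ) ^ (1 - 2 * σ - N) = (l : ℝ) ^ (1 - 2 * σ) / (l : ℝ) ^ N := by
      rw [Real.rpow_sub (by linarith), Real.rpow_natCast]
    calc _ ≤ (l : ℝ) ^ (1 - 2 * σ) * (C * (2 / l) ^ N) := by
          gcongr
          exact h3.trans (by gcongr)
      _ = C * 2 ^ N * (l : ℝ) ^ (1 - 2 * σ - N) := by rw [h5, div_pow]; ring

lemma differentiable_binomCoeff_neg (j : ℕ) : Differentiable ℂ fun s => binomCoeff (-s) j := by
  unfold binomCoeff
  refine Differentiable.div_const ?_ _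
  exact Differentiable.fun_finsetProd fun i _ => differentiable_neg.sub_const _

lemma differentiable_zetaRem {M2 : ℝ} {l : ℕ} (hl : |M2| ≤ l) (hl4 : 4 ≤ l) (N : ℕ) :
    Differentiable ℂ (zetaRem M2 N l) := by
  have hl0 : (l : ℂ) ≠ 0 := by exact_mod_cast (by lia : l ≠ 0)
  have hx : ((1 + relShift M2 l : ℝ) : ℂ) ≠ 0 := by
    have := (abs_le.1 (abs_relShift_le hl hl4).2).1
    exact ofReal_ne_zero.2 (by linarith)
  refine Differentiable.mul ?_ (Differentiable.sub ?_ (Differentiable.fun_sum fun j _ => ?_))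
  · exact ((differentiable_const _).sub (differentiable_id.const_mul 2)).const_cpow (Or.inl hl0)
  · exact differentiable_neg.const_cpow (Or.inl hx)
  · exact (differentiable_binomCoeff_neg j).mul_const _

/-- The sum of the remainders, analytic on `Re s > 1 - N / 2`. -/
noncomputable def zetaRemSum (M2 : ℝ) (n N : ℕ) (s : ℂ) : ℂ :=
  ∑' m, zetaRem M2 N (n + m + 1) s

lemma summable_zetaRem {M2 : ℝ} {n : ℕ} (hn : |M2| ≤ n) (hn4 : 4 ≤ n) {N : ℕ} {s : ℂ}
    (hs : 2 - N < 2 * s.re) : Summable fun m => ‖zetaRem M2 N (n + m + 1) s‖ := by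
  obtain ⟨u, hu, hb⟩ := exists_summable_bound_zetaRem hn hn4 N hs ‖s‖
  exact hu.of_nonneg_of_le (fun _ => norm_nonneg _) fun m => hb m s le_rfl le_rfl

lemma zetaRemSum_analytic_and_deriv {M2 : ℝ} {n : ℕ} (hn : |M2| ≤ n) (hn4 : 4 ≤ n) {N : ℕ} {s : ℂ}
    (hs : 2 - N < 2 * s.re) : AnalyticAt ℂ (zetaRemSum M2 n N) s ∧
      HasSum (fun m => deriv (zetaRem M2 N (n + m + 1)) s) (deriv (zetaRemSum M2 n N) s) := by
  set σ := (s.re + (2 - N) / 2) / 2 with hσ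
  have h1 : 2 - N < 2 * σ := by rw [hσ]; linarith
  have h2 : σ < s.re := by rw [hσ]; linarith
  obtain ⟨u, hu, hb⟩ := exists_summable_bound_zetaRem hn hn4 N h1 (‖s‖ + 1)
  set U : Set ℂ := {z | σ < z.re} ∩ {z | ‖z‖ < ‖s‖ + 1} with hU
  have hUo : IsOpen U := (isOpen_lt continuous_const continuous_re).inter
    (isOpen_lt continuous_norm continuous_const)
  have hsU : s ∈ U := ⟨h2, by simp⟩
  have hlM : ∀ m, |M2| ≤ ((n + m + 1 : ℕ) : ℝ) := fun m =>
    hn.trans (by exact_mod_cast (by lia : n ≤ n + m + 1))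
  have hd : ∀ m, DifferentiableOn ℂ (zetaRem M2 N (n + m + 1)) U := fun m =>
    (differentiable_zetaRem (hlM m) (by lia) N).differentiableOn
  have hb' : ∀ m, ∀ w ∈ U, ‖zetaRem M2 N (n + m + 1) w‖ ≤ u m := fun m w hw =>
    hb m w hw.1.le (le_of_lt hw.2)
  exact ⟨(differentiableOn_tsum_of_summable_norm hu hd hUo hb').analyticAt (hUo.mem_nhds hsU),
    hasSum_deriv_of_summable_norm hu hd hUo hb' hsU⟩

/-- The zeta function continued to `Re s > 1 - N / 2`. -/
noncomputable def zetaStep (M2 : ℝ) (n N : ℕ) (s : ℂ) : ℂ :=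
  ∑ j ∈ Finset.range N, zetaTerm M2 n j s + zetaRemSum M2 n N s

lemma zetaStep_succ {M2 : ℝ} {n : ℕ} (hn : |M2| ≤ n) (hn4 : 4 ≤ n) {N : ℕ} {s : ℂ}
    (hs : 2 - N < 2 * s.re) : zetaStep M2 n (N + 1) s = zetaStep M2 n N s := by
  have h1 : Summable fun m => zetaRem M2 (N + 1) (n + m + 1) s :=
    (summable_zetaRem hn hn4 (by push_cast; linarith)).of_norm
  have h2 := hasSum_zetaTerm M2 n N hs
  have h3 : zetaRemSum M2 n N s = zetaRemSum M2 n (N + 1) s + zetaTerm M2 n N s := by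
    rw [zetaRemSum, zetaRemSum, ← h2.tsum_eq, ← h1.tsum_add h2.summable]
    exact tsum_congr fun m => zetaRem_eq_succ_add M2 N _ s
  rw [zetaStep, zetaStep, Finset.sum_range_succ, h3]
  ring

lemma zetaStep_eq_of_le {M2 : ℝ} {n : ℕ} (hn : |M2| ≤ n) (hn4 : 4 ≤ n) {N N' : ℕ} (hN : N ≤ N')
    {s : ℂ} (hs : 2 - N < 2 * s.re) : zetaStep M2 n N' s = zetaStep M2 n N s := by
  induction N', hN using Nat.le_induction with
  | base => rfl
  | succ k hk ih =>
    have : (N : ℝ) ≤ k := by exact_mod_cast hk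
    rw [zetaStep_succ hn hn4 (by linarith), ih]

/-- The continued zeta function: at each point, any of the continuations that are valid there. -/
noncomputable def zetaCont (M2 : ℝ) (n : ℕ) (s : ℂ) : ℂ :=
  zetaStep M2 n (⌈2 - 2 * s.re⌉₊ + 1) s

lemma zetaCont_eq {M2 : ℝ} {n : ℕ} (hn : |M2| ≤ n) (hn4 : 4 ≤ n) {N : ℕ}
    {s : ℂ} (hs : 2 - N < 2 * s.re) : zetaCont M2 n s = zetaStep M2 n N s := by
  rw [zetaCont]
  rcases le_total N (⌈2 - 2 * s.re⌉₊ + 1) with h | h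
  · exact zetaStep_eq_of_le hn hn4 h hs
  · refine (zetaStep_eq_of_le hn hn4 h ?_).symm
    have := Nat.le_ceil (2 - 2 * s.re)
    push_cast
    linarith

lemma meromorphicAt_zetaTerm (M2 : ℝ) (n j : ℕ) (s : ℂ) : MeromorphicAt (zetaTerm M2 n j) s := by
  refine ((differentiable_binomCoeff_neg j).analyticAt s).meromorphicAt.mul ?_
  refine MeromorphicAt.fun_sum fun i _ => (MeromorphicAt.const _ _).mul ?_
  exact (meromorphicAt_tailZeta n _).comp_analyticAt (f := tailZeta n)
    (g := fun s : ℂ => 2 * s + j + i - 1) (by fun_prop)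

lemma meromorphic_zetaCont {M2 : ℝ} {n : ℕ} (hn : |M2| ≤ n) (hn4 : 4 ≤ n) :
    Meromorphic (zetaCont M2 n) := by
  intro s
  set N := ⌈2 - 2 * s.re⌉₊ + 1 with hN
  have hs : 2 - (N : ℝ) < 2 * s.re := by
    have := Nat.le_ceil (2 - 2 * s.re)
    rw [hN]; push_cast; linarith
  have h1 : MeromorphicAt (zetaStep M2 n N) s :=
    (MeromorphicAt.fun_sum fun j _ => meromorphicAt_zetaTerm M2 n j s).add
      (zetaRemSum_analytic_and_deriv hn hn4 hs).1.meromorphicAt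
  refine h1.congr (Filter.Eventually.filter_mono nhdsWithin_le_nhds ?_)
  have ho : IsOpen {z : ℂ | 2 - (N : ℝ) < 2 * z.re} :=
    isOpen_lt continuous_const (continuous_const.mul continuous_re)
  filter_upwards [ho.mem_nhds hs] with z hz
  exact (zetaCont_eq hn hn4 hz).symm

lemma hasSum_zetaCont {M2 : ℝ} {n : ℕ} (hn : |M2| ≤ n) (hn4 : 4 ≤ n) {s : ℂ} (hs : 1 < s.re) :
    HasSum (fun k => ((hemiEigenvalue (triangular n + k) + M2 : ℝ) : ℂ) ^ (-s))
      (zetaCont M2 n s) := by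
  have hlM : ∀ m, |M2| ≤ ((n + m + 1 : ℕ) : ℝ) := fun m =>
    hn.trans (by exact_mod_cast (by lia : n ≤ n + m + 1))
  have hs' : 2 - ((0 : ℕ) : ℝ) < 2 * s.re := by simp; linarith
  have hsum := summable_zetaRem hn hn4 hs'
  refine hasSum_eigenDegree (F := fun l => (((l : ℝ) * (l + 1) + M2 : ℝ) : ℂ) ^ (-s)) n ?_ ?_
  · have h := hsum.of_norm.hasSum
    rw [zetaCont_eq hn hn4 hs', zetaStep, Finset.sum_range_zero, zero_add, zetaRemSum]
    refine hasSum_of_eq h fun m => ?_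
    exact (zetaRem_zero (hlM m) (by lia) s).symm
  · refine hsum.congr fun m => ?_
    rw [zetaRem_zero (hlM m) (by lia) s, norm_mul, Complex.norm_natCast]

/-! ### The zeta function near the origin -/

/-- The function `s ↦ s · tailZeta n (2 s + 1)`, with its removable singularity at `0` removed. -/
noncomputable def mulTailZeta (n : ℕ) (s : ℂ) : ℂ :=
  riemannZeta₁ (2 * s + 1) / 2 - s * ∑ k ∈ Finset.range n, 1 / ((k : ℂ) + 1) ^ (2 * s + 1)

lemma mulTailZeta_eq (n : ℕ) {s : ℂ} (hs : s ≠ 0) :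
    mulTailZeta n s = s * tailZeta n (2 * s + 1) := by
  have h : 2 * s + 1 ≠ 1 := by simpa using hs
  rw [mulTailZeta, tailZeta, riemannZeta_eq_inv_sub_mul h]
  field_simp
  ring

lemma mulTailZeta_zero (n : ℕ) : mulTailZeta n 0 = 1 / 2 := by simp [mulTailZeta]

lemma differentiable_sum_one_div_cpow (n : ℕ) :
    Differentiable ℂ fun s : ℂ => ∑ k ∈ Finset.range n, 1 / ((k : ℂ) + 1) ^ (2 * s + 1) := by
  refine Differentiable.fun_sum fun k _ => ?_
  have hk : ((k : ℂ) + 1) ≠ 0 := by exact_mod_cast k.succ_ne_zero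
  exact (differentiable_const _).div (((differentiable_id.const_mul 2).add_const 1).const_cpow
    (Or.inl hk)) (by simp [cpow_eq_zero_iff, hk])

lemma differentiable_mulTailZeta (n : ℕ) : Differentiable ℂ (mulTailZeta n) := by
  refine Differentiable.sub ?_ (differentiable_id.mul (differentiable_sum_one_div_cpow n))
  exact (differentiable_riemannZeta₁.comp ((differentiable_id.const_mul 2).add_const 1)).div_const 2

lemma hasDerivAt_mulTailZeta (n : ℕ) : HasDerivAt (mulTailZeta n)
    (Real.eulerMascheroniConstant - ∑ k ∈ Finset.range n, 1 / ((k : ℂ) + 1)) 0 := by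
  have h1 : HasDerivAt riemannZeta₁ (Real.eulerMascheroniConstant : ℂ) (2 * 0 + 1) := by
    rw [mul_zero, zero_add, ← deriv_riemannZeta₁_one]
    exact (differentiable_riemannZeta₁ 1).hasDerivAt
  have h2 : HasDerivAt (fun s : ℂ => 2 * s + 1) 2 0 := by
    simpa using ((hasDerivAt_id (0 : ℂ)).const_mul 2).add_const 1
  have h3 := (hasDerivAt_id (0 : ℂ)).mul (differentiable_sum_one_div_cpow n 0).hasDerivAt
  have h4 := ((h1.comp (0 : ℂ) h2).div_const 2).sub h3
  refine h4.congr_deriv ?_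
  simp

/-- The continuation near `s = 0`, with the removable singularities removed. -/
noncomputable def zetaNearZero (M2 : ℝ) (n : ℕ) (s : ℂ) : ℂ :=
  tailZeta n (2 * s - 1) - s * tailZeta n (2 * s) - M2 * mulTailZeta n s +
    (s + 1) / 2 * (mulTailZeta n s + s * (2 * M2 * tailZeta n (2 * s + 2) +
      (M2 : ℂ) ^ 2 * tailZeta n (2 * s + 3))) + zetaRemSum M2 n 3 s

/-- The terms with `tailZeta n (2 s + 1)` are the only ones singular at `0`; their coefficients are
divisible by `s`. -/
lemma zetaStep_three_eq (M2 : ℝ) (n : ℕ) {s : ℂ} (hs : s ≠ 0) :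
    zetaStep M2 n 3 s = zetaNearZero M2 n s := by
  have e : ∀ j i : ℕ, ∀ c : ℂ, (j : ℂ) + i - 1 = c → tailZeta n (2 * s + j + i - 1) =
      tailZeta n (2 * s + c) := by
    intro j i c h; rw [← h]; congr 1; ring
  simp only [zetaStep, zetaNearZero, Finset.sum_range_succ, Finset.sum_range_zero, zetaTerm,
    binomCoeff_zero, binomCoeff_one, binomCoeff_two, mulTailZeta_eq n hs]
  rw [e 0 0 (-1) (by norm_num), e 1 0 0 (by norm_num), e 1 1 1 (by norm_num),
    e 2 0 1 (by norm_num), e 2 1 2 (by norm_num), e 2 2 3 (by norm_num), ← sub_eq_add_neg, add_zero]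
  norm_num
  ring

lemma analyticAt_zetaNearZero {M2 : ℝ} {n : ℕ} (hn : |M2| ≤ n) (hn4 : 4 ≤ n) :
    AnalyticAt ℂ (zetaNearZero M2 n) 0 := by
  have hev : ∀ c : ℂ, c ≠ 1 → AnalyticAt ℂ (fun s : ℂ => tailZeta n (2 * s + c)) 0 := by
    intro c hc
    have h1 : AnalyticAt ℂ (tailZeta n) (2 * 0 + c) := by
      rw [mul_zero, zero_add, analyticAt_iff_eventually_differentiableAt]
      filter_upwards [compl_singleton_mem_nhds hc] with z hz using differentiableAt_tailZeta n hz
    exact h1.comp (g := tailZeta n) (f := fun s : ℂ => 2 * s + c) (by fun_prop)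
  have hg : AnalyticAt ℂ (mulTailZeta n) 0 := (differentiable_mulTailZeta n).analyticAt 0
  have h1 := hev (-1) (by norm_num)
  have h2 := hev 0 (by norm_num)
  simp only [add_zero, ← sub_eq_add_neg] at h1 h2
  have hR := (zetaRemSum_analytic_and_deriv hn hn4 (N := 3) (s := 0) (by norm_num)).1
  exact (((h1.sub (analyticAt_id.mul h2)).sub (analyticAt_const.mul hg)).add
    (((analyticAt_id.add analyticAt_const).div_const).mul (hg.add (analyticAt_id.mul
    ((analyticAt_const.mul (hev 2 (by norm_num))).add
      (analyticAt_const.mul (hev 3 (by norm_num)))))))).add hR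

/-- The derivative at `0` of the continued zeta function. The constants come from `ζ(0) = -1/2` and
from the Laurent expansion `ζ(1 + u) = 1/u + γ + ⋯`. -/
lemma hasDerivAt_zetaNearZero {M2 : ℝ} {n : ℕ} (hn : |M2| ≤ n) (hn4 : 4 ≤ n) :
    HasDerivAt (zetaNearZero M2 n)
      (2 * (deriv riemannZeta (-1) + ∑ k ∈ Finset.range n, ((k : ℂ) + 1) * Complex.log ((k : ℂ) + 1))
        + (1 / 2 + n) + (1 / 2 - M2) * (Real.eulerMascheroniConstant -
          ∑ k ∈ Finset.range n, 1 / ((k : ℂ) + 1)) + 1 / 4 + M2 * tailZeta n 2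
        + (M2 : ℂ) ^ 2 / 2 * tailZeta n 3 + deriv (zetaRemSum M2 n 3) 0) 0 := by
  have hlin : ∀ c : ℂ, HasDerivAt (fun s : ℂ => 2 * s + c) 2 0 := fun c => by
    simpa using ((hasDerivAt_id (0 : ℂ)).const_mul 2).add_const c
  have hev : ∀ c : ℂ, c ≠ 1 → HasDerivAt (fun s : ℂ => tailZeta n (2 * s + c))
      (deriv (tailZeta n) c * 2) 0 := by
    intro c hc
    have h1 : HasDerivAt (tailZeta n) (deriv (tailZeta n) c) (2 * 0 + c) := by
      rw [mul_zero, zero_add]; exact (differentiableAt_tailZeta n hc).hasDerivAt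
    exact h1.comp (0 : ℂ) (hlin c)
  have hg := hasDerivAt_mulTailZeta n
  have h1 := hev (-1) (by norm_num)
  have h2 := hev 0 (by norm_num)
  simp only [add_zero, ← sub_eq_add_neg] at h1 h2
  have hR := (zetaRemSum_analytic_and_deriv hn hn4 (N := 3) (s := 0)
    (by norm_num)).1.differentiableAt.hasDerivAt
  have hid := hasDerivAt_id' (0 : ℂ)
  have h := (((h1.fun_sub (hid.fun_mul h2)).fun_sub (hg.const_mul (M2 : ℂ))).fun_add
    (((hid.add_const 1).div_const 2).fun_mul (hg.fun_add (hid.fun_mul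
    (((hev 2 (by norm_num)).const_mul (2 * (M2 : ℂ))).fun_add
      ((hev 3 (by norm_num)).const_mul ((M2 : ℂ) ^ 2))))))).fun_add hR
  refine h.congr_deriv ?_
  have hz : tailZeta n 0 = -1 / 2 - n := by simp [tailZeta, riemannZeta_zero]
  have hd : deriv (tailZeta n) (-1) = deriv riemannZeta (-1) +
      ∑ k ∈ Finset.range n, ((k : ℂ) + 1) * Complex.log ((k : ℂ) + 1) := by
    rw [(hasDerivAt_tailZeta n (s := -1) (by norm_num)).deriv]
    congr 1
    refine Finset.sum_congr rfl fun k _ => ?_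
    rw [cpow_neg_one, div_inv_eq_mul, mul_comm]
  simp only [mul_zero, zero_add, mulTailZeta_zero, hd, hz]
  ring

lemma hasDerivAt_zetaRem_three_zero {M2 : ℝ} {l : ℕ} (hl : |M2| ≤ l) (hl4 : 4 ≤ l) :
    HasDerivAt (zetaRem M2 3 l) ((l * (-Real.log (1 + relShift M2 l) + relShift M2 l -
      relShift M2 l ^ 2 / 2) : ℝ) : ℂ) 0 := by
  have hl0 : (l : ℂ) ≠ 0 := by exact_mod_cast (by lia : l ≠ 0)
  have hx0 : 0 < 1 + relShift M2 l := by
    have := (abs_le.1 (abs_relShift_le hl hl4).2).1; linarith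
  have hx : ((1 + relShift M2 l : ℝ) : ℂ) ≠ 0 := ofReal_ne_zero.2 hx0.ne'
  set x := relShift M2 l with hxdef
  have hid := hasDerivAt_id' (0 : ℂ)
  have h1 : HasDerivAt (fun s : ℂ => (l : ℂ) ^ (1 - 2 * s)) _ 0 :=
    ((hid.const_mul 2).const_sub 1).const_cpow (Or.inl hl0)
  have h2 : HasDerivAt (fun s : ℂ => ((1 + x : ℝ) : ℂ) ^ (-s)) _ 0 :=
    hid.fun_neg.const_cpow (Or.inl hx)
  have h3 : HasDerivAt (fun s : ℂ => 1 + (-s) * x + (-s) * (-s - 1) / 2 * (x : ℂ) ^ 2) _ 0 :=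
    ((hid.fun_neg.mul_const (x : ℂ)).const_add 1).fun_add
      (((hid.fun_neg.fun_mul (hid.fun_neg.sub_const 1)).div_const 2).mul_const ((x : ℂ) ^ 2))
  have h := h1.fun_mul (h2.fun_sub h3)
  have hfun : zetaRem M2 3 l = fun s => (l : ℂ) ^ (1 - 2 * s) * (((1 + x : ℝ) : ℂ) ^ (-s) -
      (1 + (-s) * x + (-s) * (-s - 1) / 2 * (x : ℂ) ^ 2)) := by
    ext s
    simp only [zetaRem, binomRem, Finset.sum_range_succ, Finset.sum_range_zero, binomCoeff_zero,
      binomCoeff_one, binomCoeff_two, ← hxdef]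
    simp
  rw [hfun]
  refine h.congr_deriv ?_
  simp only [mul_zero, sub_zero, neg_zero, cpow_zero, cpow_one, ← ofReal_log hx0.le]
  push_cast
  ring

/-- `ζ'(-1)` is real, because `ζ` commutes with complex conjugation. -/
lemma deriv_riemannZeta_neg_one_real :
    deriv riemannZeta (-1) = ((deriv riemannZeta (-1)).re : ℂ) := by
  have h1 := (differentiableAt_riemannZeta (s := -1) (by norm_num)).hasDerivAt
  have h2 := h1.conj_conj
  have e : (conj ∘ riemannZeta ∘ conj : ℂ → ℂ) = riemannZeta := by
    ext s; simp
  rw [e] at h2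
  have h3 := h2.deriv
  simp only [map_neg, map_one] at h3
  exact (conj_eq_iff_re.1 h3.symm).symm

/-- The zeta function of the eigenvalues of degree greater than `n` has the required continuation,
and the derivative of the latter at `0` is given by a convergent series. -/
lemma exists_isZetaFunction {M2 : ℝ} {n : ℕ} (hn : |M2| ≤ n) (hn4 : 4 ≤ n) :
    ∃ Z : ℂ → ℂ, IsZetaFunction hemiEigenvalue M2 (triangular n) Z ∧ ∃ S : ℝ,
      HasSum (fun m : ℕ => ((n + m + 1 : ℕ) : ℝ) * Real.log (1 + relShift M2 (n + m + 1)) - 1 +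
        (1 / 2 - M2) / ((n + m + 1 : ℕ) : ℝ)) S ∧
      -deriv Z 0 = ((-2 * (deriv riemannZeta (-1)).re -
        2 * (∑ k ∈ Finset.range n, ((k : ℝ) + 1) * Real.log ((k : ℝ) + 1)) - 3 / 4 - n +
        (M2 - 1 / 2) * (Real.eulerMascheroniConstant - ∑ k ∈ Finset.range n, 1 / ((k : ℝ) + 1)) + S
        : ℝ) : ℂ) := by
  have hlM : ∀ m, |M2| ≤ ((n + m + 1 : ℕ) : ℝ) := fun m =>
    hn.trans (by exact_mod_cast (by lia : n ≤ n + m + 1))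
  have hev : Function.update (zetaCont M2 n) 0 (zetaNearZero M2 n 0) =ᶠ[𝓝 0] zetaNearZero M2 n := by
    have ho : IsOpen {z : ℂ | 2 - ((3 : ℕ) : ℝ) < 2 * z.re} :=
      isOpen_lt continuous_const (continuous_const.mul continuous_re)
    filter_upwards [ho.mem_nhds (show 2 - ((3 : ℕ) : ℝ) < 2 * (0 : ℂ).re by norm_num)] with s hs
    by_cases h0 : s = 0
    · subst h0; simp
    · rw [Function.update_of_ne h0, zetaCont_eq hn hn4 hs, zetaStep_three_eq M2 n h0]
  have han := analyticAt_zetaNearZero hn hn4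
  -- `zetaCont` takes a junk value at the removable singularity `0`, which has to be corrected.
  refine ⟨Function.update (zetaCont M2 n) 0 (zetaNearZero M2 n 0),
    ⟨fun p hp => ?_, fun s hs => ?_, fun s => ?_, han.congr hev.symm⟩, ?_⟩
  · obtain ⟨k, rfl⟩ := Nat.exists_eq_add_of_le hp
    have h1 := eigenDegree_triangular_add n k
    have hl : |M2| ≤ eigenDegree (triangular n + k) :=
      hn.trans (by exact_mod_cast (by lia : n ≤ eigenDegree (triangular n + k)))
    have hx : 0 < 1 + relShift M2 (eigenDegree (triangular n + k)) := by
      have := (abs_le.1 (abs_relShift_le hl (by lia)).2).1; linarith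
    have h0 : (0 : ℝ) < eigenDegree (triangular n + k) := by
      exact_mod_cast (by lia : 0 < eigenDegree (triangular n + k))
    rw [hemiEigenvalue, mul_succ_add_eq (by lia)]
    positivity
  · have h0 : s ≠ 0 := by rintro rfl; norm_num at hs
    rw [Function.update_of_ne h0]
    exact hasSum_zetaCont hn hn4 hs
  · refine (meromorphic_zetaCont hn hn4 s).congr ?_
    by_cases h0 : s = 0
    · subst h0
      filter_upwards [self_mem_nhdsWithin] with z hz
      rw [Function.update_of_ne hz]
    · refine Filter.Eventually.filter_mono nhdsWithin_le_nhds ?_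
      filter_upwards [compl_singleton_mem_nhds h0] with z hz
      rw [Function.update_of_ne hz]
  · rw [hev.deriv_eq, (hasDerivAt_zetaNearZero hn hn4).deriv]
    have hR := (zetaRemSum_analytic_and_deriv hn hn4 (N := 3) (s := 0) (by norm_num)).2
    have h2 := (hasSum_tailZeta n (s := 2) (by norm_num)).mul_left (M2 : ℂ)
    have h3 := (hasSum_tailZeta n (s := 3) (by norm_num)).mul_left ((M2 : ℂ) ^ 2 / 2)
    have hS := hasSum_of_eq (f := fun m : ℕ => ((((n + m + 1 : ℕ) : ℝ) *
        Real.log (1 + relShift M2 (n + m + 1)) - 1 +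
        (1 / 2 - M2) / ((n + m + 1 : ℕ) : ℝ) : ℝ) : ℂ)) ((hR.add h2).add h3).neg ?_
    · have hre := hasSum_re hS
      simp only [ofReal_re] at hre
      refine ⟨_, hre, ?_⟩
      have hSeq := hS.unique (hasSum_ofReal.2 hre)
      simp only [ofReal_add, ofReal_sub, ofReal_mul, ofReal_neg] at hSeq ⊢
      rw [← hSeq, ← deriv_riemannZeta_neg_one_real]
      have hlog : ∀ k : ℕ, Complex.log ((k : ℂ) + 1) = ((Real.log ((k : ℝ) + 1) : ℝ) : ℂ) := by
        intro k
        rw [ofReal_log (by positivity)]; push_cast; rfl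
      simp only [hlog]
      push_cast
      ring
    · intro m
      have hl0 : ((n + m + 1 : ℕ) : ℂ) ≠ 0 := by
        exact_mod_cast Nat.succ_ne_zero (n + m)
      rw [(hasDerivAt_zetaRem_three_zero (hlM m) (by lia)).deriv]
      generalize n + m + 1 = l at *
      have e2 : (l : ℂ) ^ (2 : ℂ) = (l : ℂ) ^ 2 := by exact_mod_cast cpow_natCast (l : ℂ) 2
      have e3 : (l : ℂ) ^ (3 : ℂ) = (l : ℂ) ^ 3 := by exact_mod_cast cpow_natCast (l : ℂ) 3
      have ex : (relShift M2 l : ℂ) = ((l : ℂ) + M2) / (l : ℂ) ^ 2 := by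
        rw [relShift]; push_cast; rfl
      rw [e2, e3]
      push_cast
      rw [ex]
      field_simp
      ring

/-! ### The Barnes function and its functional equation -/

/-- The `k`-th factor of the Weierstrass product of `G (1 + z)`. -/
noncomputable def barnesFactor (z : ℂ) (k : ℕ) : ℂ :=
  (1 + z / (k + 1)) ^ (k + 1) * Complex.exp (z ^ 2 / (2 * (k + 1)) - z)

lemma norm_barnesFactor_sub_one_le {z : ℂ} {k : ℕ} (h2 : 2 * ‖z‖ ≤ k + 1)
    (h3 : ‖z‖ ^ 3 ≤ k + 1) : ‖barnesFactor z k - 1‖ ≤ 2 * ‖z‖ ^ 3 * (1 / (k + 1 : ℝ) ^ 2) := by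
  set m : ℝ := k + 1 with hm
  have hm1 : 1 ≤ m := by rw [hm]; linarith [Nat.cast_nonneg (α := ℝ) k]
  have hmc : ((k : ℂ) + 1) = (m : ℂ) := by rw [hm]; push_cast; rfl
  have hm0 : (m : ℂ) ≠ 0 := ofReal_ne_zero.2 (by linarith)
  set w : ℂ := z / m with hw
  have hwn : ‖w‖ = ‖z‖ / m := by rw [hw, norm_div, norm_real, Real.norm_of_nonneg (by linarith)]
  have hw2 : ‖w‖ ≤ 1 / 2 := by
    rw [hwn, div_le_div_iff₀ (by linarith) (by norm_num)]; linarith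
  have hw1 : 1 + w ≠ 0 := by
    intro h
    have : w = -1 := by linear_combination h
    rw [this] at hw2; norm_num at hw2
  have hlog := norm_log_sub_logTaylor_le 2 (z := w) (by linarith)
  have hT : logTaylor 3 w = w - w ^ 2 / 2 := by
    simp [logTaylor, Finset.sum_range_succ]; ring
  set e : ℂ := m * (Complex.log (1 + w) - logTaylor 3 w) with he
  have hp : barnesFactor z k = Complex.exp e := by
    rw [barnesFactor, hmc, ← hw]
    nth_rewrite 1 [← exp_log hw1]
    rw [← exp_nat_mul, ← exp_add, he, hT]
    congr 1
    have hz : z = w * m := by rw [hw]; field_simp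
    rw [hz]
    push_cast
    rw [hmc]
    field_simp
    ring
  have hen : ‖e‖ ≤ ‖z‖ ^ 3 * (1 / m ^ 2) := by
    rw [he, norm_mul, norm_real, Real.norm_of_nonneg (by linarith)]
    have h5 : (1 - ‖w‖)⁻¹ ≤ 2 := by
      rw [inv_le_comm₀ (by linarith) (by norm_num)]; linarith
    have h6 : ‖Complex.log (1 + w) - logTaylor 3 w‖ ≤ ‖w‖ ^ 3 := by
      refine hlog.trans ?_
      norm_num
      have : 0 ≤ ‖w‖ ^ 3 := by positivity
      nlinarith
    calc _ ≤ m * ‖w‖ ^ 3 := by gcongr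
      _ = ‖z‖ ^ 3 * (1 / m ^ 2) := by rw [hwn]; field_simp
  have he1 : ‖e‖ ≤ 1 := by
    refine hen.trans ?_
    rw [mul_one_div, div_le_one (by positivity)]
    nlinarith
  rw [hp]
  refine (norm_exp_sub_one_le he1).trans ?_
  linarith

lemma multipliable_barnesFactor (z : ℂ) : Multipliable (barnesFactor z) := by
  have hs : Summable fun k => barnesFactor z k - 1 := by
    refine Summable.of_norm_bounded_eventually_nat
      (g := fun k : ℕ => 2 * ‖z‖ ^ 3 * (1 / (k + 1 : ℝ) ^ 2)) ?_ ?_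
    · refine Summable.mul_left _ ?_
      have := (summable_nat_add_iff (f := fun k : ℕ => 1 / (k : ℝ) ^ 2) 1).2
        (Real.summable_one_div_nat_pow.2 (by norm_num))
      simpa using this
    · filter_upwards [eventually_ge_atTop ⌈max (2 * ‖z‖) (‖z‖ ^ 3)⌉₊] with k hk
      have h := Nat.le_of_ceil_le hk
      exact norm_barnesFactor_sub_one_le (by linarith [le_max_left (2 * ‖z‖) (‖z‖ ^ 3)])
        (by linarith [le_max_right (2 * ‖z‖) (‖z‖ ^ 3)])
  have := Complex.multipliable_one_add_of_summable hs
  simpa using this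

/-- The exponential prefactor of the Weierstrass product of `G (1 + z)`. -/
noncomputable def barnesPrefactor (z : ℂ) : ℂ :=
  (2 * Real.pi : ℂ) ^ (z / 2) *
    Complex.exp (-(z + (1 + Real.eulerMascheroniConstant) * z ^ 2) / 2)

lemma tendsto_barnesG (z : ℂ) :
    Tendsto (fun N => barnesPrefactor z * ∏ k ∈ Finset.range N, barnesFactor z k) atTop
      (𝓝 (barnesG (1 + z))) := by
  have h := (multipliable_barnesFactor z).hasProd.tendsto_prod_nat.const_mul (barnesPrefactor z)
  have e : barnesG (1 + z) = barnesPrefactor z * ∏' k, barnesFactor z k := by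
    simp only [barnesG, barnesPrefactor, barnesFactor, add_sub_cancel_left]
  rwa [e]

/-- The quotient of the partial products at `z` and `z - 1` telescopes to the denominators of the Gauss
limit for `Γ(z)`, up to elementary factors. -/
lemma prod_barnesFactor_succ {z : ℂ} (hz : ∀ k : ℕ, z ≠ -k) (N : ℕ) :
    ∏ k ∈ Finset.range N, barnesFactor z k =
      (∏ k ∈ Finset.range N, barnesFactor (z - 1) k) * ((z + N) ^ N /
        (∏ j ∈ Finset.range N, (z + j)) * Complex.exp ((z - 1 / 2) * (harmonic N : ℝ) - N)) := by
  have hne : ∀ k : ℕ, z + k ≠ 0 := fun k h => hz k (by linear_combination h)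
  induction N with
  | zero => simp
  | succ N ih =>
    have hN : ((N : ℂ) + 1) ≠ 0 := by exact_mod_cast N.succ_ne_zero
    have hp : ∏ j ∈ Finset.range N, (z + j) ≠ 0 := Finset.prod_ne_zero_iff.2 fun j _ => hne j
    have hstep : barnesFactor z N * ((z + N) ^ N * Complex.exp ((z - 1 / 2) * (harmonic N : ℝ) - N)
        * (z + N)) = barnesFactor (z - 1) N * ((z + (N + 1 : ℕ)) ^ (N + 1) *
        Complex.exp ((z - 1 / 2) * (harmonic (N + 1) : ℝ) - (N + 1 : ℕ))) := by
      have e1 : z ^ 2 / (2 * ((N : ℂ) + 1)) - z + ((z - 1 / 2) * (harmonic N : ℝ) - N) =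
          (z - 1) ^ 2 / (2 * ((N : ℂ) + 1)) - (z - 1) +
            ((z - 1 / 2) * (harmonic (N + 1) : ℝ) - (N + 1 : ℕ)) := by
        rw [harmonic_succ]; push_cast; field_simp; ring
      have e2 : 1 + z / ((N : ℂ) + 1) = (z + (N + 1 : ℕ)) / (N + 1) := by
        push_cast; field_simp; ring
      have e3 : 1 + (z - 1) / ((N : ℂ) + 1) = (z + N) / (N + 1) := by field_simp; ring
      have e4 := congrArg Complex.exp e1
      rw [Complex.exp_add, Complex.exp_add] at e4
      rw [barnesFactor, barnesFactor, e2, e3, div_pow, div_pow]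
      linear_combination ((z + (N + 1 : ℕ)) ^ (N + 1) / ((N : ℂ) + 1) ^ (N + 1) *
        (z + N) ^ (N + 1)) * e4
    rw [Finset.prod_range_succ, ih, Finset.prod_range_succ _ N, Finset.prod_range_succ _ N]
    have hzN := hne N
    generalize Complex.exp ((z - 1 / 2) * (harmonic N : ℝ) - N) = E₁ at hstep ⊢
    generalize Complex.exp ((z - 1 / 2) * (harmonic (N + 1) : ℝ) - (N + 1 : ℕ)) = E₂ at hstep ⊢
    field_simp
    linear_combination (∏ k ∈ Finset.range N, barnesFactor (z - 1) k) * hstep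

/-- The functional equation of the Barnes `G`-function, from the partial products, the Gauss limit
for `Γ`, Stirling's formula and the definition of Euler's constant. -/
lemma barnesG_add_one {z : ℂ} (hz : ∀ k : ℕ, z ≠ -k) :
    barnesG (1 + z) = Complex.Gamma z * barnesG z := by
  have hne : ∀ k : ℕ, z + k ≠ 0 := fun k h => hz k (by linear_combination h)
  have hG := tendsto_barnesG (z - 1)
  rw [add_sub_cancel] at hG
  set Q : ℕ → ℂ := fun N => Complex.exp (-1 / 2 - (1 + Real.eulerMascheroniConstant) * (z - 1 / 2)) *
    (Real.sqrt Real.pi : ℂ) *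
    (Complex.GammaSeq z N * ((1 + z / N) ^ N * (1 + z / N)) *
      Complex.exp ((z - 1 / 2) * ((harmonic N - Real.log N : ℝ) : ℂ))) /
      ((Stirling.stirlingSeq N : ℝ) : ℂ) with hQ
  have hsp : (Real.sqrt Real.pi : ℂ) ≠ 0 := ofReal_ne_zero.2 (Real.sqrt_pos.2 Real.pi_pos).ne'
  have hQlim : Tendsto Q atTop (𝓝 (Complex.Gamma z)) := by
    have h1 := Complex.GammaSeq_tendsto_Gamma z
    have h2 := Complex.tendsto_one_add_div_pow_exp z
    have h3 : Tendsto (fun N : ℕ => 1 + z / N) atTop (𝓝 (1 + 0)) :=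
      (tendsto_const_div_atTop_nhds_zero_nat z).const_add 1
    have h4 := (continuous_ofReal.tendsto _).comp Real.tendsto_harmonic_sub_log
    have h5 := (Complex.continuous_exp.tendsto _).comp (h4.const_mul (z - 1 / 2))
    have h6 := (continuous_ofReal.tendsto _).comp Stirling.tendsto_stirlingSeq_sqrt_pi
    have h7 := (((h1.mul (h2.mul h3)).mul h5).const_mul
      (Complex.exp (-1 / 2 - (1 + Real.eulerMascheroniConstant) * (z - 1 / 2)) *
        (Real.sqrt Real.pi : ℂ))).div h6 hsp
    convert! h7 using 2
    have e : Complex.exp (-1 / 2 - (1 + Real.eulerMascheroniConstant) * (z - 1 / 2)) *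
        Complex.exp z * Complex.exp ((z - 1 / 2) * Real.eulerMascheroniConstant) = 1 := by
      rw [← Complex.exp_add, ← Complex.exp_add, exp_eq_one_iff]
      exact ⟨0, by push_cast; ring⟩
    rw [eq_div_iff hsp]
    linear_combination (-(Real.sqrt Real.pi : ℂ) * Complex.Gamma z) * e
  have hrel : ∀ᶠ N : ℕ in atTop, barnesPrefactor z * ∏ k ∈ Finset.range N, barnesFactor z k =
      Q N * (barnesPrefactor (z - 1) * ∏ k ∈ Finset.range N, barnesFactor (z - 1) k) := by
    filter_upwards [eventually_ge_atTop 1] with N hN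
    have hN0 : (N : ℂ) ≠ 0 := by exact_mod_cast (by lia : N ≠ 0)
    have hNr : (0 : ℝ) < N := by exact_mod_cast hN
    have hp : ∏ j ∈ Finset.range N, (z + j) ≠ 0 := Finset.prod_ne_zero_iff.2 fun j _ => hne j
    have hpre : barnesPrefactor z = barnesPrefactor (z - 1) * ((Real.sqrt (2 * Real.pi) : ℂ) *
        Complex.exp (-1 / 2 - (1 + Real.eulerMascheroniConstant) * (z - 1 / 2))) := by
      have h2pi : (2 * Real.pi : ℂ) ≠ 0 := by simp [Real.pi_ne_zero]
      have hsq : (Real.sqrt (2 * Real.pi) : ℂ) = (2 * Real.pi : ℂ) ^ (1 / 2 : ℂ) := by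
        rw [Real.sqrt_eq_rpow, ofReal_cpow (by positivity)]; push_cast; rfl
      rw [barnesPrefactor, barnesPrefactor, hsq, mul_mul_mul_comm, ← cpow_add _ _ h2pi,
        ← Complex.exp_add]
      congr 2 <;> ring
    have hst : ((N.factorial : ℕ) : ℂ) = ((Stirling.stirlingSeq N : ℝ) : ℂ) *
        (Real.sqrt (2 * N) * (N : ℂ) ^ N * Complex.exp (-N)) := by
      have h0 : Stirling.stirlingSeq N * (Real.sqrt (2 * N) * (N : ℝ) ^ N * Real.exp (-N)) =
          N.factorial := by
        rw [Stirling.stirlingSeq, div_pow, ← Real.exp_nat_mul, Real.exp_neg]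
        have : 0 < Real.sqrt (2 * N) := by positivity
        field_simp
      have h1 := congrArg ofReal h0.symm
      push_cast at h1
      exact h1
    have hs0 : ((Stirling.stirlingSeq N : ℝ) : ℂ) ≠ 0 := by
      rw [ofReal_ne_zero]
      obtain ⟨k, rfl⟩ := Nat.exists_eq_add_of_le' hN
      exact (Stirling.stirlingSeq'_pos k).ne'
    have hgs : Complex.GammaSeq z N = (N : ℂ) ^ z * N.factorial /
        ((∏ j ∈ Finset.range N, (z + j)) * (z + N)) := by
      rw [Complex.GammaSeq, Finset.prod_range_succ]
    have hexp : Complex.exp ((z - 1 / 2) * ((harmonic N - Real.log N : ℝ) : ℂ)) * (N : ℂ) ^ z =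
        Complex.exp ((z - 1 / 2) * (harmonic N : ℝ)) * (Real.sqrt N : ℂ) := by
      have h1 : (Real.sqrt N : ℂ) = Complex.exp (Complex.log N * (1 / 2)) := by
        rw [Real.sqrt_eq_rpow, ofReal_cpow hNr.le, cpow_def_of_ne_zero (by simpa using hN0)]
        push_cast; rfl
      rw [h1, cpow_def_of_ne_zero hN0, ← Complex.exp_add, ← Complex.exp_add]
      congr 1
      push_cast
      ring
    have hsqrt : (Real.sqrt (2 * Real.pi) : ℂ) * Real.sqrt N =
        Real.sqrt Real.pi * Real.sqrt (2 * N) := by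
      rw [← ofReal_mul, ← ofReal_mul, ← Real.sqrt_mul (by positivity), ← Real.sqrt_mul (by positivity)]
      congr 2; ring
    have hz1 : 1 + z / N = (z + N) / N := by field_simp; ring
    rw [prod_barnesFactor_succ hz N, hpre, hQ]
    simp only
    have hexpN : Complex.exp ((z - 1 / 2) * (harmonic N : ℝ) - N) =
        Complex.exp ((z - 1 / 2) * (harmonic N : ℝ)) * Complex.exp (-N) := by
      rw [sub_eq_add_neg, Complex.exp_add]
    have hsN : (Real.sqrt N : ℂ) * Real.sqrt N = N := by
      rw [← ofReal_mul, Real.mul_self_sqrt hNr.le, ofReal_natCast]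
    rw [hgs, hst, hz1, div_pow, hexpN]
    have hzN := hne N
    generalize Complex.exp ((z - 1 / 2) * ((harmonic N - Real.log N : ℝ) : ℂ)) = X at hexp ⊢
    generalize Complex.exp ((z - 1 / 2) * (harmonic N : ℝ)) = H at hexp ⊢
    generalize Complex.exp (-1 / 2 - (1 + Real.eulerMascheroniConstant) * (z - 1 / 2)) = E
    generalize Complex.exp (-N) = e
    have key : (Real.sqrt Real.pi : ℂ) * Real.sqrt (2 * N) * (X * (N : ℂ) ^ z) =
        Real.sqrt (2 * Real.pi) * H * N := by
      rw [hexp, ← hsqrt]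
      linear_combination (Real.sqrt (2 * Real.pi) * H : ℂ) * hsN
    generalize (Real.sqrt Real.pi : ℂ) = a at *
    generalize (Real.sqrt (2 * N) : ℂ) = b at *
    generalize (Real.sqrt (2 * Real.pi) : ℂ) = c at *
    generalize (N : ℂ) ^ z = d at *
    field_simp
    linear_combination (-(barnesPrefactor (z - 1) * E * e *
      ∏ x ∈ Finset.range N, barnesFactor (z - 1) x)) * key
  exact tendsto_nhds_unique ((tendsto_barnesG z).congr' hrel) (hQlim.mul hG)

lemma barnesG_one : barnesG 1 = 1 := by
  simp [barnesG]

lemma barnesG_two : barnesG 2 = 1 := by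
  have h := barnesG_add_one (z := 1) fun k h => by
    have := congrArg re h
    simp at this
    linarith [Nat.cast_nonneg (α := ℝ) k]
  rwa [Complex.Gamma_one, barnesG_one, one_mul, one_add_one_eq_two] at h

/-! ### The determinant in closed form -/

/-- The factors of the regularized infinite product of the eigenvalues. -/
noncomputable def hemiFactor (M2 : ℝ) (k : ℕ) : ℝ :=
  (1 + relShift M2 (k + 1)) ^ (k + 1) * Real.exp ((1 / 2 - M2) / ((k + 1 : ℕ) : ℝ) - 1)

/-- If `z + z' = 1` and `z z' = M²`, then `(1 + z / l) (1 + z' / l) = 1 + (l + M²) / l²`, so the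
product of the eigenvalues is a product of two Barnes functions. -/
lemma barnesFactor_mul_barnesFactor {M2 : ℝ} {z z' : ℂ} (h1 : z + z' = 1) (h2 : z * z' = M2) (k : ℕ) :
    barnesFactor z k * barnesFactor z' k = hemiFactor M2 k := by
  have hk : ((k : ℂ) + 1) ≠ 0 := by exact_mod_cast k.succ_ne_zero
  rw [barnesFactor, barnesFactor, mul_mul_mul_comm, ← mul_pow, ← Complex.exp_add, hemiFactor,
    relShift]
  push_cast
  congr 2
  · field_simp
    linear_combination h2 + (k + 1 : ℂ) * h1
  · field_simp
    linear_combination (-2 * (k + 1 : ℂ) + z + z' + 1) * h1 - 2 * h2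

/-- Beyond degree `n` the factors are positive, and their product is the exponential of the series
in the derivative of the zeta function. -/
lemma tendsto_prod_hemiFactor {M2 : ℝ} {n : ℕ} (hn : |M2| ≤ n) (hn4 : 4 ≤ n) {S : ℝ}
    (hS : HasSum (fun m : ℕ => ((n + m + 1 : ℕ) : ℝ) * Real.log (1 + relShift M2 (n + m + 1)) - 1 +
        (1 / 2 - M2) / ((n + m + 1 : ℕ) : ℝ)) S) :
    Tendsto (fun N => ∏ k ∈ Finset.range N, hemiFactor M2 k) atTop
      (𝓝 ((∏ k ∈ Finset.range n, hemiFactor M2 k) * Real.exp S)) := by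
  rw [← tendsto_add_atTop_iff_nat n]
  have h := ((Real.continuous_exp.tendsto S).comp hS.tendsto_sum_nat).const_mul
    (∏ k ∈ Finset.range n, hemiFactor M2 k)
  refine h.congr fun K => ?_
  rw [add_comm K n, Finset.prod_range_add, Function.comp_apply, Real.exp_sum]
  congr 1
  refine Finset.prod_congr rfl fun m _ => ?_
  have hl : |M2| ≤ ((n + m + 1 : ℕ) : ℝ) := hn.trans (by exact_mod_cast (by lia : n ≤ n + m + 1))
  have hx : 0 < 1 + relShift M2 (n + m + 1) := by
    have := (abs_le.1 (abs_relShift_le hl (by lia)).2).1; linarith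
  rw [hemiFactor, sub_add_eq_add_sub, add_sub_assoc, Real.exp_add, Real.exp_nat_mul,
    Real.exp_log hx]

/-- The finitely many eigenvalues that are split off, in terms of the same factors as the infinite
product. -/
lemma prod_eigenvalue_eq (M2 : ℝ) (n : ℕ) :
    ∏ p ∈ Finset.range (triangular n), (hemiEigenvalue p + M2) =
      (∏ k ∈ Finset.range n, hemiFactor M2 k) *
        Real.exp (2 * (∑ k ∈ Finset.range n, ((k : ℝ) + 1) * Real.log ((k : ℝ) + 1)) + n -
          (1 / 2 - M2) * ∑ k ∈ Finset.range n, 1 / ((k : ℝ) + 1)) := by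
  have h := prod_range_triangular (fun l => (l : ℝ) * (l + 1) + M2) n
  simp only [hemiEigenvalue]
  rw [h]
  have e : Real.exp (2 * (∑ k ∈ Finset.range n, ((k : ℝ) + 1) * Real.log ((k : ℝ) + 1)) + n -
      (1 / 2 - M2) * ∑ k ∈ Finset.range n, 1 / ((k : ℝ) + 1)) =
      ∏ k ∈ Finset.range n, (((k : ℝ) + 1) ^ 2) ^ (k + 1) *
        Real.exp (1 - (1 / 2 - M2) / ((k + 1 : ℕ) : ℝ)) := by
    have e1 : ∀ k : ℕ, (((k : ℝ) + 1) ^ 2) ^ (k + 1) *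
        Real.exp (1 - (1 / 2 - M2) / ((k + 1 : ℕ) : ℝ)) =
        Real.exp (2 * (((k : ℝ) + 1) * Real.log ((k : ℝ) + 1)) + 1 -
          (1 / 2 - M2) * (1 / ((k : ℝ) + 1))) := by
      intro k
      have hk : (0 : ℝ) < (k : ℝ) + 1 := by positivity
      have e2 : (((k : ℝ) + 1) ^ 2) ^ (k + 1) =
          Real.exp (2 * (((k : ℝ) + 1) * Real.log ((k : ℝ) + 1))) := by
        rw [← pow_mul, ← Real.exp_log hk, ← Real.exp_nat_mul, Real.exp_log hk]
        congr 1; push_cast; ring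
      rw [e2, ← Real.exp_add]
      congr 1; push_cast; ring
    simp only [e1]
    rw [← Real.exp_sum, Finset.sum_sub_distrib, Finset.sum_add_distrib, Finset.mul_sum,
      Finset.mul_sum]
    simp
  rw [e, ← Finset.prod_mul_distrib]
  refine Finset.prod_congr rfl fun k _ => ?_
  have e3 := mul_succ_add_eq (M2 := M2) (l := k + 1) (by lia)
  have e4 : Real.exp ((1 / 2 - M2) / ((k + 1 : ℕ) : ℝ) - 1) *
      Real.exp (1 - (1 / 2 - M2) / ((k + 1 : ℕ) : ℝ)) = 1 := by
    rw [← Real.exp_add, Real.exp_eq_one_iff]; ring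
  rw [e3, hemiFactor, mul_pow]
  push_cast at e4 ⊢
  linear_combination (-((1 + relShift M2 (k + 1)) ^ (k + 1) * (((k : ℝ) + 1) ^ 2) ^ (k + 1))) * e4

/-- The value of the determinant as an exponential times a finite part of the product of the
eigenvalues, together with its closed form by Barnes functions. -/
lemma exists_isZetaDeterminant (M2 : ℝ) {z z' : ℂ} (h1 : z + z' = 1) (h2 : z * z' = M2) :
    ∃ D : ℝ, IsZetaDeterminant M2 1 D ∧
      (∃ p₀ : ℕ, ∃ Y : ℝ, D = (∏ p ∈ Finset.range p₀, (hemiEigenvalue p + M2)) * Real.exp Y ∧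
        ∀ p, p₀ ≤ p → 0 < hemiEigenvalue p + M2) ∧
      (D : ℂ) = Complex.exp (-(1 / 2) * (Real.log (2 * Real.pi) : ℂ) + 1 / 4 -
        2 * deriv riemannZeta (-1) - (M2 : ℂ)) * (barnesG (1 + z) * barnesG (1 + z')) := by
  set n := max ⌈|M2|⌉₊ 4 with hndef
  have hn : |M2| ≤ n := (Nat.le_ceil _).trans (by exact_mod_cast le_max_left _ _)
  have hn4 : 4 ≤ n := le_max_right _ _
  obtain ⟨Z, hZ, S, hS, hd⟩ := exists_isZetaFunction hn hn4
  set Y : ℝ := -2 * (deriv riemannZeta (-1)).re -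
        2 * (∑ k ∈ Finset.range n, ((k : ℝ) + 1) * Real.log ((k : ℝ) + 1)) - 3 / 4 - n +
        (M2 - 1 / 2) * (Real.eulerMascheroniConstant - ∑ k ∈ Finset.range n, 1 / ((k : ℝ) + 1)) + S
    with hY
  refine ⟨(∏ p ∈ Finset.range (triangular n), (hemiEigenvalue p + M2)) * Real.exp Y,
    ⟨hemiEigenvalue, isDirichletSpectrum_hemiEigenvalue, triangular n, Z, hZ, ?_⟩,
    ⟨triangular n, Y, rfl, hZ.1⟩, ?_⟩
  · rw [hd]; push_cast; rfl
  · have hD : (∏ p ∈ Finset.range (triangular n), (hemiEigenvalue p + M2)) * Real.exp Y =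
        Real.exp (-2 * (deriv riemannZeta (-1)).re - 3 / 4 +
          (M2 - 1 / 2) * Real.eulerMascheroniConstant) *
        ((∏ k ∈ Finset.range n, hemiFactor M2 k) * Real.exp S) := by
      rw [prod_eigenvalue_eq, mul_assoc, ← Real.exp_add, mul_left_comm, ← Real.exp_add]
      congr 2
      rw [hY]; ring
    have hlim : Tendsto (fun N => ((∏ k ∈ Finset.range N, hemiFactor M2 k : ℝ) : ℂ)) atTop
        (𝓝 (((∏ k ∈ Finset.range n, hemiFactor M2 k) * Real.exp S : ℝ) : ℂ)) :=
      (continuous_ofReal.tendsto _).comp (tendsto_prod_hemiFactor hn hn4 hS)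
    -- The same partial products converge to the determinant and to the product of the two `G`s.
    have hG := (tendsto_barnesG z).mul (tendsto_barnesG z')
    have hG' := hlim.const_mul (barnesPrefactor z * barnesPrefactor z')
    have hGeq := tendsto_nhds_unique (hG.congr fun N => ?_) hG'
    · rw [hGeq, hD, ofReal_mul, ← mul_assoc]
      congr 1
      have h2pi : (2 * Real.pi : ℂ) ≠ 0 := by simp [Real.pi_ne_zero]
      have hlog : Complex.log (2 * Real.pi) = (Real.log (2 * Real.pi) : ℂ) := by
        rw [ofReal_log (by positivity)]; push_cast; rfl
      rw [barnesPrefactor, barnesPrefactor, cpow_def_of_ne_zero h2pi, cpow_def_of_ne_zero h2pi,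
        hlog, deriv_riemannZeta_neg_one_real]
      simp only [← Complex.exp_add, ofReal_exp]
      congr 1
      push_cast
      linear_combination (-(Real.log (2 * Real.pi) : ℂ) / 2 + 1 / 2 +
        (1 + Real.eulerMascheroniConstant) / 2 * (z + z' + 1)) * h1 -
        (1 + Real.eulerMascheroniConstant : ℂ) * h2
    · rw [mul_mul_mul_comm, ← Finset.prod_mul_distrib, ofReal_prod]
      congr 1
      exact Finset.prod_congr rfl fun k _ => barnesFactor_mul_barnesFactor h1 h2 k

theorem mainTheorem5 (M2 : ℝ) (w : ℂ) (hw : w ^ 2 = 1 - 4 * (M2 : ℂ)) :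
    IsZetaDeterminant M2 1 (detPlus M2 1) ∧
    (-2 < M2 → 0 < detPlus M2 1) ∧
    (-2 < M2 → M2 ≠ 0 →
      (Real.log (detPlus M2 1) : ℂ) =
        -(1 / 2) * (Real.log (2 * Real.pi) : ℂ) + 1 / 4 - 2 * deriv riemannZeta (-1) - (M2 : ℂ)
          - Complex.log (1 / (Real.pi : ℂ) * Complex.cos ((Real.pi : ℂ) / 2 * w))
          + Complex.log (barnesG (1 / 2 * (1 + w)) * barnesG (1 / 2 * (1 - w)))) ∧
    (M2 = 0 →
      (Real.log (detPlus M2 1) : ℂ) =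
        -(1 / 2) * (Real.log (2 * Real.pi) : ℂ) + 1 / 4 - 2 * deriv riemannZeta (-1)) ∧
    ((∀ k : ℕ, M2 ≠ -((k : ℝ) * (k + 1))) →
      (detPlus M2 1 : ℂ) =
        Complex.exp (-(1 / 2) * (Real.log (2 * Real.pi) : ℂ) + 1 / 4 - 2 * deriv riemannZeta (-1)
          - (M2 : ℂ)) *
        (barnesG (1 / 2 * (1 + w)) * barnesG (1 / 2 * (1 - w))) /
          (1 / (Real.pi : ℂ) * Complex.cos ((Real.pi : ℂ) / 2 * w))) ∧
    (∀ k : ℕ, 1 ≤ k → M2 = -((k : ℝ) * (k + 1)) → detPlus M2 1 = 0) := by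
  obtain ⟨D, hD, ⟨p₀, Y, hDY, hpos⟩, hDG⟩ := exists_isZetaDeterminant M2
    (z := 1 / 2 * (1 + w)) (z' := 1 / 2 * (1 - w)) (by ring) (by linear_combination (-1 / 4) * hw)
  have hdet : IsZetaDeterminant M2 1 (detPlus M2 1) := Classical.epsilon_spec ⟨D, hD⟩
  rw [hdet.unique hD] at *
  set z : ℂ := 1 / 2 * (1 + w) with hz
  set z' : ℂ := 1 / 2 * (1 - w) with hz'
  set Q : ℂ := 1 / (Real.pi : ℂ) * Complex.cos ((Real.pi : ℂ) / 2 * w) with hQ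
  set c : ℝ := -(1 / 2) * Real.log (2 * Real.pi) + 1 / 4 - 2 * (deriv riemannZeta (-1)).re - M2
    with hc
  have hcC : -(1 / 2) * (Real.log (2 * Real.pi) : ℂ) + 1 / 4 - 2 * deriv riemannZeta (-1) -
      (M2 : ℂ) = (c : ℂ) := by
    rw [deriv_riemannZeta_neg_one_real, hc]; push_cast; ring
  rw [hcC] at hDG
  have hlam : ∀ p, 2 ≤ hemiEigenvalue p := by
    intro p
    have : (1 : ℝ) ≤ eigenDegree p := by exact_mod_cast one_le_eigenDegree p
    rw [hemiEigenvalue]; nlinarith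
  have hDpos : -2 < M2 → 0 < D := by
    intro h
    rw [hDY]
    refine mul_pos (Finset.prod_pos fun p _ => ?_) (Real.exp_pos _)
    have := hlam p
    linarith
  -- Away from the poles of the Gamma factors, the functional equation lowers both arguments by `1`.
  have hform : (∀ k : ℕ, M2 ≠ -((k : ℝ) * (k + 1))) → Q ≠ 0 ∧
      (D : ℂ) = Complex.exp c * (barnesG z * barnesG z') / Q := by
    intro hk
    have hzz : z' = 1 - z := by rw [hz, hz']; ring
    have hM : z * z' = M2 := by rw [hz, hz']; linear_combination (-1 / 4) * hw
    have key : ∀ u u' : ℂ, u' = 1 - u → u * u' = M2 → ∀ k : ℕ, u ≠ -k := by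
      rintro u u' rfl h k rfl
      refine hk k ?_
      have : ((M2 : ℝ) : ℂ) = ((-((k : ℝ) * (k + 1)) : ℝ) : ℂ) := by
        rw [← h]; push_cast; ring
      exact_mod_cast this
    have hz1 := key z z' hzz hM
    have hz2 := key z' z (by rw [hzz]; ring) (by rw [mul_comm]; exact hM)
    have hpi : (Real.pi : ℂ) ≠ 0 := ofReal_ne_zero.2 Real.pi_ne_zero
    have hGam : Complex.Gamma z * Complex.Gamma z' * Q = 1 := by
      have hsin : Complex.sin (Real.pi * z) = Complex.cos ((Real.pi : ℂ) / 2 * w) := by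
        rw [← Complex.sin_add_pi_div_two, hz]; congr 1; ring
      have hne : Complex.Gamma z * Complex.Gamma z' ≠ 0 :=
        mul_ne_zero (Complex.Gamma_ne_zero hz1) (Complex.Gamma_ne_zero hz2)
      rw [hzz, Complex.Gamma_mul_Gamma_one_sub, hsin] at hne
      have hc0 : Complex.cos ((Real.pi : ℂ) / 2 * w) ≠ 0 := fun h => hne (by rw [h, div_zero])
      rw [hzz, Complex.Gamma_mul_Gamma_one_sub, hsin, hQ]
      generalize Complex.cos ((Real.pi : ℂ) / 2 * w) = C at hc0 ⊢
      field_simp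
    have hQ0 : Q ≠ 0 := right_ne_zero_of_mul_eq_one hGam
    refine ⟨hQ0, ?_⟩
    rw [hDG, barnesG_add_one hz1, barnesG_add_one hz2, eq_div_iff hQ0]
    linear_combination (Complex.exp c * barnesG z * barnesG z') * hGam
  refine ⟨hD, hDpos, fun h hM0 => ?_, fun hM0 => ?_, fun hk => ?_, fun k hk hM => ?_⟩
  · obtain ⟨hQ0, hDQ⟩ := hform fun k hk => by
      rcases k with _ | k
      · simp at hk; exact hM0 hk
      · push_cast at hk
        have : (0 : ℝ) ≤ k := Nat.cast_nonneg k
        nlinarith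
    -- The product of the two `G`s is a positive multiple of `Q`, so their logarithms have the same
    -- imaginary part.
    have hr : 0 < D * Real.exp (-c) := mul_pos (hDpos h) (Real.exp_pos _)
    have hGG : barnesG z * barnesG z' = ((D * Real.exp (-c) : ℝ) : ℂ) * Q := by
      have he : Complex.exp c * Complex.exp (-c) = 1 := by
        rw [← Complex.exp_add, add_neg_cancel, Complex.exp_zero]
      rw [eq_div_iff hQ0] at hDQ
      push_cast
      linear_combination (-(barnesG z * barnesG z')) * he - Complex.exp (-c) * hDQ
    rw [hGG, hcC, Complex.log_ofReal_mul hr hQ0, Real.log_mul (hDpos h).ne' (Real.exp_pos _).ne',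
      Real.log_exp]
    push_cast
    ring
  · subst hM0
    have hw1 : (w - 1) * (w + 1) = 0 := by
      push_cast at hw; linear_combination hw
    have hG1 : barnesG (1 + z) * barnesG (1 + z') = 1 := by
      rcases mul_eq_zero.1 hw1 with h | h
      · have hw' : w = 1 := by linear_combination h
        rw [hz, hz', hw']; norm_num [barnesG_one, barnesG_two]
      · have hw' : w = -1 := by linear_combination h
        rw [hz, hz', hw']; norm_num [barnesG_one, barnesG_two]
    rw [hG1, mul_one, ← ofReal_exp] at hDG
    have hDc : D = Real.exp c := by exact_mod_cast hDG
    rw [hDc, Real.log_exp, ← hcC]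
    simp
  · rw [hcC]; exact (hform hk).2
  · -- The eigenvalue of index `k (k - 1) / 2` has degree `k`, so one factor of `D` vanishes.
    obtain ⟨m, rfl⟩ := Nat.exists_eq_add_of_le' hk
    have hdeg : eigenDegree (triangular m) = m + 1 := by
      rw [eigenDegree_eq_succ_iff, triangular_succ]; lia
    have hzero : hemiEigenvalue (triangular m) + M2 = 0 := by
      rw [hemiEigenvalue, hdeg, hM]; ring
    have hlt : triangular m < p₀ := by
      by_contra! h
      exact (hpos _ h).ne' hzero
    rw [hDY, Finset.prod_eq_zero (Finset.mem_range.2 hlt) hzero, zero_mul]
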